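/- Let $\mathcal R\in C^1(\mathbb R^2,\mathbb R)$ and let $A:\mathbb R\to\mathbb R$ be locally Lipschitz with $A(0)=0$ and $\mathcal R(u,v)=0\Leftrightarrow v=A(u)$. Assume that for every $U_0\ge 0$ there are constants $g(U_0),h(U_0),\beta_0(U_0)$ with, for all $(u,v)\in[-U_0,U_0]\times\mathbb R$, $$|\partial_u\mathcal R(u,v)|\le g(U_0),\qquad 0<\beta_0(U_0)\le\partial_v\mathcal R(u,v)\le h(U_0).$$ Fix $N_0,B$ and consider initial data $u_0,v_0$ with $\|u_0\|_\infty,\|v_0\|_\infty\le N_0$ and $\|u_0\|_{BV},\|v_0\|_{BV}\le B$, where $\|f\|_{BV}=\|f\|_{L^1(\mathbb R)}+TV(f)$ (the data may depend on $\varepsilon$; only the bounds $N_0,B$ do not). For $a_0>0$ put $$U=\Big(1+\tfrac1{\sqrt{a_0}}\Big)N_0,\qquad F=\sup_{|\xi|\le U}|A(\xi)|,\qquad V=U+\tfrac1{\sqrt{a_0}}F,$$ and let $a,\beta$ satisfy $$\sqrt a>\max\Big\{\sqrt{a_0},\ \frac{g(V)}{\beta_0(V)}\Big\},\qquad \beta=h(V).$$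 For $\varepsilon>0$ consider the Cauchy problem on $[0,\infty)\times\mathbb R$ $$\partial_tu+\partial_xv=0,\qquad \partial_tv+a\,\partial_xu=-\tfrac1\varepsilon\mathcal R(u,v),\qquad u(0)=u_0,\ v(0)=v_0, \tag{1}$$ where a weak solution is a pair of functions in $C([0,\infty);L^1_{loc}(\mathbb R))$, bounded on $[0,T]\times\mathbb R$ for every $T$, satisfying (1) in the sense of distributions, with test functions in $C_c^\infty(\mathbb R\times\mathbb R)$ (not required to vanish at $t=0$). Let $\Delta t,\Delta x>0$ satisfy the CFL condition $\sqrt a\,\Delta t/\Delta x<1$. On a uniform grid with cells $C_j=\,]x_{j-1/2},x_{j+1/2}[$ of length $\Delta x$ ($j\in\mathbb Z$), set $u_j^0=\frac1{\Delta x}\int_{C_j}u_0$, $v_j^0=\frac1{\Delta x}\int_{C_j}v_0$ and, for $n\ge0$, $$u_j^{n+1/2}=u_j^n-\tfrac{\Delta t}{2\Delta x}\big[v_{j+1}^n-v_{j-1}^n-\sqrt a\,(u_{j+1}^n-2u_j^n+u_{j-1}^n)\big],$$ $$v_j^{n+1/2}=v_j^n-\tfrac{\Delta t}{2\Delta x}\big[a(u_{j+1}^n-u_{j-1}^n)-\sqrt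 a\,(v_{j+1}^n-2v_j^n+v_{j-1}^n)\big],$$ $$u_j^{n+1}=u_j^{n+1/2},$$ $$v_j^{n+1}=v_j^{n+1/2}-\big(v_j^{n+1/2}-A(u_j^{n+1/2})\big)\Big[1-\Big(1+\tfrac{\beta\Delta t}\varepsilon\Big)e^{-\beta\Delta t/\varepsilon}\Big]-\tfrac{\Delta t}\varepsilon e^{-\beta\Delta t/\varepsilon}\,\mathcal R\big(u_j^{n+1/2},v_j^{n+1/2}\big).$$ Let $u_h(t,x)=u_j^n$ and $v_h(t,x)=v_j^n$ for $x\in C_j$, $n\Delta t\le t<(n+1)\Delta t$, where $h=(\Delta t,\Delta x)$. **Theorem.** Problem (1) has a weak solution for every $\varepsilon>0$ and all such data. For every weak solution $(u,v)$ of (1): 1. for fixed $\varepsilon>0$, $(u_h,v_h)\to(u,v)$ in $L^1_{loc}([0,\infty)\times\mathbb R)$ as $h\to(0,0)$ under the CFL condition (in particular the weak solution is unique); 2. for all $T$ and $M$ there is a constant $C$, depending only on $T,M,N_0,B,a_0,a,\mathcal R,A,g,h,\beta_0$, such that for all $0<\varepsilon\le M$, all such data, all grids and steps satisfying the CFL condition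 with $\Delta x\le M$, and all $t\in[0,T]$, $$\|u_h(t)-u(t)\|_{1}+\|v_h(t)-v(t)\|_{1}\le\frac{C}{\varepsilon}\Big(\Delta t\Big(\frac{\|\delta^0\|_1}{\varepsilon}+1\Big)+\Delta x^{1/2}\Big),\qquad \delta^0=v_0-A(u_0).$$ -/

import Mathlib

open MeasureTheory Set Filter Topology
open scoped ENNReal NNReal ContDiff

namespace RelaxationAP

noncomputable section

/-! ### Structural assumptions and the bounds attached to the initial data -/

/-- The source term `R` is `C¹`, its zero set is the graph `v = A u`, the equilibrium map `A` is
locally Lipschitz with `A 0 = 0`, and on each strip `|u| ≤ U₀` (with `v` arbitrary) one has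
`|∂ᵤR| ≤ g U₀` and `0 < β₀ U₀ ≤ ∂ᵥR ≤ h U₀`. -/
structure IsRelaxationTerm (R : ℝ → ℝ → ℝ) (A g h β₀ : ℝ → ℝ) : Prop where
  contDiff : ContDiff ℝ 1 (fun p : ℝ × ℝ => R p.1 p.2)
  equilibrium : ∀ u v, R u v = 0 ↔ v = A u
  lipschitz : LocallyLipschitz A
  map_zero : A 0 = 0
  deriv_u : ∀ U₀, 0 ≤ U₀ → ∀ u ∈ Icc (-U₀) U₀, ∀ v, |deriv (fun s => R s v) u| ≤ g U₀
  pos : ∀ U₀, 0 ≤ U₀ → 0 < β₀ U₀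
  deriv_v : ∀ U₀, 0 ≤ U₀ → ∀ u ∈ Icc (-U₀) U₀, ∀ v,
    β₀ U₀ ≤ deriv (fun s => R u s) v ∧ deriv (fun s => R u s) v ≤ h U₀

/-- `U(N, α) = (1 + 1/√α) N`. -/
def boundU (N α : ℝ) : ℝ := (1 + 1 / √α) * N

/-- `F(N, α) = sup {|A ξ| : |ξ| ≤ U(N, α)}`. -/
def boundF (A : ℝ → ℝ) (N α : ℝ) : ℝ :=
  sSup ((fun ξ => |A ξ|) '' Icc (-boundU N α) (boundU N α))

/-- `V(N, α) = U(N, α) + F(N, α)/√α`. -/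
def boundV (A : ℝ → ℝ) (N α : ℝ) : ℝ := boundU N α + 1 / √α * boundF A N α

/-- Total variation over `ℝ` of an almost-everywhere class: the essential variation, i.e. the
infimum of the pointwise variations of its representatives. -/
def totalVariation (f : ℝ → ℝ) : ℝ≥0∞ :=
  ⨅ (f' : ℝ → ℝ) (_ : f' =ᵐ[volume] f), eVariationOn f' univ

/-- `f ∈ L^∞ ∩ BV(ℝ)` with `‖f‖_∞ ≤ N` and `‖f‖_BV = ‖f‖₁ + TV(f) ≤ B`. -/
structure IsDatum (N : ℝ) (B : ℝ≥0) (f : ℝ → ℝ) : Prop where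
  aestronglyMeasurable : AEStronglyMeasurable f volume
  bounded : ∀ᵐ x, |f x| ≤ N
  bv : eLpNorm f 1 volume + totalVariation f ≤ B

/-! ### Weak solutions of the relaxation system -/

/-- `f ∈ C([0, ∞); L¹_loc(ℝ))`, with `f` jointly measurable and bounded on `[0, T] × ℝ` for
every `T`. -/
structure IsBoundedCurve (f : ℝ → ℝ → ℝ) : Prop where
  aestronglyMeasurable :
    AEStronglyMeasurable (fun p : ℝ × ℝ => f p.1 p.2) (volume.restrict (Ici 0 ×ˢ univ))
  aestronglyMeasurable_slice : ∀ t, 0 ≤ t → AEStronglyMeasurable (f t) volume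
  bounded : ∀ T, ∃ K : ℝ, ∀ t ∈ Icc 0 T, ∀ᵐ x, |f t x| ≤ K
  continuous : ∀ t, 0 ≤ t → ∀ L : ℝ,
    Tendsto (fun s => ∫⁻ x in Icc (-L) L, ‖f s x - f t x‖ₑ) (𝓝[Ici 0] t) (𝓝 0)

/-- `(u, v)` is a bounded weak solution in `C([0, ∞); L¹_loc)` of the Cauchy problem
`∂ₜu + ∂ₓv = 0`, `∂ₜv + a ∂ₓu = -R(u, v)/ε`, `u(0) = u₀`, `v(0) = v₀`.
The test functions need not vanish at `t = 0`, which encodes the initial condition. -/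
structure IsWeakSolution (R : ℝ → ℝ → ℝ) (a ε : ℝ) (u₀ v₀ : ℝ → ℝ) (u v : ℝ → ℝ → ℝ) :
    Prop where
  curve_u : IsBoundedCurve u
  curve_v : IsBoundedCurve v
  eq_u : ∀ φ : ℝ × ℝ → ℝ, ContDiff ℝ ∞ φ → HasCompactSupport φ →
    (∫ p in Ioi (0 : ℝ) ×ˢ (univ : Set ℝ),
        (u p.1 p.2 * fderiv ℝ φ p (1, 0) + v p.1 p.2 * fderiv ℝ φ p (0, 1)))
      + ∫ x, u₀ x * φ (0, x) = 0
  eq_v : ∀ φ : ℝ × ℝ → ℝ, ContDiff ℝ ∞ φ → HasCompactSupport φ →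
    (∫ p in Ioi (0 : ℝ) ×ˢ (univ : Set ℝ),
        (v p.1 p.2 * fderiv ℝ φ p (1, 0) + a * u p.1 p.2 * fderiv ℝ φ p (0, 1)
          - 1 / ε * R (u p.1 p.2) (v p.1 p.2) * φ p))
      + ∫ x, v₀ x * φ (0, x) = 0

/-! ### The splitting scheme -/

/-- Positive steps with `0 < √a Δt / Δx < 1`. -/
def CFL (a Δt Δx : ℝ) : Prop := 0 < Δt ∧ 0 < Δx ∧ √a * Δt / Δx < 1

/-- The cell `C_j = ]x_{j-1/2}, x_{j+1/2}[` of the uniform grid `x_{j+1/2} = ξ + (j + 1/2) Δx`. -/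
def cell (ξ Δx : ℝ) (j : ℤ) : Set ℝ :=
  Ioo (ξ + ((j : ℝ) - 1 / 2) * Δx) (ξ + ((j : ℝ) + 1 / 2) * Δx)

/-- Cell averages. -/
def cellAverage (ξ Δx : ℝ) (f : ℝ → ℝ) (j : ℤ) : ℝ := 1 / Δx * ∫ x in cell ξ Δx j, f x

/-- The discrete derivative `D_h v_j`. -/
def discreteDv (a Δx : ℝ) (u v : ℤ → ℝ) (j : ℤ) : ℝ :=
  1 / (2 * Δx) * ((v (j + 1) - v (j - 1)) - √a * (u (j + 1) - 2 * u j + u (j - 1)))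

/-- The discrete derivative `a D_h u_j`. -/
def discreteADu (a Δx : ℝ) (u v : ℤ → ℝ) (j : ℤ) : ℝ :=
  1 / (2 * Δx) * (a * (u (j + 1) - u (j - 1)) - √a * (v (j + 1) - 2 * v j + v (j - 1)))

/-- Explicit finite volume step for the linear transport part:
`(u^n, v^n) ↦ (u^{n+1/2}, v^{n+1/2})`. -/
def transportStep (a Δt Δx : ℝ) (s : (ℤ → ℝ) × (ℤ → ℝ)) : (ℤ → ℝ) × (ℤ → ℝ) :=
  (fun j => s.1 j - Δt * discreteDv a Δx s.1 s.2 j,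
   fun j => s.2 j - Δt * discreteADu a Δx s.1 s.2 j)

/-- Exponential step for the stiff part: `(u^{n+1/2}, v^{n+1/2}) ↦ (u^{n+1}, v^{n+1})`. -/
def relaxationStep (R : ℝ → ℝ → ℝ) (A : ℝ → ℝ) (β ε Δt : ℝ) (s : (ℤ → ℝ) × (ℤ → ℝ)) :
    (ℤ → ℝ) × (ℤ → ℝ) :=
  (s.1,
   fun j => s.2 j
     - (s.2 j - A (s.1 j)) * (1 - (1 + β * Δt / ε) * Real.exp (-(β * Δt / ε)))
     - Δt / ε * Real.exp (-(β * Δt / ε)) * R (s.1 j) (s.2 j))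

/-- The sequence `n ↦ ((u_j^n)_j, (v_j^n)_j)` produced by the scheme. -/
def scheme (R : ℝ → ℝ → ℝ) (A : ℝ → ℝ) (a β ε ξ Δt Δx : ℝ) (u₀ v₀ : ℝ → ℝ) :
    ℕ → (ℤ → ℝ) × (ℤ → ℝ)
  | 0 => (cellAverage ξ Δx u₀, cellAverage ξ Δx v₀)
  | n + 1 => relaxationStep R A β ε Δt
      (transportStep a Δt Δx (scheme R A a β ε ξ Δt Δx u₀ v₀ n))

/-- The piecewise constant function
`∑ₙ ∑ⱼ c_j^n 1_{C_j}(x) 1_{[t^n, t^{n+1}[}(t)`, `t^n = n Δt`.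
At every `(t, x)` at most one term is nonzero. -/
def piecewiseConst (ξ Δt Δx : ℝ) (c : ℕ → ℤ → ℝ) (t x : ℝ) : ℝ :=
  ∑' n : ℕ, ∑' j : ℤ,
    c n j * (cell ξ Δx j).indicator 1 x
      * (Ico ((n : ℝ) * Δt) (((n : ℝ) + 1) * Δt)).indicator 1 t

/-- The numerical solution `u_h`. -/
def numU (R : ℝ → ℝ → ℝ) (A : ℝ → ℝ) (a β ε ξ Δt Δx : ℝ) (u₀ v₀ : ℝ → ℝ) : ℝ → ℝ → ℝ :=
  piecewiseConst ξ Δt Δx (fun n => (scheme R A a β ε ξ Δt Δx u₀ v₀ n).1)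

/-- The numerical solution `v_h`. -/
def numV (R : ℝ → ℝ → ℝ) (A : ℝ → ℝ) (a β ε ξ Δt Δx : ℝ) (u₀ v₀ : ℝ → ℝ) : ℝ → ℝ → ℝ :=
  piecewiseConst ξ Δt Δx (fun n => (scheme R A a β ε ξ Δt Δx u₀ v₀ n).2)

end

end RelaxationAP

namespace RelaxationAP

/-! ### Global solutions of Lipschitz ordinary differential equations -/

section GlobalODE

/-! With `c = √a` and `f₁ = (u + v/c)/2`, `f₂ = (u - v/c)/2`, the linear part of the system
translates `f₁` and `f₂` at speeds `c` and `-c`: a strongly continuous group `T` of isometries of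
`L¹ × L¹` with the sum norm. The source acts pointwise, by `N f = (-q, q)` with `q = R(u, v)/(2cε)`.
After `u` is clipped to `[-V, V]` inside `R` and `A`, the source is globally Lipschitz and the
subcharacteristic condition `|∂ᵤR| ≤ c b`, `b ≤ ∂ᵥR ≤ H` holds everywhere. A mild solution `T t (g
t)` then comes from an ordinary differential equation for `g` with a Lipschitz right-hand side.

Since `|f₁| + |f₂| = max |u| |v/c|`, the subcharacteristic condition says exactly that both the
explicit step `f + h N f` (for `h ≤ ε/H`) and the exponential relaxation step (for every time step)
are `L¹` contractions (`IsGlobalTerm.sub_decrement_abs_le`). Contraction and translation invariance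
show that the flow preserves the `L¹` modulus of translation, which replaces the `BV` bound. The
source damps the distance to equilibrium `‖v - A u‖₁` at rate `b/ε` while transport regenerates it
at a bounded rate, so it stays below its initial value plus `O(ε)` (`defect_flow_le`). This is what
controls the powers of `1/ε`.

In the variables `f` the scheme is an upwind step `(1 - l) f + l T(k) f`, with `k = Δx/c` and `l k =
Δt`, followed by a contraction (`Represents.schemeStep`). It is therefore stable, and its local
errors may be summed. The solution is only of bounded variation, so the scheme is compared with the
exact solution averaged along `T` over a time `η`: the averaging costs `O(η)`, and the accumulated
upwind error is `O(Δx/η)`. The choice `η = √Δx/c` gives the rate `√Δx`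
(`norm_iterate_splitStep_sub_le`, `exists_schemeStep_error`).

It remains to return to the original problem. Comparison with spatially constant states bounds the
clipped scheme in the supremum norm (`scheme_bound`). The bound passes to the limit (`flow_bounds`),
so the clipping is never active, and the mild solution is a weak solution of the original system
(`exists_isWeakSolution`). Conversely, a bounded weak solution satisfies integral equations along
characteristics, and Grönwall's inequality in a weighted `L¹` space gives uniqueness
(`IsWeakSolution.unique`). Hence every weak solution is the mild one; the error estimate applies to
it, and convergence follows. -/

theorem continuous_comp_of_lipschitz {X : Type*} [NormedAddCommGroup X] {Φ : ℝ → X → X} {K : ℝ≥0}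
    (hΦ : ∀ x, Continuous fun t => Φ t x)
    (hK : ∀ t, LipschitzWith K (Φ t)) {g : ℝ → X} (hg : Continuous g) :
    Continuous fun t => Φ t (g t) := by
  have h := continuous_prod_of_continuous_lipschitzWith' (fun p : ℝ × X => Φ p.1 p.2) K hK hΦ
  exact h.comp (continuous_id.prodMk hg)

variable {X : Type*} [NormedAddCommGroup X] [NormedSpace ℝ X]

/-- A globally Lipschitz, time continuous vector field vanishing at the origin has a global
integral curve on `[0, ∞)` through each point. -/
theorem exists_global_solution [CompleteSpace X] {Φ : ℝ → X → X} {K : ℝ≥0}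
    (hΦ : ∀ x, Continuous fun t => Φ t x) (hK : ∀ t, LipschitzWith K (Φ t)) (h0 : ∀ t, Φ t 0 = 0)
    (x₀ : X) : ∃ g : ℝ → X, g 0 = x₀ ∧ Continuous g ∧ ∀ t, 0 ≤ t → HasDerivAt g (Φ t (g t)) t := by
  -- The unknown is `y t = exp (-l t) • g t`: the supremum norm of `y` is a weighted norm of `g` in
  -- which the Picard map contracts by `K / l ≤ 1/2` on the whole half-line at once.
  set l : ℝ := 2 * K + 1 with hl
  have hl0 : 0 < l := by positivity
  have hKl : (K : ℝ) / l ≤ 1 / 2 := by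
    rw [div_le_div_iff₀ hl0 two_pos]; rw [hl]; linarith
  have hnorm : ∀ t x y, ‖Φ t x - Φ t y‖ ≤ K * ‖x - y‖ := fun t x y => (hK t).norm_sub_le x y
  have hw : Continuous fun t : ℝ => Real.exp (l * t) := by fun_prop
  have hcont : ∀ y : ℝ → X, Continuous y → Continuous fun s => Φ s (Real.exp (l * s) • y s) :=
    fun y hy => continuous_comp_of_lipschitz hΦ hK (hw.smul hy)
  have hexp : ∀ C t : ℝ, 0 ≤ t → ∫ s in (0 : ℝ)..t, C * Real.exp (l * s)
      = C / l * (Real.exp (l * t) - 1) := by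
    intro C t _
    rw [intervalIntegral.integral_const_mul, intervalIntegral.integral_comp_mul_left _ hl0.ne']
    simp
    ring
  have hest : ∀ y z : ℝ → X, Continuous y → Continuous z → ∀ C, 0 ≤ C → (∀ s, ‖y s - z s‖ ≤ C) →
      ∀ t, ‖Real.exp (-(l * max t 0)) • ((∫ s in (0 : ℝ)..max t 0, Φ s (Real.exp (l * s) • y s)) -
        ∫ s in (0 : ℝ)..max t 0, Φ s (Real.exp (l * s) • z s))‖ ≤ C / 2 := by
    intro y z hy hz C hC hyz t
    have ht : 0 ≤ max t 0 := le_max_right _ _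
    set τ := max t 0
    rw [← intervalIntegral.integral_sub ((hcont y hy).intervalIntegrable _ _)
      ((hcont z hz).intervalIntegrable _ _), norm_smul, Real.norm_of_nonneg (Real.exp_pos _).le]
    have h1 : ‖∫ s in (0 : ℝ)..τ, (Φ s (Real.exp (l * s) • y s) - Φ s (Real.exp (l * s) • z s))‖
        ≤ ∫ s in (0 : ℝ)..τ, (K * C) * Real.exp (l * s) := by
      refine intervalIntegral.norm_integral_le_of_norm_le ht (Eventually.of_forall fun s _ => ?_)
        ((Continuous.intervalIntegrable (by fun_prop) _ _))
      refine (hnorm _ _ _).trans ?_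
      rw [← smul_sub, norm_smul, Real.norm_of_nonneg (Real.exp_pos _).le]
      calc (K : ℝ) * (Real.exp (l * s) * ‖y s - z s‖) ≤ K * (Real.exp (l * s) * C) := by
            gcongr
            exact hyz s
        _ = _ := by ring
    rw [hexp _ _ ht] at h1
    calc Real.exp (-(l * τ)) * _ ≤ Real.exp (-(l * τ)) * (K * C / l * (Real.exp (l * τ) - 1)) := by
          gcongr
      _ = K / l * C * (1 - Real.exp (-(l * τ))) := by
          rw [Real.exp_neg]; field_simp
      _ ≤ 1 / 2 * C * 1 := by
          gcongr
          · have : Real.exp (-(l * τ)) ≤ 1 := Real.exp_le_one_iff.2 (by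
              have := mul_nonneg hl0.le ht
              linarith)
            linarith
          · linarith [Real.exp_pos (-(l * τ))]
      _ = C / 2 := by ring
  -- Freezing time at `0` for negative arguments keeps the image bounded on all of `ℝ`.
  have hPc : ∀ y : ℝ → X, Continuous y → Continuous fun t => Real.exp (-(l * max t 0)) •
      (x₀ + ∫ s in (0 : ℝ)..max t 0, Φ s (Real.exp (l * s) • y s)) := by
    intro y hy
    have h1 : Continuous fun t : ℝ => ∫ s in (0 : ℝ)..t, Φ s (Real.exp (l * s) • y s) :=
      intervalIntegral.continuous_primitive (fun a b => (hcont y hy).intervalIntegrable a b) 0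
    have h2 : Continuous fun t : ℝ => max t 0 := by fun_prop
    exact (by fun_prop : Continuous fun t : ℝ => Real.exp (-(l * max t 0))).smul
      (continuous_const.add (h1.comp h2))
  have hPb : ∀ y : BoundedContinuousFunction ℝ X, ∀ t, ‖Real.exp (-(l * max t 0)) •
      (x₀ + ∫ s in (0 : ℝ)..max t 0, Φ s (Real.exp (l * s) • y s))‖ ≤ ‖x₀‖ + ‖y‖ / 2 := by
    intro y t
    have h1 := hest y 0 y.continuous continuous_zero ‖y‖ (norm_nonneg _)
      (fun s => by simpa using y.norm_coe_le_norm s) t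
    simp only [Pi.zero_apply, smul_zero, h0, intervalIntegral.integral_zero, sub_zero] at h1
    rw [smul_add]
    refine (norm_add_le _ _).trans (add_le_add ?_ h1)
    rw [norm_smul, Real.norm_of_nonneg (Real.exp_pos _).le]
    refine mul_le_of_le_one_left (norm_nonneg _) (Real.exp_le_one_iff.2 ?_)
    have := mul_nonneg hl0.le (le_max_right t 0)
    linarith
  let P : BoundedContinuousFunction ℝ X → BoundedContinuousFunction ℝ X := fun y =>
    BoundedContinuousFunction.ofNormedAddCommGroup _ (hPc y y.continuous) _ (hPb y)
  have hP : ContractingWith (1 / 2) P := by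
    refine ⟨by
      rw [← NNReal.coe_lt_coe]; norm_num, LipschitzWith.of_dist_le_mul fun y z => ?_⟩
    rw [BoundedContinuousFunction.dist_le (by positivity)]
    intro t
    have h1 := hest y z y.continuous z.continuous (dist y z) dist_nonneg
      (fun s => by rw [← dist_eq_norm]; exact BoundedContinuousFunction.dist_coe_le_dist s) t
    rw [dist_eq_norm]
    change ‖Real.exp (-(l * max t 0)) • (x₀ + _) - Real.exp (-(l * max t 0)) • (x₀ + _)‖ ≤ _
    rw [← smul_sub, add_sub_add_left_eq_sub]
    refine h1.trans (le_of_eq ?_)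
    push_cast
    ring
  set y := ContractingWith.fixedPoint P hP with hy
  have hfix : P y = y := hP.fixedPoint_isFixedPt
  have hyt : ∀ t, 0 ≤ t → Real.exp (l * t) • y t =
      x₀ + ∫ s in (0 : ℝ)..t, Φ s (Real.exp (l * s) • y s) := by
    intro t ht
    have h1 : P y t = Real.exp (-(l * max t 0)) •
      (x₀ + ∫ s in (0 : ℝ)..max t 0, Φ s (Real.exp (l * s) • y s)) := rfl
    rw [hfix, max_eq_left ht] at h1
    rw [h1, smul_smul, ← Real.exp_add]
    simp
  have hd : ∀ t, HasDerivAt (fun t => x₀ + ∫ s in (0 : ℝ)..t, Φ s (Real.exp (l * s) • y s))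
      (Φ t (Real.exp (l * t) • y t)) t := fun t =>
    ((hcont y y.continuous).integral_hasStrictDerivAt 0 t).hasDerivAt.const_add x₀
  -- The primitive, rather than `exp (l t) • y t`, is taken as the solution because it is
  -- differentiable from both sides at `t = 0`.
  refine ⟨fun t => x₀ + ∫ s in (0 : ℝ)..t, Φ s (Real.exp (l * s) • y s), by simp,
    continuous_iff_continuousAt.2 fun t => (hd t).continuousAt, fun t ht => ?_⟩
  have := hd t
  rwa [hyt t ht] at this

end GlobalODE

/-! ### Semilinear evolutions driven by a group of isometries -/

section Semilinear

variable {X : Type*} [NormedAddCommGroup X] [NormedSpace ℝ X]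

/-- A strongly continuous one-parameter group of linear isometries. -/
structure IsIsometryGroup (T : ℝ → X →ₗᵢ[ℝ] X) : Prop where
  add : ∀ s t f, T (s + t) f = T s (T t f)
  zero : ∀ f, T 0 f = f
  continuous : ∀ f, Continuous fun t => T t f

namespace IsIsometryGroup

variable {T : ℝ → X →ₗᵢ[ℝ] X} (hT : IsIsometryGroup T)
include hT

theorem neg_apply (t : ℝ) (f : X) : T (-t) (T t f) = f := by
  rw [← hT.add, neg_add_cancel, hT.zero]

theorem apply_neg (t : ℝ) (f : X) : T t (T (-t) f) = f := by
  rw [← hT.add, add_neg_cancel, hT.zero]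

theorem continuous_apply {g : ℝ → X} (hg : Continuous g) : Continuous fun t => T t (g t) :=
  continuous_comp_of_lipschitz hT.continuous (fun t => (T t).lipschitz) hg

theorem norm_sub (s t : ℝ) (f : X) : ‖T s f - T t f‖ = ‖T (s - t) f - f‖ := by
  rw [← (T t).norm_map (T (s - t) f - f), map_sub, ← hT.add, add_sub_cancel]

end IsIsometryGroup

/-- `g` is the solution of `f' = A f + N f`, `A` the generator of `T`, read off along `T`:
`f t = T t (g t)`. -/
def IsMildCurve (T : ℝ → X →ₗᵢ[ℝ] X) (N : X → X) (g : ℝ → X) : Prop :=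
  ∀ t, 0 ≤ t → HasDerivAt g (T (-t) (N (T t (g t)))) t

/-- `f` moves by at most `D * |y|` under `Y y`. -/
def TransLip (Y : ℝ → X →ₗᵢ[ℝ] X) (D : ℝ) (f : X) : Prop := ∀ y, ‖Y y f - f‖ ≤ D * |y|

variable {T Y : ℝ → X →ₗᵢ[ℝ] X} {N : X → X} {K : ℝ≥0}

/-- Reading the solution off along `T` removes the unbounded generator: what remains is a
differential equation whose field `T (-t) ∘ N ∘ T t` has the Lipschitz constant of `N`. -/
theorem exists_isMildCurve [CompleteSpace X] (hT : IsIsometryGroup T) (hN : LipschitzWith K N)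
    (hN0 : N 0 = 0) (f₀ : X) : ∃ g : ℝ → X, g 0 = f₀ ∧ Continuous g ∧ IsMildCurve T N g := by
  refine exists_global_solution (Φ := fun t x => T (-t) (N (T t x))) (K := K) (fun x => ?_)
    (fun t => ?_) (fun t => by simp [hN0]) f₀
  · have h1 : Continuous fun t => N (T t x) := hN.continuous.comp (hT.continuous x)
    exact continuous_comp_of_lipschitz (Φ := fun t x => T (-t) x) (K := 1)
      (fun x => (hT.continuous x).comp continuous_neg) (fun t => (T (-t)).lipschitz) h1
  · have := (T (-t)).lipschitz.comp (hN.comp (T t).lipschitz)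
    rw [one_mul, mul_one] at this
    exact this

/-- A continuous functional of a curve is bounded by `B` provided its right Dini derivative is
nonpositive. -/
theorem le_of_right_increment_le {m : ℝ → ℝ} (hm : ContinuousOn m (Ici 0))
    (hinc : ∀ t, 0 ≤ t → ∀ r, 0 < r → ∀ᶠ z in 𝓝[>] t, m z ≤ m t + r * (z - t)) {t : ℝ} (ht : 0 ≤ t) :
    m t ≤ m 0 := by
  refine image_le_of_liminf_slope_right_le_deriv_boundary (f := m) (a := 0) (b := t)
    (B := fun _ => m 0) (B' := fun _ => 0) (hm.mono Icc_subset_Ici_self) le_rfl continuousOn_const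
    (fun x _ => hasDerivWithinAt_const _ _ _) (fun x hx r hr => ?_) ⟨ht, le_rfl⟩
  refine Eventually.frequently ?_
  filter_upwards [hinc x hx.1 (r / 2) (half_pos hr), self_mem_nhdsWithin] with z hz hz'
  have hz' : 0 < z - x := sub_pos.2 hz'
  rw [slope_def_field, div_lt_iff₀ hz']
  nlinarith

theorem eventually_norm_sub_le {E : Type*} [NormedAddCommGroup E] [NormedSpace ℝ E] {g : ℝ → E}
    {g' : E} {t : ℝ} (hg : HasDerivAt g g' t) {r : ℝ} (hr : 0 < r) :
    ∀ᶠ z in 𝓝[>] t, ‖g z - g t - (z - t) • g'‖ ≤ r * (z - t) := by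
  have h1 := (hasDerivAt_iff_isLittleO.1 hg).def hr
  filter_upwards [nhdsWithin_le_nhds h1, self_mem_nhdsWithin] with z hz hz'
  rwa [Real.norm_of_nonneg (sub_nonneg.2 (le_of_lt hz'))] at hz

theorem eventually_sub_le_nhdsGT {t h₀ : ℝ} (h : 0 < h₀) :
    ∀ᶠ z in 𝓝[>] t, 0 < z - t ∧ z - t ≤ h₀ := by
  filter_upwards [Ioc_mem_nhdsGT (show t < t + h₀ by linarith)] with z hz
  exact ⟨by linarith [hz.1], by linarith [hz.2]⟩

namespace IsMildCurve

variable {g g₁ g₂ : ℝ → X}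

theorem continuousOn (hg : IsMildCurve T N g) : ContinuousOn g (Ici 0) := fun t ht =>
  (hg t ht).continuousAt.continuousWithinAt

/-- Contraction: the flow of a dissipative semilinear evolution does not expand distances. -/
theorem norm_sub_le (hT : IsIsometryGroup T) {h₀ : ℝ} (h₀pos : 0 < h₀)
    (hdiss : ∀ h, 0 < h → h ≤ h₀ → ∀ f f', ‖(f + h • N f) - (f' + h • N f')‖ ≤ ‖f - f'‖)
    (hg₁ : IsMildCurve T N g₁) (hg₂ : IsMildCurve T N g₂) {t : ℝ} (ht : 0 ≤ t) :
    ‖g₁ t - g₂ t‖ ≤ ‖g₁ 0 - g₂ 0‖ := by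
  refine le_of_right_increment_le (m := fun t => ‖g₁ t - g₂ t‖)
    (hg₁.continuousOn.sub hg₂.continuousOn).norm (fun s hs r hr => ?_) ht
  filter_upwards [eventually_norm_sub_le ((hg₁ s hs).sub (hg₂ s hs)) hr,
    eventually_sub_le_nhdsGT h₀pos (t := s)] with z hz hzh
  have h1 := hdiss (z - s) hzh.1 hzh.2 (T s (g₁ s)) (T s (g₂ s))
  -- To first order the difference at time `z` is the isometric image of a difference of two
  -- explicit Euler steps, which `hdiss` controls.
  have h2 : (g₁ s - g₂ s) + (z - s) • (T (-s) (N (T s (g₁ s))) - T (-s) (N (T s (g₂ s)))) =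
      T (-s) ((T s (g₁ s) + (z - s) • N (T s (g₁ s))) -
        (T s (g₂ s) + (z - s) • N (T s (g₂ s)))) := by
    simp only [map_add, map_sub, map_smul, hT.neg_apply]
    module
  have h3 : ‖(g₁ s - g₂ s) + (z - s) • (T (-s) (N (T s (g₁ s))) - T (-s) (N (T s (g₂ s))))‖ ≤
      ‖g₁ s - g₂ s‖ := by
    rw [h2, LinearIsometry.norm_map]
    refine h1.trans (le_of_eq ?_)
    rw [← map_sub, LinearIsometry.norm_map]
  calc ‖g₁ z - g₂ z‖ = ‖((g₁ - g₂) z - (g₁ - g₂) s -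
        (z - s) • (T (-s) (N (T s (g₁ s))) - T (-s) (N (T s (g₂ s))))) +
        ((g₁ s - g₂ s) + (z - s) • (T (-s) (N (T s (g₁ s))) - T (-s) (N (T s (g₂ s)))))‖ := by
        congr 1; simp only [Pi.sub_apply]; module
    _ ≤ _ := (norm_add_le _ _).trans (by linarith)

/-- Applied to spatial translations, this makes the translate of a solution a solution, so that
contraction yields regularity in space. -/
theorem comp_isometry (hg : IsMildCurve T N g) {Φ : X →ₗᵢ[ℝ] X} (hΦT : ∀ t f, Φ (T t f) = T t (Φ f))
    (hΦN : ∀ f, N (Φ f) = Φ (N f)) : IsMildCurve T N fun t => Φ (g t) := fun t ht => by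
  have := Φ.toContinuousLinearMap.hasFDerivAt.comp_hasDerivAt t (hg t ht)
  rw [LinearIsometry.coe_toContinuousLinearMap, hΦT, ← hΦN, hΦT] at this
  exact this

/-- Translation moduli do not grow along the flow. -/
theorem transLip (hT : IsIsometryGroup T) {h₀ : ℝ} (h₀pos : 0 < h₀)
    (hdiss : ∀ h, 0 < h → h ≤ h₀ → ∀ f f', ‖(f + h • N f) - (f' + h • N f')‖ ≤ ‖f - f'‖)
    (hYT : ∀ y t f, Y y (T t f) = T t (Y y f)) (hYN : ∀ y f, N (Y y f) = Y y (N f))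
    (hg : IsMildCurve T N g) {D : ℝ} (hD : TransLip Y D (g 0)) {t : ℝ} (ht : 0 ≤ t) :
    TransLip Y D (T t (g t)) := fun y => by
  have := norm_sub_le hT h₀pos hdiss (hg.comp_isometry (hYT y) (hYN y)) hg ht
  rw [hYT, ← map_sub, LinearIsometry.norm_map]
  exact this.trans (hD y)

/-- Relaxation: a functional that is damped by the source, and is moved in a controlled way by the
group, stays bounded. -/
theorem functional_le (hT : IsIsometryGroup T) (hN : LipschitzWith K N) {h₀ : ℝ} (h₀pos : 0 < h₀)
    {d : X → ℝ} {Kd γ Λ : ℝ} (hKd : 0 ≤ Kd) (hγ : 0 < γ) (hγh : h₀ * γ ≤ 1)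
    (hd : ∀ f f', d f - d f' ≤ Kd * ‖f - f'‖) (hd0 : ∀ f, 0 ≤ d f)
    (hdamp : ∀ h, 0 < h → h ≤ h₀ → ∀ f, d (f + h • N f) ≤ (1 - h * γ) * d f)
    (hg : IsMildCurve T N g) (hΛ : 0 ≤ Λ)
    (hmove : ∀ s t, 0 ≤ t → ‖T s (T t (g t)) - T t (g t)‖ ≤ Λ * |s|) {t : ℝ} (ht : 0 ≤ t) :
    d (T t (g t)) ≤ d (g 0) + (Kd * Λ + 1) / γ := by
  -- Wherever the functional equals `B`, its upper slope `-γ B + Kd Λ` is at most `-1`. The summand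
  -- `1` provides this strictness.
  set B := d (g 0) + (Kd * Λ + 1) / γ with hB
  have hdc : Continuous d := by
    refine (LipschitzWith.of_dist_le_mul (K := Kd.toNNReal) fun f f' => ?_).continuous
    rw [Real.dist_eq, dist_eq_norm, Real.coe_toNNReal _ hKd, abs_sub_le_iff]
    exact ⟨hd f f', by rw [norm_sub_rev]; exact hd f' f⟩
  have hTc : ContinuousOn (fun t => T t (g t)) (Ici 0) := by
    have h := continuous_prod_of_continuous_lipschitzWith' (fun p : ℝ × X => T p.1 p.2) 1
      (fun t => (T t).lipschitz) hT.continuous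
    exact h.comp_continuousOn (continuousOn_id.prodMk hg.continuousOn)
  refine image_le_of_liminf_slope_right_lt_deriv_boundary' (f := fun t => d (T t (g t)))
    (f' := fun s => -γ * d (T s (g s)) + Kd * Λ)
    (a := 0) (b := t) (B := fun _ => B) (B' := fun _ => 0)
    ((hdc.comp_continuousOn hTc).mono Icc_subset_Ici_self) (fun s hs r hr => ?_)
    (by simp only [hT.zero, hB]; have : 0 ≤ (Kd * Λ + 1) / γ := by positivity
        linarith) continuousOn_const
    (fun x _ => hasDerivWithinAt_const _ _ _) (fun x _ hx => ?_) ⟨ht, le_rfl⟩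
  · have hs0 : 0 ≤ s := hs.1
    set η := (r - (-γ * d (T s (g s)) + Kd * Λ)) / (2 * (Kd + 1) ) with hη
    have hηpos : 0 < η := by rw [hη]; exact div_pos (sub_pos.2 hr) (by positivity)
    have hη2 : 2 * (Kd + 1) * η = r - (-γ * d (T s (g s)) + Kd * Λ) := by
      rw [hη]; field_simp
    set F := T s (g s) with hF
    -- Over a short time the curve is compared with a shift followed by an explicit source step, so
    -- `N` has to be evaluated after the shift. The commutator of the two is small by continuity.
    have hcN : Continuous fun z : ℝ => T (z - s) (N F) - N (T (z - s) F) :=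
      ((hT.continuous _).comp (continuous_id.sub continuous_const)).sub
        (hN.continuous.comp ((hT.continuous _).comp (continuous_id.sub continuous_const)))
    have hcN' : ∀ᶠ z in 𝓝[>] s, ‖T (z - s) (N F) - N (T (z - s) F)‖ < η := by
      refine nhdsWithin_le_nhds ((hcN.norm.tendsto s).eventually (gt_mem_nhds ?_))
      simpa [hT.zero] using hηpos
    refine Eventually.frequently ?_
    filter_upwards [eventually_norm_sub_le (hg s hs0) hηpos, hcN',
      eventually_sub_le_nhdsGT h₀pos (t := s)] with z hz1 hz2 hzh
    have hz0 : 0 < z - s := hzh.1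
    have e1 : T z (g z) - (T (z - s) F + (z - s) • N (T (z - s) F)) =
        T z (g z - g s - (z - s) • T (-s) (N F)) +
          (z - s) • (T (z - s) (N F) - N (T (z - s) F)) := by
      have a1 : T z (g s) = T (z - s) F := by rw [hF, ← hT.add, sub_add_cancel]
      have a2 : T z (T (-s) (N F)) = T (z - s) (N F) := by rw [← hT.add, sub_eq_add_neg]
      simp only [map_sub, map_smul, a1, a2]
      module
    have e2 : ‖T z (g z) - (T (z - s) F + (z - s) • N (T (z - s) F))‖ ≤ 2 * η * (z - s) := by
      rw [e1]
      refine (norm_add_le _ _).trans ?_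
      rw [LinearIsometry.norm_map, norm_smul, Real.norm_of_nonneg hz0.le]
      nlinarith
    have e3 := hd (T z (g z)) (T (z - s) F + (z - s) • N (T (z - s) F))
    have e4 := hdamp _ hz0 hzh.2 (T (z - s) F)
    have e5 := hd (T (z - s) F) F
    have e6 := hmove (z - s) s hs0
    rw [abs_of_pos hz0] at e6
    have e7 : 0 ≤ 1 - (z - s) * γ := by nlinarith [hzh.2]
    rw [slope_def_field, div_lt_iff₀ hz0]
    have e8 : d (T (z - s) F) ≤ d F + Kd * (Λ * (z - s)) := by
      nlinarith [mul_le_mul_of_nonneg_left e6 hKd]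
    have e9 := mul_le_mul_of_nonneg_left e8 e7
    have e10 := mul_le_mul_of_nonneg_left e2 hKd
    have e11 : 0 ≤ (z - s) * γ * (Kd * (Λ * (z - s))) := by positivity
    have e12 : (2 * (Kd + 1) * η) * (z - s) = (r - (-γ * d F + Kd * Λ)) * (z - s) := by rw [hη2]
    nlinarith [mul_pos hηpos hz0]
  · rw [hx, hB]
    have : γ * ((Kd * Λ + 1) / γ) = Kd * Λ + 1 := by field_simp
    have := mul_nonneg hγ.le (hd0 (g 0))
    nlinarith

theorem norm_sub_le_of_bound (hg : IsMildCurve T N g) {C : ℝ}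
    (hC : ∀ t, 0 ≤ t → ‖N (T t (g t))‖ ≤ C) {s t : ℝ} (hs : 0 ≤ s) (ht : 0 ≤ t) :
    ‖g s - g t‖ ≤ C * |s - t| := by
  have := (convex_Ici (0 : ℝ)).norm_image_sub_le_of_norm_hasDerivWithin_le (f := g)
    (f' := fun t => T (-t) (N (T t (g t)))) (C := C) (x := t) (y := s)
    (fun x hx => (hg x hx).hasDerivWithinAt)
    (fun x hx => by rw [LinearIsometry.norm_map]; exact hC x hx) ht hs
  simpa using this

/-- Lipschitz continuity in time. -/
theorem apply_norm_sub_le (hT : IsIsometryGroup T) (hg : IsMildCurve T N g) {C Λ : ℝ}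
    (hC : ∀ t, 0 ≤ t → ‖N (T t (g t))‖ ≤ C)
    (hmove : ∀ s t, 0 ≤ t → ‖T s (T t (g t)) - T t (g t)‖ ≤ Λ * |s|)
    {s t : ℝ} (hs : 0 ≤ s) (ht : 0 ≤ t) :
    ‖T s (g s) - T t (g t)‖ ≤ (C + Λ) * |s - t| := by
  have h1 := hg.norm_sub_le_of_bound hC hs ht
  have h2 := hmove (s - t) t ht
  rw [← hT.add, sub_add_cancel] at h2
  calc ‖T s (g s) - T t (g t)‖ = ‖T s (g s - g t) + (T s (g t) - T t (g t))‖ := by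
        congr 1; rw [map_sub]; abel
    _ ≤ ‖T s (g s - g t)‖ + ‖T s (g t) - T t (g t)‖ := norm_add_le _ _
    _ ≤ (C + Λ) * |s - t| := by rw [LinearIsometry.norm_map]; linarith

/-- Consistency of one explicit step. -/
theorem norm_step_sub_le (hT : IsIsometryGroup T) (hg : IsMildCurve T N g) (hN : LipschitzWith K N)
    {L P : ℝ}
    (hL : ∀ s t, 0 ≤ s → 0 ≤ t → ‖T s (g s) - T t (g t)‖ ≤ L * |s - t|)
    (hP : ∀ s t, 0 ≤ t → ‖T s (N (T t (g t))) - N (T t (g t))‖ ≤ P * |s|)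
    (hL0 : 0 ≤ L) (hP0 : 0 ≤ P)
    {t h : ℝ} (ht : 0 ≤ t) (hh : 0 ≤ h) :
    ‖T (t + h) (g (t + h)) - T h (T t (g t)) - h • N (T t (g t))‖ ≤ (K * L + P) * h ^ 2 := by
  -- The frozen source is pulled back from the final time `t + h`, so that `T (t + h)` turns `h • w`
  -- into exactly `h • N (T t (g t))`. The derivative of `g s - s • w` is then `O(h)`: `K L` comes
  -- from motion along the curve, `P` from moving the source by the group.
  set w := T (-(t + h)) (N (T t (g t))) with hw
  have key := (convex_Icc t (t + h)).norm_image_sub_le_of_norm_hasDerivWithin_le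
    (f := fun s => g s - s • w)
    (f' := fun s => T (-s) (N (T s (g s))) - w) (C := (K * L + P) * h) (x := t) (y := t + h)
    (fun x hx => by
      have := (hg x (ht.trans hx.1)).sub ((hasDerivAt_id x).smul_const w)
      rw [one_smul] at this
      exact this.hasDerivWithinAt)
    (fun x hx => ?_) ⟨le_rfl, by linarith⟩ ⟨by linarith, le_rfl⟩
  · have e : T (t + h) (g (t + h)) - T h (T t (g t)) - h • N (T t (g t)) =
        T (t + h) (g (t + h) - (t + h) • w - (g t - t • w)) := by
      have a1 : T (t + h) (g t) = T h (T t (g t)) := by rw [add_comm, hT.add]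
      have a2 : T (t + h) w = N (T t (g t)) := hT.apply_neg _ _
      simp only [map_sub, map_smul, a1, a2]
      module
    rw [e, LinearIsometry.norm_map]
    refine key.trans (le_of_eq ?_)
    rw [add_sub_cancel_left, Real.norm_of_nonneg hh]
    ring
  · have hx0 : 0 ≤ x := ht.trans hx.1
    have e : T (-x) (N (T x (g x))) - w = T (-x) ((N (T x (g x)) - N (T t (g t))) -
        (T (x - (t + h)) (N (T t (g t))) - N (T t (g t)))) := by
      have a1 : T (-x) (T (x - (t + h)) (N (T t (g t)))) = w := by
        rw [← hT.add, hw]; congr 2; ring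
      simp only [map_sub, a1]
      abel
    rw [e, LinearIsometry.norm_map]
    refine (_root_.norm_sub_le _ _).trans ?_
    have b1 := (hN.norm_sub_le (T x (g x)) (T t (g t)))
    have b2 := hL x t hx0 ht
    have b3 := hP (x - (t + h)) t ht
    have b4 : |x - t| ≤ h := by rw [abs_le]; constructor <;> linarith [hx.1, hx.2]
    have b5 : |x - (t + h)| ≤ h := by rw [abs_le]; constructor <;> linarith [hx.1, hx.2]
    have b6 : (K : ℝ) * ‖T x (g x) - T t (g t)‖ ≤ K * (L * h) := by
      gcongr; exact b2.trans (by gcongr)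
    have b7 : P * |x - (t + h)| ≤ P * h := by gcongr
    nlinarith

end IsMildCurve

end Semilinear

end RelaxationAP

namespace RelaxationAP

/-! ### Averaging along the group and the upwind truncation error. -/

section Mollifier

variable {X : Type*} [NormedAddCommGroup X] [NormedSpace ℝ X]

/-- Average of `T s f` over `s ∈ [0, η]`. -/
noncomputable def mollify (T : ℝ → X →ₗᵢ[ℝ] X) (η : ℝ) (f : X) : X :=
  η⁻¹ • ∫ s in (0 : ℝ)..η, T s f

variable {T : ℝ → X →ₗᵢ[ℝ] X} {η : ℝ}

theorem norm_mollify_le (hη : 0 < η) (f : X) : ‖mollify T η f‖ ≤ ‖f‖ := by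
  have h := intervalIntegral.norm_integral_le_of_norm_le_const (a := 0) (b := η)
    (f := fun s => T s f) (C := ‖f‖) fun s _ => (LinearIsometry.norm_map _ _).le
  rw [sub_zero, abs_of_pos hη] at h
  rw [mollify, norm_smul, norm_inv, Real.norm_of_nonneg hη.le, inv_mul_le_iff₀ hη]
  linarith

theorem mollify_add (hT : IsIsometryGroup T) (f f' : X) :
    mollify T η (f + f') = mollify T η f + mollify T η f' := by
  rw [mollify, mollify, mollify, ← smul_add, ← intervalIntegral.integral_add
    ((hT.continuous _).intervalIntegrable _ _) ((hT.continuous _).intervalIntegrable _ _)]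
  simp

theorem mollify_smul (a : ℝ) (f : X) : mollify T η (a • f) = a • mollify T η f := by
  simp only [mollify, map_smul, intervalIntegral.integral_smul]
  rw [smul_comm]

variable [CompleteSpace X]

/-- The group law moves `T t` into the limits of integration, so the averaged element has a
differentiable orbit although `f` need not. -/
theorem apply_mollify (hT : IsIsometryGroup T) (t : ℝ) (f : X) :
    T t (mollify T η f) = η⁻¹ • ∫ s in t..t + η, T s f := by
  rw [mollify, map_smul]
  have := (T t).toContinuousLinearMap.intervalIntegral_comp_comm
    ((hT.continuous f).intervalIntegrable (μ := volume) 0 η)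
  rw [LinearIsometry.coe_toContinuousLinearMap] at this
  rw [← this]
  simp only [← hT.add]
  rw [intervalIntegral.integral_comp_add_left (fun s => T s f) t, add_zero]

theorem apply_mollify_comm (hT : IsIsometryGroup T) (t : ℝ) (f : X) :
    T t (mollify T η f) = mollify T η (T t f) := by
  rw [apply_mollify hT, mollify]
  simp only [← hT.add]
  rw [intervalIntegral.integral_comp_add_right (fun s => T s f) t, zero_add, add_comm]

theorem norm_mollify_sub_le (hT : IsIsometryGroup T) (hη : 0 < η) {Λ : ℝ} {f : X}
    (hΛ : ∀ s, ‖T s f - f‖ ≤ Λ * |s|) : ‖mollify T η f - f‖ ≤ Λ * η := by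
  have hΛ0 : 0 ≤ Λ := by simpa using (norm_nonneg _).trans (hΛ 1)
  have e : mollify T η f - f = η⁻¹ • ∫ s in (0 : ℝ)..η, (T s f - f) := by
    rw [intervalIntegral.integral_sub ((hT.continuous _).intervalIntegrable _ _) (by simp),
      intervalIntegral.integral_const, smul_sub, sub_zero, smul_smul, inv_mul_cancel₀ hη.ne',
      one_smul, mollify]
  have h := intervalIntegral.norm_integral_le_of_norm_le_const (a := 0) (b := η)
    (f := fun s => T s f - f) (C := Λ * η) fun s hs => by
      rw [uIoc_of_le hη.le] at hs
      refine (hΛ s).trans ?_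
      rw [abs_of_pos hs.1]
      exact mul_le_mul_of_nonneg_left hs.2 hΛ0
  rw [sub_zero, abs_of_pos hη] at h
  rw [e, norm_smul, norm_inv, Real.norm_of_nonneg hη.le, inv_mul_le_iff₀ hη]
  linarith

/-- Truncation error of the upwind step on a mollified element. -/
theorem norm_upwind_sub_le (hT : IsIsometryGroup T) (hη : 0 < η) {Λ : ℝ} {f : X}
    (hΛ : ∀ s, ‖T s f - f‖ ≤ Λ * |s|) {l k : ℝ} (hl : 0 ≤ l) (hl1 : l ≤ 1) (hk : 0 ≤ k) :
    ‖(1 - l) • mollify T η f + l • T k (mollify T η f) - T (l * k) (mollify T η f)‖ ≤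
      4 * Λ * (l * k) * k / η := by
  have hΛ0 : 0 ≤ Λ := by simpa using (norm_nonneg _).trans (hΛ 1)
  set p : ℝ → X := fun y => T y (mollify T η f) with hp
  set p' : ℝ → X := fun y => η⁻¹ • (T (y + η) f - T y f) with hp'
  have hd : ∀ y, HasDerivAt p (p' y) y := by
    intro y
    have hc := hT.continuous f
    have e : p = fun y => η⁻¹ • ((∫ s in (0 : ℝ)..y + η, T s f) - ∫ s in (0 : ℝ)..y, T s f) := by
      funext y
      rw [hp]
      simp only [apply_mollify hT]
      rw [intervalIntegral.integral_interval_sub_left (hc.intervalIntegrable _ _)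
        (hc.intervalIntegrable _ _)]
    rw [e]
    have h1 := (hc.integral_hasStrictDerivAt 0 (y + η)).hasDerivAt
    have h2 := (hc.integral_hasStrictDerivAt 0 y).hasDerivAt
    have h3 : HasDerivAt (fun y => ∫ s in (0 : ℝ)..y + η, T s f) (T (y + η) f) y :=
      h1.comp_add_const y η
    exact (h3.sub h2).const_smul _
  -- Averaging gains one derivative at the price `1/η`: the derivative of the orbit is a difference
  -- quotient of step `η`, hence inherits the Lipschitz bound of `f`.
  have hlip : ∀ y, 0 ≤ y → y ≤ k → ‖p' y - p' 0‖ ≤ 2 * Λ * k / η := by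
    intro y hy hyk
    have e : p' y - p' 0 = η⁻¹ • (T η (T y f - f) - (T y f - f)) := by
      rw [hp', ← smul_sub]
      simp only [map_sub, ← hT.add, zero_add, hT.zero, add_comm η y]
      congr 1; abel
    rw [e, norm_smul, norm_inv, Real.norm_of_nonneg hη.le, inv_mul_le_iff₀ hη]
    have h1 := norm_sub_le (T η (T y f - f)) (T y f - f)
    rw [LinearIsometry.norm_map] at h1
    have h2 := hΛ y
    rw [abs_of_nonneg hy] at h2
    have h3 := mul_le_mul_of_nonneg_left hyk hΛ0
    have h4 : η * (2 * Λ * k / η) = 2 * Λ * k := by field_simp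
    rw [h4]; linarith
  have hq : ∀ y, 0 ≤ y → y ≤ k → ‖p y - p 0 - y • p' 0‖ ≤ 2 * Λ * k / η * y := by
    intro y hy hyk
    have := (convex_Icc (0 : ℝ) k).norm_image_sub_le_of_norm_hasDerivWithin_le
      (f := fun y => p y - y • p' 0) (f' := fun y => p' y - p' 0) (C := 2 * Λ * k / η) (x := 0)
      (y := y) (fun x _ => by
        have := (hd x).sub ((hasDerivAt_id x).smul_const (p' 0))
        rw [one_smul] at this
        exact this.hasDerivWithinAt) (fun x hx => hlip x hx.1 hx.2) ⟨le_rfl, hk⟩ ⟨hy, hyk⟩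
    rw [sub_zero, Real.norm_of_nonneg hy] at this
    convert this using 2
    simp only [zero_smul, sub_zero]
    abel
  have hp0 : p 0 = mollify T η f := hT.zero _
  -- The upwind combination and the exact shift by `l * k` have the same affine part, so only the
  -- two quadratic remainders survive.
  have e : (1 - l) • mollify T η f + l • T k (mollify T η f) - T (l * k) (mollify T η f) =
      l • (p k - p 0 - k • p' 0) - (p (l * k) - p 0 - (l * k) • p' 0) := by
    rw [hp0]; simp only [hp]; module
  rw [e]
  have h1 := hq k hk le_rfl
  have h2 := hq (l * k) (by positivity) (by nlinarith)
  refine (norm_sub_le _ _).trans ?_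
  rw [norm_smul, Real.norm_of_nonneg hl]
  have h3 := mul_le_mul_of_nonneg_left h1 hl
  have h4 : 4 * Λ * (l * k) * k / η = l * (2 * Λ * k / η * k) + 2 * Λ * k / η * (l * k) := by ring
  rw [h4]; linarith

end Mollifier

/-! ### Stability and error accumulation for the splitting. -/

section ErrorEstimate

variable {X : Type*} [NormedAddCommGroup X] [NormedSpace ℝ X]
  {T : ℝ → X →ₗᵢ[ℝ] X} {N : X → X} {K : ℝ≥0} {g : ℝ → X}

/-- One step of an upwind discretisation of the group followed by the map `id + Q`. -/
def splitStep (T : ℝ → X →ₗᵢ[ℝ] X) (Q : X → X) (l k : ℝ) (F : X) : X :=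
  ((1 - l) • F + l • T k F) + Q ((1 - l) • F + l • T k F)

/-- For Courant number at most one, the upwind step is a convex combination of two isometries.
Stability with constant `1` lets the local errors simply add up. -/
theorem norm_splitStep_sub_le {Q : X → X} (hQ : ∀ F F', ‖(F + Q F) - (F' + Q F')‖ ≤ ‖F - F'‖)
    {l k : ℝ} (hl : 0 ≤ l) (hl1 : l ≤ 1) (F F' : X) :
    ‖splitStep T Q l k F - splitStep T Q l k F'‖ ≤ ‖F - F'‖ := by
  refine (hQ _ _).trans ?_
  have e : ((1 - l) • F + l • T k F) - ((1 - l) • F' + l • T k F') =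
      (1 - l) • (F - F') + l • T k (F - F') := by
    rw [map_sub]; module
  rw [e]
  refine (norm_add_le _ _).trans ?_
  rw [norm_smul, norm_smul, LinearIsometry.norm_map, Real.norm_of_nonneg hl,
    Real.norm_of_nonneg (by linarith : (0 : ℝ) ≤ 1 - l)]
  linarith

/-- Error of the splitting scheme along a mild solution. -/
theorem norm_iterate_splitStep_sub_le [CompleteSpace X] (hT : IsIsometryGroup T) (hg : IsMildCurve T N g)
    (hN : LipschitzWith K N) {Q : X → X}
    (hQ : ∀ F F', ‖(F + Q F) - (F' + Q F')‖ ≤ ‖F - F'‖) {A₁ A₂ : ℝ}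
    (hQ₁ : ∀ F F', ‖Q F - Q F'‖ ≤ A₁ * ‖F - F'‖) (hA₁ : 0 ≤ A₁) {l k η : ℝ}
    (hl : 0 ≤ l) (hl1 : l ≤ 1) (hk : 0 ≤ k) (hη : 0 < η)
    (hQ₂ : ∀ t, 0 ≤ t → ‖Q (T t (g t)) - (l * k) • N (T t (g t))‖ ≤ A₂)
    {Λ L P : ℝ} (hΛ : ∀ s t, 0 ≤ t → ‖T s (T t (g t)) - T t (g t)‖ ≤ Λ * |s|)
    (hL : ∀ s t, 0 ≤ s → 0 ≤ t → ‖T s (g s) - T t (g t)‖ ≤ L * |s - t|)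
    (hP : ∀ s t, 0 ≤ t → ‖T s (N (T t (g t))) - N (T t (g t))‖ ≤ P * |s|)
    (F₀ : X) (n : ℕ) :
    ‖(splitStep T Q l k)^[n] F₀ - T (n * (l * k)) (g (n * (l * k)))‖ ≤
      ‖F₀ - g 0‖ + 2 * Λ * η + n * (4 * Λ * (l * k) * k / η + A₁ * (Λ * (k + η)) + A₂ +
        (K * L + P) * (l * k) ^ 2 + (l * k) * (P * η)) := by
  set E := 4 * Λ * (l * k) * k / η + A₁ * (Λ * (k + η)) + A₂ +
        (K * L + P) * (l * k) ^ 2 + (l * k) * (P * η) with hE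
  have hh : 0 ≤ l * k := by positivity
  set h := l * k with hhdef
  have hΛ0 : 0 ≤ Λ := by simpa using (norm_nonneg _).trans (hΛ 1 0 le_rfl)
  have hL0 : 0 ≤ L := by simpa using (norm_nonneg _).trans (hL 1 0 zero_le_one le_rfl)
  have hP0 : 0 ≤ P := by simpa using (norm_nonneg _).trans (hP 1 0 le_rfl)
  have step : ∀ t, 0 ≤ t → ‖splitStep T Q l k (mollify T η (T t (g t))) -
      mollify T η (T (t + h) (g (t + h)))‖ ≤ E := by
    intro t ht
    set f := T t (g t) with hf
    set F := mollify T η f with hF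
    set U := (1 - l) • F + l • T k F with hU
    set r := T (t + h) (g (t + h)) - T h f - h • N f with hr
    -- The five terms are: upwind truncation, evaluation of the source step at `U` instead of `f`,
    -- replacement of `Q` by `h • N`, consistency of the explicit step, and averaging of the source.
    have e : splitStep T Q l k F - mollify T η (T (t + h) (g (t + h))) =
        (U - T h F) + (Q U - Q f) + (Q f - h • N f) - mollify T η r -
          h • (mollify T η (N f) - N f) := by
      have e1 : T (t + h) (g (t + h)) = r + T h f + h • N f := by rw [hr]; abel
      rw [e1, mollify_add hT, mollify_add hT, mollify_smul, ← apply_mollify_comm hT]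
      simp only [splitStep, ← hU, ← hF]
      module
    have b1 : ‖U - T h F‖ ≤ 4 * Λ * h * k / η := norm_upwind_sub_le hT hη (fun s => hΛ s t ht) hl hl1 hk
    have b2 : ‖F - f‖ ≤ Λ * η := norm_mollify_sub_le hT hη (fun s => hΛ s t ht)
    have b3 : ‖U - F‖ ≤ Λ * k := by
      have e2 : U - F = l • mollify T η (T k f - f) := by
        have : mollify T η (T k f) = mollify T η (T k f - f) + F := by
          rw [hF, ← mollify_add hT, sub_add_cancel]
        rw [hU, hF, apply_mollify_comm hT, this]
        simp only [← hF]
        module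
      rw [e2, norm_smul, Real.norm_of_nonneg hl]
      have := (norm_mollify_le (T := T) hη (T k f - f)).trans (hΛ k t ht)
      rw [abs_of_nonneg hk] at this
      calc l * _ ≤ 1 * (Λ * k) := by gcongr
        _ = _ := one_mul _
    have b4 : ‖Q U - Q f‖ ≤ A₁ * (Λ * (k + η)) := by
      refine (hQ₁ _ _).trans (mul_le_mul_of_nonneg_left ?_ hA₁)
      calc ‖U - f‖ = ‖(U - F) + (F - f)‖ := by congr 1; abel
        _ ≤ _ := (norm_add_le _ _).trans (by linarith)
    have b5 : ‖mollify T η r‖ ≤ (K * L + P) * h ^ 2 :=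
      (norm_mollify_le hη r).trans (hg.norm_step_sub_le hT hN hL hP hL0 hP0 ht hh)
    have b6 : ‖h • (mollify T η (N f) - N f)‖ ≤ h * (P * η) := by
      rw [norm_smul, Real.norm_of_nonneg hh]
      exact mul_le_mul_of_nonneg_left (norm_mollify_sub_le hT hη (fun s => hP s t ht)) hh
    rw [e]
    refine (norm_sub_le _ _).trans ?_
    refine (add_le_add (norm_sub_le _ _) b6).trans ?_
    refine (add_le_add_left (add_le_add ((norm_add_le _ _).trans (add_le_add
      ((norm_add_le _ _).trans (add_le_add b1 b4)) (hQ₂ t ht))) b5) _).trans ?_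
    exact le_of_eq (by rw [hE])
  -- The induction runs entirely against the averaged solution; the averaging error `Λ * η` is paid
  -- only at the initial and the final time.
  have main : ∀ n : ℕ, ‖(splitStep T Q l k)^[n] F₀ - mollify T η (T (n * h) (g (n * h)))‖ ≤
      ‖F₀ - g 0‖ + Λ * η + n * E := by
    intro n
    induction n with
    | zero =>
      have b2 : ‖mollify T η (T 0 (g 0)) - T 0 (g 0)‖ ≤ Λ * η :=
        norm_mollify_sub_le hT hη (fun s => hΛ s 0 le_rfl)
      rw [hT.zero] at b2
      simp only [Function.iterate_zero, id, Nat.cast_zero, zero_mul, hT.zero, add_zero]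
      calc ‖F₀ - mollify T η (g 0)‖ = ‖(F₀ - g 0) - (mollify T η (g 0) - g 0)‖ := by
            congr 1; abel
        _ ≤ _ := (norm_sub_le _ _).trans (by linarith)
    | succ n ih =>
      have s1 := step (n * h) (by positivity)
      have s2 := norm_splitStep_sub_le (T := T) hQ (k := k) hl hl1 ((splitStep T Q l k)^[n] F₀)
        (mollify T η (T (n * h) (g (n * h))))
      have e : ((n + 1 : ℕ) : ℝ) * h = n * h + h := by push_cast; ring
      rw [Function.iterate_succ_apply', e]
      have := norm_add_le (splitStep T Q l k ((splitStep T Q l k)^[n] F₀) -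
        splitStep T Q l k (mollify T η (T (n * h) (g (n * h)))))
        (splitStep T Q l k (mollify T η (T (n * h) (g (n * h)))) -
          mollify T η (T (n * h + h) (g (n * h + h))))
      rw [sub_add_sub_cancel] at this
      push_cast
      linarith
  have hn : 0 ≤ (n : ℝ) * h := by positivity
  have m1 := main n
  have m2 := norm_mollify_sub_le hT hη (fun s => hΛ s (n * h) hn)
  have := norm_add_le ((splitStep T Q l k)^[n] F₀ - mollify T η (T (n * h) (g (n * h))))
    (mollify T η (T (n * h) (g (n * h))) - T (n * h) (g (n * h)))
  rw [sub_add_sub_cancel] at this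
  linarith

end ErrorEstimate

end RelaxationAP

namespace RelaxationAP

noncomputable section

/-! ### Translations of `L¹(ℝ)` and the state space -/

/-- `L¹(ℝ)`. -/
abbrev LOne := Lp ℝ 1 (volume : Measure ℝ)

/-- Pairs `(f₁, f₂)` of characteristic variables, normed by `‖f₁‖₁ + ‖f₂‖₁`. -/
abbrev State := WithLp 1 (LOne × LOne)

/-- Translation `f ↦ f (· - y)`. -/
def shift (y : ℝ) : LOne →ₗᵢ[ℝ] LOne :=
  Lp.compMeasurePreservingₗᵢ ℝ (fun x => x - y) (measurePreserving_sub_right volume y)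

theorem shift_coe (y : ℝ) (f : LOne) : shift y f =ᵐ[volume] fun x => f (x - y) :=
  Lp.coeFn_compMeasurePreserving f (measurePreserving_sub_right volume y)

theorem ae_comp_sub {P : ℝ → Prop} (y : ℝ) (h : ∀ᵐ x, P x) : ∀ᵐ x : ℝ, P (x - y) :=
  (measurePreserving_sub_right volume y).quasiMeasurePreserving.ae h

theorem isIsometryGroup_shift : IsIsometryGroup shift where
  add s t f := by
    refine Lp.ext ?_
    filter_upwards [shift_coe (s + t) f, shift_coe s (shift t f), ae_comp_sub s (shift_coe t f)]
      with x h1 h2 h3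
    rw [h1, h2, h3]
    congr 1; ring
  zero f := by
    refine Lp.ext ?_
    filter_upwards [shift_coe 0 f] with x h1
    rw [h1, sub_zero]
  continuous f := by
    have hg : Continuous fun y : ℝ => (⟨fun x => x - y, by fun_prop⟩ : C(ℝ, ℝ)) :=
      ContinuousMap.continuous_of_continuous_uncurry _ (continuous_snd.sub continuous_fst)
    exact Continuous.compMeasurePreservingLp (μ := volume) (ν := volume) (p := 1)
      (f := fun _ : ℝ => f) continuous_const hg
      (fun y => measurePreserving_sub_right volume y) (by simp)

theorem norm_shift_sub_neg (y : ℝ) (f : LOne) : ‖shift (-y) f - f‖ = ‖shift y f - f‖ := by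
  have := isIsometryGroup_shift.norm_sub 0 y f
  rw [isIsometryGroup_shift.zero, zero_sub] at this
  rw [← this, norm_sub_rev]

/-- Shift of the two components by `a t` and `b t`. -/
def pairShift (a b t : ℝ) : State →ₗᵢ[ℝ] State where
  toFun f := WithLp.toLp 1 (shift (a * t) f.fst, shift (b * t) f.snd)
  map_add' f g := by
    change WithLp.toLp 1 (shift (a * t) (f.fst + g.fst), shift (b * t) (f.snd + g.snd)) = _
    rw [map_add, map_add]
    rfl
  map_smul' r f := by
    change WithLp.toLp 1 (shift (a * t) (r • f.fst), shift (b * t) (r • f.snd)) = _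
    rw [map_smul, map_smul]
    rfl
  norm_map' f := by
    rw [WithLp.prod_norm_eq_of_L1 f]
    change ‖WithLp.toLp 1 (shift (a * t) f.fst, shift (b * t) f.snd)‖ = _
    rw [WithLp.prod_norm_eq_of_L1]
    simp

theorem pairShift_fst (a b t : ℝ) (f : State) : (pairShift a b t f).fst = shift (a * t) f.fst := rfl

theorem pairShift_snd (a b t : ℝ) (f : State) : (pairShift a b t f).snd = shift (b * t) f.snd := rfl

theorem state_ext {f g : State} (h1 : f.fst = g.fst) (h2 : f.snd = g.snd) : f = g := by
  have : WithLp.ofLp f = WithLp.ofLp g := Prod.ext h1 h2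
  exact WithLp.ofLp_injective _ this

theorem isIsometryGroup_pairShift (a b : ℝ) : IsIsometryGroup (pairShift a b) where
  add s t f := by
    refine state_ext ?_ ?_ <;>
    simp only [pairShift_fst, pairShift_snd, mul_add, isIsometryGroup_shift.add]
  zero f := by
    refine state_ext ?_ ?_ <;>
    simp only [pairShift_fst, pairShift_snd, mul_zero, isIsometryGroup_shift.zero]
  continuous f := by
    refine (WithLp.prod_continuous_toLp 1 LOne LOne).comp (Continuous.prodMk ?_ ?_)
    · exact (isIsometryGroup_shift.continuous f.fst).comp (continuous_const.mul continuous_id)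
    · exact (isIsometryGroup_shift.continuous f.snd).comp (continuous_const.mul continuous_id)

theorem pairShift_comm (a b a' b' s t : ℝ) (f : State) :
    pairShift a b s (pairShift a' b' t f) = pairShift a' b' t (pairShift a b s f) := by
  refine state_ext ?_ ?_ <;>
  simp only [pairShift_fst, pairShift_snd, ← isIsometryGroup_shift.add] <;> rw [add_comm]

/-- A translation modulus controls the displacement along the characteristics. -/
theorem TransLip.char {c D : ℝ} (hc : 0 ≤ c) {f : State} (hf : TransLip (pairShift 1 1) D f) (t : ℝ) :
    ‖pairShift c (-c) t f - f‖ ≤ c * D * |t| := by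
  have h := hf (c * t)
  rw [WithLp.prod_norm_eq_of_L1, WithLp.sub_fst, WithLp.sub_snd] at h ⊢
  simp only [pairShift_fst, pairShift_snd, one_mul, neg_mul] at h ⊢
  rw [norm_shift_sub_neg]
  rw [abs_mul, abs_of_nonneg hc] at h
  linarith

/-! ### Integral inequalities in the state space -/

/-- This identity turns the sum norm of characteristic variables into the maximum norm in `(u,
v/c)`, in which the source steps contract pointwise. -/
theorem abs_add_abs_eq_max (a b : ℝ) : |a| + |b| = max |a + b| |a - b| := by
  rcases le_total 0 a with ha | ha <;> rcases le_total 0 b with hb | hb <;>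
  rcases le_total 0 (a + b) with h | h <;> rcases le_total 0 (a - b) with h' | h' <;>
  simp only [abs_of_nonneg, abs_of_nonpos, ha, hb, h, h'] <;>
  (symm; first
    | exact (max_eq_left (by linarith)).trans (by linarith)
    | exact (max_eq_right (by linarith)).trans (by linarith))

theorem integrable_state (f : State) : Integrable fun x => |f.fst x| + |f.snd x| :=
  (L1.integrable_coeFn f.fst).abs.add (L1.integrable_coeFn f.snd).abs

theorem state_norm_eq (f : State) : ‖f‖ = ∫ x, (|f.fst x| + |f.snd x|) := by
  rw [WithLp.prod_norm_eq_of_L1, L1.norm_eq_integral_norm, L1.norm_eq_integral_norm,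
    integral_add (L1.integrable_coeFn f.fst).abs (L1.integrable_coeFn f.snd).abs]
  rfl

theorem state_sub_coe (f g : State) : ∀ᵐ x, (f - g).fst x = f.fst x - g.fst x ∧
    (f - g).snd x = f.snd x - g.snd x := by
  filter_upwards [Lp.coeFn_sub f.fst g.fst, Lp.coeFn_sub f.snd g.snd] with x h1 h2
  rw [WithLp.sub_fst, WithLp.sub_snd, h1, h2]
  simp

theorem state_add_coe (f g : State) : ∀ᵐ x, (f + g).fst x = f.fst x + g.fst x ∧
    (f + g).snd x = f.snd x + g.snd x := by
  filter_upwards [Lp.coeFn_add f.fst g.fst, Lp.coeFn_add f.snd g.snd] with x h1 h2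
  rw [WithLp.add_fst, WithLp.add_snd, h1, h2]
  simp

theorem state_smul_coe (r : ℝ) (f : State) : ∀ᵐ x, (r • f).fst x = r * f.fst x ∧
    (r • f).snd x = r * f.snd x := by
  filter_upwards [Lp.coeFn_smul r f.fst, Lp.coeFn_smul r f.snd] with x h1 h2
  rw [WithLp.smul_fst, WithLp.smul_snd, h1, h2]
  simp

theorem state_norm_le {f : State} {w : ℝ → ℝ} (hw : Integrable w)
    (h : ∀ᵐ x, |f.fst x| + |f.snd x| ≤ w x) : ‖f‖ ≤ ∫ x, w x := by
  rw [state_norm_eq]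
  exact integral_mono_ae (integrable_state f) hw h

/-- The conserved variable `u = f₁ + f₂`. -/
def uOf (f : State) (x : ℝ) : ℝ := f.fst x + f.snd x

/-- The flux variable `v = c (f₁ - f₂)`. -/
def vOf (c : ℝ) (f : State) (x : ℝ) : ℝ := c * (f.fst x - f.snd x)

theorem integrable_uOf (f : State) : Integrable (uOf f) :=
  (L1.integrable_coeFn f.fst).add (L1.integrable_coeFn f.snd)

theorem integrable_vOf (c : ℝ) (f : State) : Integrable (vOf c f) :=
  ((L1.integrable_coeFn f.fst).sub (L1.integrable_coeFn f.snd)).const_mul c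

/-- Superposition operators that preserve `L¹`. -/
structure IsNemytskii (Θ : ℝ → ℝ → ℝ) : Prop where
  continuous : Continuous fun p : ℝ × ℝ => Θ p.1 p.2
  bound : ∃ C, ∀ u v, |Θ u v| ≤ C * (|u| + |v|)

theorem IsNemytskii.integrable {Θ : ℝ → ℝ → ℝ} (hΘ : IsNemytskii Θ) {u v : ℝ → ℝ}
    (hu : Integrable u) (hv : Integrable v) : Integrable fun x => Θ (u x) (v x) := by
  obtain ⟨C, hC⟩ := hΘ.bound
  refine ((hu.abs.add hv.abs).const_mul C).mono' ?_ (Eventually.of_forall fun x => hC _ _)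
  exact hΘ.continuous.comp_aestronglyMeasurable
    (hu.aestronglyMeasurable.prodMk hv.aestronglyMeasurable)

theorem integrable_source {Θ : ℝ → ℝ → ℝ} (hΘ : IsNemytskii Θ) (c : ℝ) (f : State) :
    Integrable fun x => Θ (uOf f x) (vOf c f x) / (2 * c) :=
  (hΘ.integrable (integrable_uOf f) (integrable_vOf c f)).div_const _

/-- The state with `u = 0` and `v = -Θ(u, v)`. -/
def source (c : ℝ) {Θ : ℝ → ℝ → ℝ} (hΘ : IsNemytskii Θ) (f : State) : State :=
  WithLp.toLp 1 (-(integrable_source hΘ c f).toL1 _, (integrable_source hΘ c f).toL1 _)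

theorem source_coe (c : ℝ) {Θ : ℝ → ℝ → ℝ} (hΘ : IsNemytskii Θ) (f : State) :
    ∀ᵐ x, (source c hΘ f).fst x = -(Θ (uOf f x) (vOf c f x) / (2 * c)) ∧
      (source c hΘ f).snd x = Θ (uOf f x) (vOf c f x) / (2 * c) := by
  filter_upwards [(integrable_source hΘ c f).coeFn_toL1,
    Lp.coeFn_neg ((integrable_source hΘ c f).toL1 _)] with x h1 h2
  refine ⟨?_, h1⟩
  change (-(integrable_source hΘ c f).toL1 _ : LOne) x = _
  rw [h2, Pi.neg_apply, h1]

variable {c : ℝ} {Θ : ℝ → ℝ → ℝ}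

theorem uOf_pairShift (y : ℝ) (f : State) :
    ∀ᵐ x, uOf (pairShift 1 1 y f) x = uOf f (x - y) ∧
      ∀ c, vOf c (pairShift 1 1 y f) x = vOf c f (x - y) := by
  filter_upwards [shift_coe (1 * y) f.fst, shift_coe (1 * y) f.snd] with x h1 h2
  rw [one_mul] at h1 h2
  simp only [uOf, vOf, pairShift_fst, pairShift_snd, one_mul, h1, h2]
  exact ⟨trivial, fun _ => trivial⟩

/-- Both components must be moved the same way: a superposition operator commutes with a common
translation, but not with the characteristic group. -/
theorem source_pairShift (hΘ : IsNemytskii Θ) (y : ℝ) (f : State) :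
    source c hΘ (pairShift 1 1 y f) = pairShift 1 1 y (source c hΘ f) := by
  refine state_ext (Lp.ext ?_) (Lp.ext ?_)
  · filter_upwards [source_coe c hΘ (pairShift 1 1 y f), ae_comp_sub y (source_coe c hΘ f),
      uOf_pairShift y f, shift_coe (1 * y) (source c hΘ f).fst] with x h1 h2 h3 h4
    rw [h1.1, h3.1, h3.2, pairShift_fst, h4, one_mul, h2.1]
  · filter_upwards [source_coe c hΘ (pairShift 1 1 y f), ae_comp_sub y (source_coe c hΘ f),
      uOf_pairShift y f, shift_coe (1 * y) (source c hΘ f).snd] with x h1 h2 h3 h4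
    rw [h1.2, h3.1, h3.2, pairShift_snd, h4, one_mul, h2.2]

theorem state_abs_eq (hc : 0 < c) (f g : State) (x : ℝ) :
    c * (|f.fst x - g.fst x| + |f.snd x - g.snd x|) =
      max (c * |uOf f x - uOf g x|) |vOf c f x - vOf c g x| := by
  rw [abs_add_abs_eq_max, mul_max_of_nonneg _ _ hc.le]
  congr 1
  · simp only [uOf]; congr 2; ring
  · simp only [vOf]; rw [← abs_of_pos hc, ← abs_mul, abs_of_pos hc]; congr 1; ring

theorem integrable_abs_sub (f g : State) :
    Integrable fun x => |f.fst x - g.fst x| + |f.snd x - g.snd x| :=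
  ((L1.integrable_coeFn f.fst).sub (L1.integrable_coeFn g.fst)).abs.add
    ((L1.integrable_coeFn f.snd).sub (L1.integrable_coeFn g.snd)).abs

theorem norm_sub_eq_integral (f g : State) :
    ‖f - g‖ = ∫ x, (|f.fst x - g.fst x| + |f.snd x - g.snd x|) := by
  rw [state_norm_eq]
  refine integral_congr_ae ?_
  filter_upwards [state_sub_coe f g] with x h
  simp only [h.1, h.2]

/-- Lipschitz estimate for source operators. -/
theorem norm_source_sub_le (hc : 0 < c) (hΘ : IsNemytskii Θ) {A : ℝ}
    (hA : ∀ u v u' v', |Θ u v - Θ u' v'| ≤ A * max (c * |u - u'|) |v - v'|) (f g : State) :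
    ‖source c hΘ f - source c hΘ g‖ ≤ A * ‖f - g‖ := by
  rw [norm_sub_eq_integral f g, ← integral_const_mul]
  refine state_norm_le ((integrable_abs_sub f g).const_mul A) ?_
  filter_upwards [state_sub_coe (source c hΘ f) (source c hΘ g), source_coe c hΘ f,
    source_coe c hΘ g] with x h1 h2 h3
  rw [h1.1, h1.2, h2.1, h2.2, h3.1, h3.2]
  have h4 := hA (uOf f x) (vOf c f x) (uOf g x) (vOf c g x)
  rw [← state_abs_eq hc] at h4
  rw [← neg_sub', abs_neg, ← sub_div, abs_div, abs_of_pos (by positivity : 0 < 2 * c),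
    ← two_mul, mul_div_assoc', mul_div_mul_left _ _ two_ne_zero, div_le_iff₀ hc]
  linarith

/-- Contraction estimate for `f ↦ f + source f`: `u` is kept, `v` is replaced by `v - Θ(u, v)`. -/
theorem norm_add_source_sub_le (hc : 0 < c) (hΘ : IsNemytskii Θ)
    (hA : ∀ u v u' v', |(v - Θ u v) - (v' - Θ u' v')| ≤ max (c * |u - u'|) |v - v'|) (f g : State) :
    ‖(f + source c hΘ f) - (g + source c hΘ g)‖ ≤ ‖f - g‖ := by
  rw [norm_sub_eq_integral f g]
  refine state_norm_le (integrable_abs_sub f g) ?_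
  filter_upwards [state_sub_coe (f + source c hΘ f) (g + source c hΘ g), source_coe c hΘ f,
    source_coe c hΘ g, state_add_coe f (source c hΘ f), state_add_coe g (source c hΘ g)]
    with x h1 h2 h3 h4 h5
  rw [h1.1, h1.2, h4.1, h4.2, h5.1, h5.2, h2.1, h2.2, h3.1, h3.2]
  refine le_of_mul_le_mul_left ?_ hc
  rw [state_abs_eq hc, abs_add_abs_eq_max, mul_max_of_nonneg _ _ hc.le]
  refine max_le (le_max_of_le_left (le_of_eq ?_)) (le_trans (le_of_eq ?_) (hA _ _ _ _))
  · simp only [uOf]; congr 2; ring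
  · rw [← abs_of_pos hc, ← abs_mul, abs_of_pos hc]
    congr 1
    simp only [vOf]
    field_simp
    ring

theorem uOf_add_source (hc : c ≠ 0) (hΘ : IsNemytskii Θ) (f : State) :
    ∀ᵐ x, uOf (f + source c hΘ f) x = uOf f x ∧
      vOf c (f + source c hΘ f) x = vOf c f x - Θ (uOf f x) (vOf c f x) := by
  filter_upwards [source_coe c hΘ f, state_add_coe f (source c hΘ f)] with x h1 h2
  constructor
  · rw [uOf, h2.1, h2.2, h1.1, h1.2, uOf]; ring
  · rw [vOf, h2.1, h2.2, h1.1, h1.2]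
    generalize Θ (uOf f x) (vOf c f x) = q
    rw [vOf]
    field_simp
    ring

end

end RelaxationAP

namespace RelaxationAP

noncomputable section

/-! ### Globally subcharacteristic source terms -/

/-- A source term `r` with equilibrium `v = α u` that is globally Lipschitz and satisfies the
subcharacteristic condition `|∂ᵤr| ≤ c b`, `b ≤ ∂ᵥr ≤ H`. -/
structure IsGlobalTerm (r : ℝ → ℝ → ℝ) (α : ℝ → ℝ) (c b H : ℝ) : Prop where
  c_pos : 0 < c
  b_pos : 0 < b
  b_le : b ≤ H
  lip_u : ∀ u u' v, |r u v - r u' v| ≤ c * b * |u - u'|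
  mono : ∀ u v v', v ≤ v' → b * (v' - v) ≤ r u v' - r u v ∧ r u v' - r u v ≤ H * (v' - v)
  zero : ∀ u, r u (α u) = 0
  map_zero : α 0 = 0

/-- Decrement of `v` in a relaxation step: a combination of `v - α u` and of the source. -/
def decrement (r : ℝ → ℝ → ℝ) (α : ℝ → ℝ) (κ σ u v : ℝ) : ℝ := κ * (v - α u) + σ * r u v

namespace IsGlobalTerm

variable {r : ℝ → ℝ → ℝ} {α : ℝ → ℝ} {c b H : ℝ} (hr : IsGlobalTerm r α c b H)
include hr

theorem H_pos : 0 < H := hr.b_pos.trans_le hr.b_le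

/-- The difference quotient serves as slope, and `b` when the two points coincide. It lets the
source be treated as linear in `v`. -/
theorem exists_slope (u v v' : ℝ) : ∃ q, b ≤ q ∧ q ≤ H ∧ r u v - r u v' = q * (v - v') := by
  rcases lt_trichotomy v v' with h | h | h
  · have := hr.mono u v v' h.le
    have h' : 0 < v' - v := sub_pos.2 h
    refine ⟨(r u v' - r u v) / (v' - v), ?_, ?_, ?_⟩
    · rw [le_div_iff₀ h']; exact this.1
    · rw [div_le_iff₀ h']; exact this.2
    · field_simp; ring
  · exact ⟨b, le_rfl, hr.b_le, by simp [h]⟩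
  · have := hr.mono u v' v h.le
    have h' : 0 < v - v' := sub_pos.2 h
    refine ⟨(r u v - r u v') / (v - v'), ?_, ?_, ?_⟩
    · rw [le_div_iff₀ h']; exact this.1
    · rw [div_le_iff₀ h']; exact this.2
    · field_simp

theorem eq_slope (u v : ℝ) : ∃ q, b ≤ q ∧ q ≤ H ∧ r u v = q * (v - α u) := by
  obtain ⟨q, h1, h2, h3⟩ := hr.exists_slope u v (α u)
  exact ⟨q, h1, h2, by rw [← h3, hr.zero, sub_zero]⟩

/-- The value `r u' (α u)` is at least `b |α u - α u'|` in modulus by monotonicity in `v`, and at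
most `c b |u - u'|` because `r u (α u)` vanishes. This is the subcharacteristic condition in its
usual form, speeds of the equilibrium flux at most `c`. -/
theorem abs_alpha_sub_le (u u' : ℝ) : |α u - α u'| ≤ c * |u - u'| := by
  obtain ⟨q, h1, -, h3⟩ := hr.eq_slope u' (α u)
  have h4 := hr.lip_u u' u (α u)
  rw [hr.zero u, sub_zero, h3, abs_mul, abs_of_pos (hr.b_pos.trans_le h1), abs_sub_comm u'] at h4
  have h5 := mul_le_mul_of_nonneg_right h1 (abs_nonneg (α u - α u'))
  have h6 : b * |α u - α u'| ≤ b * (c * |u - u'|) := by linarith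
  exact le_of_mul_le_mul_left h6 hr.b_pos

theorem decrement_abs_sub_le {κ σ : ℝ} (hκ : 0 ≤ κ) (hσ : 0 ≤ σ) (u v u' v' : ℝ) :
    |decrement r α κ σ u v - decrement r α κ σ u' v'| ≤
      (2 * κ + 2 * H * σ) * max (c * |u - u'|) |v - v'| := by
  obtain ⟨q, h1, h2, h3⟩ := hr.exists_slope u v v'
  have hq : 0 < q := hr.b_pos.trans_le h1
  set m := max (c * |u - u'|) |v - v'| with hm
  have m1 : c * |u - u'| ≤ m := le_max_left _ _
  have m2 : |v - v'| ≤ m := le_max_right _ _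
  have h4 := hr.abs_alpha_sub_le u u'
  have h5 := hr.lip_u u u' v'
  have h6 : |(v - α u) - (v' - α u')| ≤ 2 * m := by
    have : (v - α u) - (v' - α u') = (v - v') - (α u - α u') := by ring
    rw [this]
    exact (abs_sub _ _).trans (by linarith)
  have h7 : |r u v - r u' v'| ≤ 2 * H * m := by
    have : r u v - r u' v' = q * (v - v') + (r u v' - r u' v') := by rw [← h3]; ring
    rw [this]
    refine (abs_add_le _ _).trans ?_
    rw [abs_mul, abs_of_pos hq]
    have a1 : q * |v - v'| ≤ H * m := mul_le_mul h2 m2 (abs_nonneg _) hr.H_pos.le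
    have a2 : b * (c * |u - u'|) ≤ H * m :=
      mul_le_mul hr.b_le m1 (mul_nonneg hr.c_pos.le (abs_nonneg _)) hr.H_pos.le
    linarith
  have e : decrement r α κ σ u v - decrement r α κ σ u' v' =
      κ * ((v - α u) - (v' - α u')) + σ * (r u v - r u' v') := by
    rw [decrement, decrement]; ring
  rw [e]
  refine (abs_add_le _ _).trans ?_
  rw [abs_mul, abs_mul, abs_of_nonneg hκ, abs_of_nonneg hσ]
  have := mul_le_mul_of_nonneg_left h6 hκ
  have := mul_le_mul_of_nonneg_left h7 hσ
  linarith

theorem decrement_zero (κ σ : ℝ) : decrement r α κ σ 0 0 = 0 := by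
  have h := hr.zero 0
  rw [hr.map_zero] at h
  rw [decrement, hr.map_zero, h]; ring

theorem isNemytskii {κ σ : ℝ} (hκ : 0 ≤ κ) (hσ : 0 ≤ σ) : IsNemytskii (decrement r α κ σ) := by
  have hc := hr.c_pos
  have hH := hr.H_pos
  have key : ∀ u v u' v', |decrement r α κ σ u v - decrement r α κ σ u' v'| ≤
      (2 * κ + 2 * H * σ) * (c + 1) * (|u - u'| + |v - v'|) := by
    intro u v u' v'
    refine (hr.decrement_abs_sub_le hκ hσ u v u' v').trans ?_
    have h0 : 0 ≤ 2 * κ + 2 * H * σ := by positivity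
    rw [mul_assoc (2 * κ + 2 * H * σ)]
    refine mul_le_mul_of_nonneg_left (max_le ?_ ?_) h0
    · nlinarith [abs_nonneg (u - u'), abs_nonneg (v - v')]
    · nlinarith [abs_nonneg (u - u'), abs_nonneg (v - v')]
  refine ⟨?_, (2 * κ + 2 * H * σ) * (c + 1), fun u v => ?_⟩
  · rw [continuous_iff_continuousAt]
    rintro ⟨u, v⟩
    rw [ContinuousAt, tendsto_iff_dist_tendsto_zero]
    refine squeeze_zero (g := fun p : ℝ × ℝ =>
      (2 * κ + 2 * H * σ) * (c + 1) * (|p.1 - u| + |p.2 - v|)) (fun _ => dist_nonneg)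
      (fun p => key p.1 p.2 u v) ?_
    have : Continuous fun p : ℝ × ℝ =>
        (2 * κ + 2 * H * σ) * (c + 1) * (|p.1 - u| + |p.2 - v|) := by fun_prop
    simpa using this.tendsto (u, v)
  · have := key u v 0 0
    rwa [hr.decrement_zero, sub_zero, sub_zero, sub_zero] at this

/-- The new difference in `v` has weights `1 - κ - σ q`, `κ` and `σ q`, which sum to one and are
nonnegative by `h1`. They multiply, respectively, `v - v'`, the difference of equilibria, and a
source difference bounded by `c b |u - u'| ≤ q c |u - u'|`. Each is at most the maximum on the
right. -/
theorem sub_decrement_abs_le {κ σ : ℝ} (hκ : 0 ≤ κ) (hσ : 0 ≤ σ) (h1 : κ + σ * H ≤ 1)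
    (u v u' v' : ℝ) : |(v - decrement r α κ σ u v) - (v' - decrement r α κ σ u' v')| ≤
      max (c * |u - u'|) |v - v'| := by
  obtain ⟨q, hq1, hq2, hq3⟩ := hr.exists_slope u v v'
  have hq : 0 < q := hr.b_pos.trans_le hq1
  set m := max (c * |u - u'|) |v - v'| with hm
  have m1 : c * |u - u'| ≤ m := le_max_left _ _
  have m2 : |v - v'| ≤ m := le_max_right _ _
  have h4 := hr.abs_alpha_sub_le u u'
  have h5 := hr.lip_u u u' v'
  have hσq : σ * q ≤ σ * H := mul_le_mul_of_nonneg_left hq2 hσ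
  have e : (v - decrement r α κ σ u v) - (v' - decrement r α κ σ u' v') =
      (1 - κ - σ * q) * (v - v') + (κ * (α u - α u') - σ * (r u v' - r u' v')) := by
    have : r u v = r u v' + q * (v - v') := by linarith
    rw [decrement, decrement, this]; ring
  rw [e]
  refine (abs_add_le _ _).trans ?_
  rw [abs_mul, abs_of_nonneg (by linarith : 0 ≤ 1 - κ - σ * q)]
  have a1 := mul_le_mul_of_nonneg_left m2 (by linarith : 0 ≤ 1 - κ - σ * q)
  have a2 : |κ * (α u - α u') - σ * (r u v' - r u' v')| ≤ κ * m + σ * q * m := by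
    refine (abs_sub _ _).trans ?_
    rw [abs_mul, abs_mul, abs_of_nonneg hκ, abs_of_nonneg hσ, mul_assoc]
    refine add_le_add (mul_le_mul_of_nonneg_left (h4.trans m1) hκ)
      (mul_le_mul_of_nonneg_left ?_ hσ)
    refine h5.trans ?_
    rw [mul_comm c b, mul_assoc]
    exact mul_le_mul hq1 m1 (mul_nonneg hr.c_pos.le (abs_nonneg _)) hq.le
  linarith

/-- The deviation from equilibrium is multiplied by `1 - σ q` with `b ≤ q ≤ H`. -/
theorem abs_sub_decrement_le {σ : ℝ} (hσ : 0 ≤ σ) (h1 : σ * H ≤ 1) (u v : ℝ) :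
    |v - decrement r α 0 σ u v - α u| ≤ (1 - σ * b) * |v - α u| := by
  obtain ⟨q, hq1, hq2, hq3⟩ := hr.eq_slope u v
  have e : v - decrement r α 0 σ u v - α u = (1 - σ * q) * (v - α u) := by
    rw [decrement, hq3]; ring
  have h2 := mul_le_mul_of_nonneg_left hq2 hσ
  have h3 := mul_le_mul_of_nonneg_left hq1 hσ
  rw [e, abs_mul, abs_of_nonneg (by linarith)]
  exact mul_le_mul_of_nonneg_right (by linarith) (abs_nonneg _)

theorem abs_decrement_le {σ : ℝ} (hσ : 0 ≤ σ) (u v : ℝ) :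
    |decrement r α 0 σ u v| ≤ H * σ * |v - α u| := by
  obtain ⟨q, hq1, hq2, hq3⟩ := hr.eq_slope u v
  have hq : 0 < q := hr.b_pos.trans_le hq1
  rw [decrement, hq3, zero_mul, zero_add, abs_mul, abs_mul, abs_of_nonneg hσ, abs_of_pos hq]
  calc σ * (q * |v - α u|) ≤ σ * (H * |v - α u|) := by gcongr
    _ = _ := by ring

end IsGlobalTerm

/-- The coefficients of the exponential relaxation step. -/
def expKappa (H τ : ℝ) : ℝ := 1 - (1 + H * τ) * Real.exp (-(H * τ))

/-- See `expKappa`. -/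
def expSigma (H τ : ℝ) : ℝ := τ * Real.exp (-(H * τ))

/-! ### Estimates for the exponential coefficients. -/

section Coefficients

variable {H τ : ℝ}

theorem expKappa_nonneg (H τ : ℝ) : 0 ≤ expKappa H τ := by
  have h1 := Real.add_one_le_exp (H * τ)
  rw [expKappa, Real.exp_neg, sub_nonneg, ← div_eq_mul_inv, div_le_one (Real.exp_pos _)]
  linarith

theorem expSigma_nonneg (hτ : 0 ≤ τ) : 0 ≤ expSigma H τ := mul_nonneg hτ (Real.exp_pos _).le

/-- The right-hand side is below one for every `τ`, so the relaxation step contracts without any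
restriction of `Δt` by `ε`. -/
theorem expKappa_add_expSigma : expKappa H τ + expSigma H τ * H = 1 - Real.exp (-(H * τ)) := by
  rw [expKappa, expSigma]; ring

/-- Together with `sub_expSigma_le`, this makes the exponential step agree with the explicit one up
to second order in `τ`. -/
theorem expKappa_le_sq (hH : 0 ≤ H) (hτ : 0 ≤ τ) : expKappa H τ ≤ (H * τ) ^ 2 := by
  have h1 := Real.add_one_le_exp (-(H * τ))
  have h2 := mul_le_mul_of_nonneg_left h1 (by positivity : 0 ≤ 1 + H * τ)
  rw [expKappa]; nlinarith

theorem expKappa_le (hH : 0 ≤ H) (hτ : 0 ≤ τ) : expKappa H τ ≤ H * τ := by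
  have h1 := Real.add_one_le_exp (-(H * τ))
  have h2 : 0 ≤ H * τ * Real.exp (-(H * τ)) := by positivity
  rw [expKappa]; nlinarith

theorem expSigma_le (hH : 0 ≤ H) (hτ : 0 ≤ τ) : expSigma H τ ≤ τ :=
  mul_le_of_le_one_right hτ (Real.exp_le_one_iff.2 (by have := mul_nonneg hH hτ; linarith))

theorem sub_expSigma_le (hτ : 0 ≤ τ) : τ - expSigma H τ ≤ H * τ ^ 2 := by
  have h1 := Real.add_one_le_exp (-(H * τ))
  have h2 := mul_le_mul_of_nonneg_left h1 hτ
  rw [expSigma]; nlinarith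

end Coefficients

/-! ### Relaxation operators on states and the distance to equilibrium. -/

section Operators

variable {r : ℝ → ℝ → ℝ} {α : ℝ → ℝ} {c b H : ℝ}

/-- `L¹` distance to equilibrium. -/
def defect (c : ℝ) (α : ℝ → ℝ) (f : State) : ℝ := ∫ x, |vOf c f x - α (uOf f x)|

theorem defect_nonneg (f : State) : 0 ≤ defect c α f := integral_nonneg fun _ => abs_nonneg _

variable (hr : IsGlobalTerm r α c b H)
include hr

theorem integrable_defect (f : State) : Integrable fun x => |vOf c f x - α (uOf f x)| := by
  have h := (hr.isNemytskii zero_le_one le_rfl).integrable (integrable_uOf f) (integrable_vOf c f)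
  refine h.abs.congr (Eventually.of_forall fun x => ?_)
  simp [decrement]

/-- The deviation `v - α u` is the decrement with `κ = 1`, `σ = 0`, whose Lipschitz constant is
already known. -/
theorem defect_sub_le (f g : State) : defect c α f - defect c α g ≤ 2 * c * ‖f - g‖ := by
  rw [defect, defect, ← integral_sub (integrable_defect hr f) (integrable_defect hr g),
    norm_sub_eq_integral, ← integral_const_mul]
  refine integral_mono ((integrable_defect hr f).sub (integrable_defect hr g))
    ((integrable_abs_sub f g).const_mul _) fun x => ?_
  have h1 := hr.decrement_abs_sub_le zero_le_one le_rfl (uOf f x) (vOf c f x) (uOf g x) (vOf c g x)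
  rw [← state_abs_eq hr.c_pos] at h1
  simp only [decrement, one_mul, zero_mul, add_zero, mul_zero, mul_one] at h1
  have h2 := abs_sub_abs_le_abs_sub (vOf c f x - α (uOf f x)) (vOf c g x - α (uOf g x))
  linarith

/-- The relaxation source as an operator on states. -/
def relaxOp {κ σ : ℝ} (hκ : 0 ≤ κ) (hσ : 0 ≤ σ) : State → State :=
  source c (hr.isNemytskii hκ hσ)

theorem lipschitz_relaxOp {κ σ : ℝ} (hκ : 0 ≤ κ) (hσ : 0 ≤ σ) (f g : State) :
    ‖relaxOp hr hκ hσ f - relaxOp hr hκ hσ g‖ ≤ (2 * κ + 2 * H * σ) * ‖f - g‖ :=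
  norm_source_sub_le hr.c_pos _ (hr.decrement_abs_sub_le hκ hσ) f g

theorem norm_add_relaxOp_sub_le {κ σ : ℝ} (hκ : 0 ≤ κ) (hσ : 0 ≤ σ) (h1 : κ + σ * H ≤ 1)
    (f g : State) : ‖(f + relaxOp hr hκ hσ f) - (g + relaxOp hr hκ hσ g)‖ ≤ ‖f - g‖ :=
  norm_add_source_sub_le hr.c_pos _ (hr.sub_decrement_abs_le hκ hσ h1) f g

theorem smul_relaxOp {σ h : ℝ} (hσ : 0 ≤ σ) (hh : 0 ≤ h) (f : State) :
    h • relaxOp hr le_rfl hσ f = relaxOp hr le_rfl (mul_nonneg hh hσ) f := by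
  have e : ∀ u v, decrement r α 0 (h * σ) u v = h * decrement r α 0 σ u v := fun u v => by
    simp only [decrement]; ring
  refine state_ext (Lp.ext ?_) (Lp.ext ?_) <;>
  filter_upwards [state_smul_coe h (relaxOp hr le_rfl hσ f),
    source_coe c (hr.isNemytskii le_rfl hσ) f,
    source_coe c (hr.isNemytskii le_rfl (mul_nonneg hh hσ)) f] with x h1 h2 h3
  · rw [h1.1, relaxOp, relaxOp, h2.1, h3.1, e]; ring
  · rw [h1.2, relaxOp, relaxOp, h2.2, h3.2, e]; ring

theorem relaxOp_zero {κ σ : ℝ} (hκ : 0 ≤ κ) (hσ : 0 ≤ σ) : relaxOp hr hκ hσ 0 = 0 := by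
  have e0 : ∀ᵐ x, uOf (0 : State) x = 0 ∧ vOf c (0 : State) x = 0 := by
    filter_upwards [Lp.coeFn_zero ℝ 1 (volume : Measure ℝ)] with x hx
    have h1 : (0 : State).fst x = 0 := hx
    have h2 : (0 : State).snd x = 0 := hx
    rw [uOf, vOf, h1, h2]
    simp
  refine state_ext (Lp.ext ?_) (Lp.ext ?_) <;>
  filter_upwards [e0, Lp.coeFn_zero ℝ 1 (volume : Measure ℝ),
    source_coe c (hr.isNemytskii hκ hσ) (0 : State)] with x h0 h1 h2
  · rw [relaxOp, h2.1, h0.1, h0.2, hr.decrement_zero, zero_div, neg_zero]; exact h1.symm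
  · rw [relaxOp, h2.2, h0.1, h0.2, hr.decrement_zero, zero_div]; exact h1.symm

theorem norm_relaxOp_le {σ : ℝ} (hσ : 0 ≤ σ) (f : State) :
    ‖relaxOp hr le_rfl hσ f‖ ≤ H * σ / c * defect c α f := by
  have hc := hr.c_pos
  rw [defect, ← integral_const_mul]
  refine state_norm_le ((integrable_defect hr f).const_mul _) ?_
  filter_upwards [source_coe c (hr.isNemytskii le_rfl hσ) f] with x h
  rw [relaxOp, h.1, h.2, abs_neg, abs_div, abs_of_pos (by positivity : 0 < 2 * c), ← two_mul,
    mul_div_assoc', mul_div_mul_left _ _ two_ne_zero, div_mul_eq_mul_div]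
  exact div_le_div_of_nonneg_right (hr.abs_decrement_le hσ _ _) hc.le

/-- Both steps are multiples of `v - α u`, so their second-order discrepancy is weighted by the
distance to equilibrium. With `τ = Δt / ε` and a defect of order `ε`, one power of `1/ε` is saved.
-/
theorem norm_relaxOp_exp_sub_le {τ : ℝ} (hτ : 0 ≤ τ) (f : State) :
    ‖relaxOp hr (expKappa_nonneg H τ) (expSigma_nonneg (H := H) hτ) f -
      relaxOp hr le_rfl hτ f‖ ≤ 2 * H ^ 2 * τ ^ 2 / c * defect c α f := by
  have hc := hr.c_pos
  rw [defect, ← integral_const_mul]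
  refine state_norm_le ((integrable_defect hr f).const_mul _) ?_
  filter_upwards [source_coe c (hr.isNemytskii le_rfl hτ) f, state_sub_coe
    (relaxOp hr (expKappa_nonneg H τ) (expSigma_nonneg (H := H) hτ) f)
      (relaxOp hr le_rfl hτ f), source_coe c (hr.isNemytskii
        (expKappa_nonneg H τ) (expSigma_nonneg (H := H) hτ)) f] with x h1 h2 h3
  rw [h2.1, h2.2, relaxOp, relaxOp, h1.1, h1.2, h3.1, h3.2, ← neg_sub', abs_neg, ← sub_div, abs_div,
    abs_of_pos (by positivity : 0 < 2 * c), ← two_mul,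
    mul_div_assoc', mul_div_mul_left _ _ two_ne_zero, div_mul_eq_mul_div]
  refine div_le_div_of_nonneg_right ?_ hc.le
  set u := uOf f x
  set v := vOf c f x
  obtain ⟨q, hq1, hq2, hq3⟩ := hr.eq_slope u v
  have hq : 0 < q := hr.b_pos.trans_le hq1
  have e : decrement r α (expKappa H τ) (expSigma H τ) u v - decrement r α 0 τ u v =
      (expKappa H τ - (τ - expSigma H τ) * q) * (v - α u) := by
    rw [decrement, decrement, hq3]; ring
  rw [e, abs_mul]
  refine mul_le_mul_of_nonneg_right ?_ (abs_nonneg _)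
  have a1 := expKappa_nonneg H τ
  have a2 := expKappa_le_sq hr.H_pos.le hτ
  have a3 := sub_expSigma_le (H := H) hτ
  have a4 := sub_nonneg.2 (expSigma_le hr.H_pos.le hτ)
  have a5 : (τ - expSigma H τ) * q ≤ H * τ ^ 2 * H := mul_le_mul a3 hq2 hq.le (by
    have := hr.H_pos; positivity)
  have a6 : 0 ≤ (τ - expSigma H τ) * q := by positivity
  have a7 : 0 ≤ H ^ 2 * τ ^ 2 := by positivity
  rw [abs_le]; constructor <;> nlinarith

/-- The step leaves `u`, hence the equilibrium value, unchanged, and the pointwise damping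
integrates. -/
theorem defect_add_relaxOp_le {σ : ℝ} (hσ : 0 ≤ σ) (h1 : σ * H ≤ 1) (f : State) :
    defect c α (f + relaxOp hr le_rfl hσ f) ≤ (1 - σ * b) * defect c α f := by
  rw [defect, defect, ← integral_const_mul]
  refine integral_mono_ae (integrable_defect hr _) ((integrable_defect hr f).const_mul _) ?_
  filter_upwards [uOf_add_source hr.c_pos.ne' (hr.isNemytskii le_rfl hσ) f] with x h
  rw [relaxOp, h.1, h.2]
  exact hr.abs_sub_decrement_le hσ h1 _ _

end Operators

end

end RelaxationAP

namespace RelaxationAP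

noncomputable section

theorem TransLip.nonneg {Y : ℝ → State →ₗᵢ[ℝ] State} {D : ℝ} {f : State} (h : TransLip Y D f) :
    0 ≤ D := by
  simpa using (norm_nonneg _).trans (h 1)

/-! ### A priori bounds for the relaxation flow. -/

section RelaxationFlow

variable {r : ℝ → ℝ → ℝ} {α : ℝ → ℝ} {c b H : ℝ} (hr : IsGlobalTerm r α c b H) {ε : ℝ} (hε : 0 < ε)

/-- The operator `f ↦ (-q, q)`, `q = r(u, v) / (2 c ε)`. -/
def relaxSource : State → State := relaxOp hr le_rfl (one_div_nonneg.2 hε.le)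

theorem lipschitz_relaxSource : LipschitzWith (2 * H / ε).toNNReal (relaxSource hr hε) := by
  have hH := hr.H_pos
  refine LipschitzWith.of_dist_le_mul fun f g => ?_
  rw [Real.coe_toNNReal _ (by positivity), dist_eq_norm, dist_eq_norm]
  refine (lipschitz_relaxOp hr _ _ f g).trans (le_of_eq ?_)
  ring

theorem relaxSource_pairShift (y : ℝ) (f : State) :
    relaxSource hr hε (pairShift 1 1 y f) = pairShift 1 1 y (relaxSource hr hε f) :=
  source_pairShift (hr.isNemytskii le_rfl (one_div_nonneg.2 hε.le)) y f

theorem relaxSource_zero : relaxSource hr hε 0 = 0 := relaxOp_zero hr _ _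

theorem smul_relaxSource {h : ℝ} (hh : 0 ≤ h) (f : State) :
    h • relaxSource hr hε f = relaxOp hr le_rfl (div_nonneg hh hε.le) f := by
  rw [relaxSource, smul_relaxOp hr _ hh]
  congr 1
  ring_nf

theorem mul_le_one_of_le_div {ε H h : ℝ} (hε : 0 < ε) (hH : 0 < H) (hh : h ≤ ε / H) :
    h / ε * H ≤ 1 := by
  rw [le_div_iff₀ hH] at hh
  rw [div_mul_eq_mul_div, div_le_one hε]
  exact hh

theorem relaxSource_dissipative (h : ℝ) (hh : 0 < h) (hh' : h ≤ ε / H) (f f' : State) :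
    ‖(f + h • relaxSource hr hε f) - (f' + h • relaxSource hr hε f')‖ ≤ ‖f - f'‖ := by
  rw [smul_relaxSource hr hε hh.le, smul_relaxSource hr hε hh.le]
  refine norm_add_relaxOp_sub_le hr _ _ ?_ f f'
  rw [zero_add]
  exact mul_le_one_of_le_div hε hr.H_pos hh'

variable {g : ℝ → State} (hg : IsMildCurve (pairShift c (-c)) (relaxSource hr hε) g) {D : ℝ}
  (hD : TransLip (pairShift 1 1) D (g 0))
include hg hD

theorem transLip_flow {t : ℝ} (ht : 0 ≤ t) :
    TransLip (pairShift 1 1) D (pairShift c (-c) t (g t)) :=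
  IsMildCurve.transLip (isIsometryGroup_pairShift _ _) (div_pos hε hr.H_pos)
    (relaxSource_dissipative hr hε) (fun _ _ _ => pairShift_comm _ _ _ _ _ _ _)
    (relaxSource_pairShift hr hε) hg hD ht

theorem norm_char_flow_sub_le (s t : ℝ) (ht : 0 ≤ t) :
    ‖pairShift c (-c) s (pairShift c (-c) t (g t)) - pairShift c (-c) t (g t)‖ ≤ c * D * |s| :=
  (transLip_flow hr hε hg hD ht).char hr.c_pos.le s

theorem norm_char_source_sub_le (s t : ℝ) (ht : 0 ≤ t) :
    ‖pairShift c (-c) s (relaxSource hr hε (pairShift c (-c) t (g t))) -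
      relaxSource hr hε (pairShift c (-c) t (g t))‖ ≤ c * (2 * H / ε * D) * |s| := by
  have hH := hr.H_pos
  refine TransLip.char hr.c_pos.le (fun y => ?_) s
  rw [← relaxSource_pairShift]
  refine ((lipschitz_relaxSource hr hε).norm_sub_le _ _).trans ?_
  rw [Real.coe_toNNReal _ (by positivity), mul_assoc]
  exact mul_le_mul_of_nonneg_left (transLip_flow hr hε hg hD ht y) (by positivity)

/-- Damping at rate `b / ε` competes with transport, which changes the defect at rate at most `2 c *
(c * D)`. The balance is of order `ε`, uniformly in time. -/
theorem defect_flow_le {t : ℝ} (ht : 0 ≤ t) :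
    defect c α (pairShift c (-c) t (g t)) ≤ defect c α (g 0) + (2 * c * (c * D) + 1) / b * ε := by
  have hc := hr.c_pos
  have hb := hr.b_pos
  have hH := hr.H_pos
  have hD0 := hD.nonneg
  have := hg.functional_le (isIsometryGroup_pairShift _ _) (lipschitz_relaxSource hr hε)
    (div_pos hε hH) (d := defect c α) (Kd := 2 * c) (γ := b / ε) (Λ := c * D) (by positivity)
    (by positivity) (by
      rw [div_mul_div_comm, mul_comm ε, mul_div_mul_right _ _ hε.ne', div_le_one hH]
      exact hr.b_le)
    (defect_sub_le hr) (fun f => defect_nonneg f) (fun h hh hh' f => by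
      rw [smul_relaxSource hr hε hh.le]
      refine (defect_add_relaxOp_le hr _ (mul_le_one_of_le_div hε hr.H_pos hh') f).trans (le_of_eq ?_)
      ring) (by positivity) (norm_char_flow_sub_le hr hε hg hD) ht
  refine this.trans (le_of_eq ?_)
  rw [div_div_eq_mul_div]; ring

theorem norm_source_flow_le {t : ℝ} (ht : 0 ≤ t) :
    ‖relaxSource hr hε (pairShift c (-c) t (g t))‖ ≤
      H / (c * ε) * (defect c α (g 0) + (2 * c * (c * D) + 1) / b * ε) := by
  have hc := hr.c_pos
  have hH := hr.H_pos
  refine (norm_relaxOp_le hr _ _).trans ?_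
  have e : H * (1 / ε) / c = H / (c * ε) := by field_simp
  rw [e]
  exact mul_le_mul_of_nonneg_left (defect_flow_le hr hε hg hD ht) (by positivity)

theorem flow_lipschitz (s t : ℝ) (hs : 0 ≤ s) (ht : 0 ≤ t) :
    ‖pairShift c (-c) s (g s) - pairShift c (-c) t (g t)‖ ≤
      (H / (c * ε) * (defect c α (g 0) + (2 * c * (c * D) + 1) / b * ε) + c * D) * |s - t| :=
  hg.apply_norm_sub_le (isIsometryGroup_pairShift _ _)
    (fun _ ht => norm_source_flow_le hr hε hg hD ht) (norm_char_flow_sub_le hr hε hg hD) hs ht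

end RelaxationFlow

/-- One step of the scheme on states: upwind step of Courant number `c Δt / Δx`, then the
exponential relaxation step. -/
def schemeStep {r : ℝ → ℝ → ℝ} {α : ℝ → ℝ} {c b H : ℝ} (hr : IsGlobalTerm r α c b H) {ε Δt : ℝ}
    (hτ : 0 ≤ Δt / ε) (Δx : ℝ) : State → State :=
  splitStep (pairShift c (-c))
    (relaxOp hr (expKappa_nonneg H (Δt / ε)) (expSigma_nonneg (H := H) hτ)) (c * Δt / Δx) (Δx / c)

theorem add_le_one_add_mul_add_one {C x : ℝ} (hC : 0 ≤ C) (hx : 0 ≤ x) :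
    x + C ≤ (1 + C) * (x + 1) := by
  nlinarith [mul_nonneg hC hx]

/-- Collects the local errors of one time step of the scheme. -/
theorem local_error_le {c H D C₁ ε M m s x Δt Dl L : ℝ} (hc : 0 < c) (hH : 0 < H) (hD : 0 ≤ D)
    (hC₁ : 0 ≤ C₁) (hε : 0 < ε) (hεM : ε ≤ M) (hs : 0 < s) (hsm : s ≤ m) (hx : 0 ≤ x) (hΔt : 0 < Δt)
    (hDl : Dl = ε * (x + C₁)) (hL : L = H / c * (x + C₁) + c * D) :
    4 * (c * D) * Δt * (s * s / c) / (s / c) +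
      4 * H * (Δt / ε) * (c * D * (s * s / c + s / c)) + 2 * H ^ 2 * (Δt / ε) ^ 2 / c * Dl +
        (2 * H / ε * L + c * (2 * H / ε * D)) * Δt ^ 2 + Δt * (c * (2 * H / ε * D) * (s / c)) ≤
      Δt * ((4 * c * D * M + 4 * H * D * (m + 1) + 2 * H * D + 4 * H ^ 2 / c * (1 + C₁) +
        4 * H * c * D) / ε * (Δt * (x + 1) + s)) := by
  -- Here `s = √Δx`, the grid time is `k = s * s / c` and the averaging time is `η = s / c`.
  -- Substituting `Dl = ε * (x + C₁)` cancels one of the factors `1 / ε` of the relaxation error.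
  have e : 4 * (c * D) * Δt * (s * s / c) / (s / c) +
      4 * H * (Δt / ε) * (c * D * (s * s / c + s / c)) + 2 * H ^ 2 * (Δt / ε) ^ 2 / c * Dl +
        (2 * H / ε * L + c * (2 * H / ε * D)) * Δt ^ 2 + Δt * (c * (2 * H / ε * D) * (s / c)) =
      Δt * ((4 * c * D * ε * s + 4 * H * D * (s + 1) * s + 2 * H * D * s +
        (4 * H ^ 2 / c * (x + C₁) + 4 * H * c * D) * Δt) / ε) := by
    rw [hL, hDl]
    field_simp
    ring
  have hm : 0 ≤ m := hs.le.trans hsm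
  have hM : 0 < M := hε.trans_le hεM
  rw [e, div_mul_eq_mul_div (_ + 4 * H * c * D)]
  refine mul_le_mul_of_nonneg_left (div_le_div_of_nonneg_right ?_ hε.le) hΔt.le
  have a1 : 4 * c * D * ε * s ≤ 4 * c * D * M * s := by gcongr
  have a2 : 4 * H * D * (s + 1) * s ≤ 4 * H * D * (m + 1) * s := by gcongr
  have a3 : 4 * H ^ 2 / c * (x + C₁) * Δt ≤ 4 * H ^ 2 / c * (1 + C₁) * (Δt * (x + 1)) := by
    have := add_le_one_add_mul_add_one hC₁ hx
    calc 4 * H ^ 2 / c * (x + C₁) * Δt ≤ 4 * H ^ 2 / c * ((1 + C₁) * (x + 1)) * Δt := by gcongr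
      _ = _ := by ring
  have a4 : 4 * H * c * D * Δt ≤ 4 * H * c * D * (Δt * (x + 1)) := by
    refine mul_le_mul_of_nonneg_left ?_ (by positivity)
    nlinarith [mul_nonneg hΔt.le hx]
  have p1 : 0 ≤ 4 * c * D * M + 4 * H * D * (m + 1) + 2 * H * D := by positivity
  have p2 : 0 ≤ 4 * H ^ 2 / c * (1 + C₁) + 4 * H * c * D := by positivity
  have p3 : 0 ≤ Δt * (x + 1) := by positivity
  have q1 := mul_nonneg p1 p3
  have q2 := mul_nonneg p2 hs.le
  linarith

/-- Collects the errors committed before the first and after the last time step. -/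
theorem boundary_error_le {c H D C₁ ε M m s x Δt L i j : ℝ} (hc : 0 < c) (hH : 0 < H) (hD : 0 ≤ D)
    (hC₁ : 0 ≤ C₁) (hε : 0 < ε) (hεM : ε ≤ M) (hs : 0 < s) (hsm : s ≤ m) (hx : 0 ≤ x) (hΔt : 0 < Δt)
    (hL : L = H / c * (x + C₁) + c * D) (hi : i ≤ 2 * D * (s * s)) (hj : j ≤ Δt) :
    i + 2 * (c * D) * (s / c) + L * j ≤
      (2 * D * m * M + 2 * D * M + M * (H / c * (1 + C₁) + c * D)) / ε * (Δt * (x + 1) + s) := by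
  have hm : 0 ≤ m := hs.le.trans hsm
  have hx1 : 0 ≤ Δt * x := by positivity
  have hL0 : 0 ≤ L := by rw [hL]; positivity
  have b1 : L * j ≤ L * Δt := mul_le_mul_of_nonneg_left hj hL0
  -- The boundary errors carry no factor `1 / ε`; it is inserted by means of `ε ≤ M`.
  have b2 : 1 ≤ M / ε := by rw [le_div_iff₀ hε]; linarith
  have c1 : H / c * (x + C₁) * Δt ≤ H / c * (1 + C₁) * (Δt * (x + 1)) := by
    have := add_le_one_add_mul_add_one hC₁ hx
    calc H / c * (x + C₁) * Δt ≤ H / c * ((1 + C₁) * (x + 1)) * Δt := by gcongr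
      _ = _ := by ring
  have c2 : c * D * Δt ≤ c * D * (Δt * (x + 1)) :=
    mul_le_mul_of_nonneg_left (by linarith) (by positivity)
  have c3 : 0 ≤ (H / c * (1 + C₁) + c * D) * s := by positivity
  have d1 : D * (s * s) ≤ D * (m * s) := by gcongr
  have d2 : 2 * (c * D) * (s / c) = 2 * D * s := by field_simp
  have d3 : 0 ≤ (2 * D * m + 2 * D) * (Δt * (x + 1)) := by positivity
  have b3 : L * Δt = H / c * (x + C₁) * Δt + c * D * Δt := by rw [hL]; ring
  have b4 : 0 ≤ (2 * D * m + 2 * D + (H / c * (1 + C₁) + c * D)) * (Δt * (x + 1) + s) := by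
    positivity
  calc i + 2 * (c * D) * (s / c) + L * j
      ≤ 1 * ((2 * D * m + 2 * D + (H / c * (1 + C₁) + c * D)) * (Δt * (x + 1) + s)) := by linarith
    _ ≤ M / ε * ((2 * D * m + 2 * D + (H / c * (1 + C₁) + c * D)) * (Δt * (x + 1) + s)) :=
        mul_le_mul_of_nonneg_right b2 b4
    _ = _ := by ring

/-- Error estimate for the scheme on states, uniform in `ε`. -/
theorem exists_schemeStep_error {r : ℝ → ℝ → ℝ} {α : ℝ → ℝ} {c b H : ℝ}
    (hr : IsGlobalTerm r α c b H) (τ M D : ℝ) : ∃ C, 0 ≤ C ∧ ∀ (ε : ℝ) (hε : 0 < ε), ε ≤ M →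
      ∀ g : ℝ → State, IsMildCurve (pairShift c (-c)) (relaxSource hr hε) g →
      TransLip (pairShift 1 1) D (g 0) → ∀ (Δt Δx : ℝ) (hΔt : 0 < Δt), 0 < Δx → c * Δt / Δx < 1 →
      Δx ≤ M → ∀ F₀ : State, ‖F₀ - g 0‖ ≤ 2 * D * Δx → ∀ (n : ℕ) (t : ℝ), t ≤ τ → n * Δt ≤ t →
      t ≤ (n + 1) * Δt →
      ‖(schemeStep hr (div_nonneg hΔt.le hε.le) Δx)^[n] F₀ - pairShift c (-c) t (g t)‖ ≤
        C / ε * (Δt * (defect c α (g 0) / ε + 1) + √Δx) := by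
  have hc := hr.c_pos
  have hb := hr.b_pos
  have hH := hr.H_pos
  -- Absolute values give a nonnegative constant before any sign is known; once a datum is present,
  -- `D' = D` and `M' = M`.
  set D' := |D|
  set M' := |M|
  set m := √M'
  set C₁ := (2 * c * (c * D') + 1) / b with hC₁
  have hC₁0 : 0 ≤ C₁ := by positivity
  set C₂ := 4 * c * D' * M' + 4 * H * D' * (m + 1) + 2 * H * D' + 4 * H ^ 2 / c * (1 + C₁) +
    4 * H * c * D' with hC₂
  have hC₂0 : 0 ≤ C₂ := by positivity
  refine ⟨2 * D' * m * M' + 2 * D' * M' + |τ| * C₂ + M' * (H / c * (1 + C₁) + c * D'),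
    by positivity, ?_⟩
  intro ε hε hεM g hg hD Δt Δx hΔt hΔx hcfl hΔxM F₀ hF₀ n t htτ hnt htn
  have hD0 := hD.nonneg
  have hDD : D' = D := abs_of_nonneg hD0
  have hMM : M' = M := abs_of_pos (hε.trans_le hεM)
  have hM0 : 0 < M' := hMM ▸ hε.trans_le hεM
  set s := √Δx with hs
  have hs0 : 0 < s := Real.sqrt_pos.2 hΔx
  have hss : s * s = Δx := Real.mul_self_sqrt hΔx.le
  have hsm : s ≤ m := Real.sqrt_le_sqrt (hMM ▸ hΔxM)
  have hm0 : 0 ≤ m := Real.sqrt_nonneg _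
  set d := defect c α (g 0) with hd
  have hd0 : 0 ≤ d := defect_nonneg _
  set x := d / ε with hx
  have hx0 : 0 ≤ x := by positivity
  have hdx : d = ε * x := by rw [hx]; field_simp
  set Dl := d + C₁ * ε with hDl
  have hDlx : Dl = ε * (x + C₁) := by rw [hDl, hdx]; ring
  have hDlf : ∀ t, 0 ≤ t → defect c α (pairShift c (-c) t (g t)) ≤ Dl := fun t ht => by
    have := defect_flow_le hr hε hg hD ht
    rwa [← hDD] at this
  set L := H / (c * ε) * Dl + c * D with hL
  have hLf : ∀ s t, 0 ≤ s → 0 ≤ t →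
      ‖pairShift c (-c) s (g s) - pairShift c (-c) t (g t)‖ ≤ L * |s - t| := fun s t hs ht => by
    have := flow_lipschitz hr hε hg hD s t hs ht
    rwa [← hDD, ← hC₁, ← hDl, hDD] at this
  have hLx : L = H / c * (x + C₁) + c * D := by rw [hL, hDlx]; field_simp
  have hn0 : 0 ≤ (n : ℝ) * Δt := by positivity
  have hlk : c * Δt / Δx * (Δx / c) = Δt := by field_simp
  have hτ0 : 0 ≤ Δt / ε := by positivity
  -- The averaging time `s / c = √Δx / c` balances the averaging error, of order `η`, against the
  -- accumulated upwind error, of order `Δx / η`.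
  have main := norm_iterate_splitStep_sub_le (isIsometryGroup_pairShift c (-c)) hg
    (lipschitz_relaxSource hr hε)
    (Q := relaxOp hr (expKappa_nonneg H (Δt / ε)) (expSigma_nonneg (H := H) hτ0))
    (norm_add_relaxOp_sub_le hr _ _ (by
      rw [expKappa_add_expSigma]; linarith [Real.exp_pos (-(H * (Δt / ε)))]))
    (A₁ := 4 * H * (Δt / ε)) (A₂ := 2 * H ^ 2 * (Δt / ε) ^ 2 / c * Dl) (fun F F' => by
      refine (lipschitz_relaxOp hr _ _ F F').trans
        (mul_le_mul_of_nonneg_right ?_ (norm_nonneg _))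
      have h1 := expKappa_le hH.le hτ0
      have h2 := mul_le_mul_of_nonneg_left (expSigma_le hH.le hτ0) hH.le
      linarith) (by positivity) (l := c * Δt / Δx) (k := Δx / c) (η := s / c) (by positivity)
      hcfl.le (by positivity) (by positivity) (fun t ht => by
        rw [hlk, smul_relaxSource hr hε hΔt.le]
        refine (norm_relaxOp_exp_sub_le hr hτ0 _).trans ?_
        exact mul_le_mul_of_nonneg_left (hDlf t ht) (by positivity))
      (norm_char_flow_sub_le hr hε hg hD) hLf (norm_char_source_sub_le hr hε hg hD) F₀ n
  rw [hlk, Real.coe_toNNReal _ (by positivity)] at main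
  have hE := local_error_le hc hH hD0 hC₁0 hε hεM hs0 hsm hx0 hΔt hDlx hLx
  rw [hss, ← hDD, ← hMM, ← hC₂, hDD] at hE
  -- The numerical solution is frozen on each time slab, so the exact one must be compared at `t`
  -- and at `n * Δt`.
  have hlast := hLf (n * Δt) t hn0 (hn0.trans hnt)
  have hdt : |n * Δt - t| ≤ Δt := by
    rw [abs_le]; constructor <;> linarith
  have hbd := boundary_error_le hc hH hD0 hC₁0 hε hεM hs0 hsm hx0 hΔt hLx (hss ▸ hF₀) hdt
  rw [← hDD, ← hMM, hDD] at hbd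
  set W := Δt * (x + 1) + s with hW
  have hW0 : 0 ≤ W := by positivity
  have hnE : (n : ℝ) * (Δt * (C₂ / ε * W)) ≤ |τ| * (C₂ / ε * W) := by
    rw [← mul_assoc]
    exact mul_le_mul_of_nonneg_right ((hnt.trans htτ).trans (le_abs_self τ)) (by positivity)
  have hnE' := mul_le_mul_of_nonneg_left hE (Nat.cast_nonneg n)
  refine (norm_sub_le_norm_sub_add_norm_sub _ (pairShift c (-c) (n * Δt) (g (n * Δt))) _).trans ?_
  refine (add_le_add main hlast).trans ?_
  have fin : (2 * D' * m * M' + 2 * D' * M' + |τ| * C₂ + M' * (H / c * (1 + C₁) + c * D')) / ε * W =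
      (2 * D' * m * M' + 2 * D' * M' + M' * (H / c * (1 + C₁) + c * D')) / ε * W +
        |τ| * (C₂ / ε * W) := by ring
  rw [fin, hDD]
  linarith

end

end RelaxationAP

namespace RelaxationAP

noncomputable section

/-! ### Grid functions -/

/-- The function equal to `s j` on the `j`-th (half-open) cell. -/
def gridFn (ξ Δx : ℝ) (s : ℤ → ℝ) (x : ℝ) : ℝ := s ⌊(x - ξ) / Δx + 1 / 2⌋

theorem gridFn_add {Δx : ℝ} (hΔx : 0 < Δx) (ξ : ℝ) (s : ℤ → ℝ) (x : ℝ) (m : ℤ) :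
    gridFn ξ Δx s (x + m * Δx) = s (⌊(x - ξ) / Δx + 1 / 2⌋ + m) := by
  have e : (x + m * Δx - ξ) / Δx + 1 / 2 = (x - ξ) / Δx + 1 / 2 + m := by field_simp; ring
  rw [gridFn, e, Int.floor_add_intCast]

theorem measurable_gridFn (ξ Δx : ℝ) (s : ℤ → ℝ) : Measurable (gridFn ξ Δx s) :=
  (measurable_from_top (f := s)).comp
    (Int.measurable_floor.comp (((measurable_id.sub_const ξ).div_const Δx).add_const (1 / 2)))

/-- The cells are open, so the floor gives the right index only away from the countably many
interfaces. -/
theorem mem_cell_floor {Δx : ℝ} (hΔx : 0 < Δx) (ξ : ℝ) :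
    ∀ᵐ x : ℝ, ∀ j : ℤ, x ∈ cell ξ Δx j ↔ j = ⌊(x - ξ) / Δx + 1 / 2⌋ := by
  have h0 : ∀ᵐ x : ℝ, ∀ j : ℤ, x ≠ ξ + ((j : ℝ) - 1 / 2) * Δx := by
    rw [ae_all_iff]
    intro j
    exact Measure.ae_ne volume _
  filter_upwards [h0] with x hx j
  have e1 : ξ + ((j : ℝ) - 1 / 2) * Δx < x ↔ (j : ℝ) < (x - ξ) / Δx + 1 / 2 := by
    rw [← sub_lt_iff_lt_add, lt_div_iff₀ hΔx]
    constructor <;> intro h <;> linarith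
  have e1' : ξ + ((j : ℝ) - 1 / 2) * Δx ≤ x ↔ (j : ℝ) ≤ (x - ξ) / Δx + 1 / 2 := by
    rw [← sub_le_iff_le_add, le_div_iff₀ hΔx]
    constructor <;> intro h <;> linarith
  have e2 : x < ξ + ((j : ℝ) + 1 / 2) * Δx ↔ (x - ξ) / Δx + 1 / 2 < j + 1 := by
    rw [← lt_sub_iff_add_lt, div_lt_iff₀ hΔx]
    constructor <;> intro h <;> linarith
  rw [eq_comm, Int.floor_eq_iff, cell, mem_Ioo, e2, e1, ← e1']
  constructor
  · rintro ⟨h1, h2⟩; exact ⟨(e1.2 h1).le, h2⟩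
  · rintro ⟨h1, h2⟩; exact ⟨e1.1 (lt_of_le_of_ne h1 (hx j).symm), h2⟩

/-- On the time slab `[nΔt, (n+1)Δt)` the numerical solution is a grid function. -/
theorem piecewiseConst_ae_eq {Δt Δx : ℝ} (hΔt : 0 < Δt) (hΔx : 0 < Δx) (ξ : ℝ) (k : ℕ → ℤ → ℝ)
    (n : ℕ) {t : ℝ} (h1 : n * Δt ≤ t) (h2 : t < (n + 1) * Δt) :
    piecewiseConst ξ Δt Δx k t =ᵐ[volume] gridFn ξ Δx (k n) := by
  have hn : ∀ n' : ℕ, n' ≠ n → t ∉ Ico ((n' : ℝ) * Δt) (((n' : ℝ) + 1) * Δt) := by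
    rintro n' hne ⟨h3, h4⟩
    have a1 : (n' : ℝ) < n + 1 := lt_of_mul_lt_mul_right (h3.trans_lt h2) hΔt.le
    have a2 : (n : ℝ) < n' + 1 := lt_of_mul_lt_mul_right (h1.trans_lt h4) hΔt.le
    have a3 : n' < n + 1 := by exact_mod_cast a1
    have a4 : n < n' + 1 := by exact_mod_cast a2
    omega
  have hn' : t ∈ Ico ((n : ℝ) * Δt) (((n : ℝ) + 1) * Δt) := ⟨h1, h2⟩
  filter_upwards [mem_cell_floor hΔx ξ] with x hx
  rw [piecewiseConst, tsum_eq_single n]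
  · rw [tsum_eq_single ⌊(x - ξ) / Δx + 1 / 2⌋]
    · rw [indicator_of_mem ((hx _).2 rfl), indicator_of_mem hn', gridFn]
      simp
    · intro j hj
      rw [indicator_of_notMem fun h => hj ((hx j).1 h)]
      simp
  · intro n' hne
    simp [indicator_of_notMem (hn n' hne)]

/-! ### The scheme on states -/

/-- The state whose conserved variable and flux variable are the grid functions of `s`. -/
def Represents (c ξ Δx : ℝ) (F : State) (s : (ℤ → ℝ) × (ℤ → ℝ)) : Prop :=
  ∀ᵐ x, uOf F x = gridFn ξ Δx s.1 x ∧ vOf c F x = gridFn ξ Δx s.2 x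

theorem fst_eq {c : ℝ} (hc : c ≠ 0) (F : State) (x : ℝ) : F.fst x = (uOf F x + vOf c F x / c) / 2 := by
  rw [uOf, vOf]; field_simp; ring

theorem snd_eq {c : ℝ} (hc : c ≠ 0) (F : State) (x : ℝ) : F.snd x = (uOf F x - vOf c F x / c) / 2 := by
  rw [uOf, vOf]; field_simp; ring

/-- In characteristic variables the centred differences with viscosity `√a` are one-sided: the first
component takes the value from the left cell, the second from the right one. Shifting by time `Δx /
c` moves a grid function by exactly one cell, so states represented on the grid stay on it. -/
theorem Represents.schemeStep {r : ℝ → ℝ → ℝ} {α : ℝ → ℝ} {a b H : ℝ} (ha : 0 < a)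
    (hr : IsGlobalTerm r α √a b H) {ε Δt ξ Δx : ℝ} (hτ : 0 ≤ Δt / ε) (hΔx : 0 < Δx)
    {F : State} {s : (ℤ → ℝ) × (ℤ → ℝ)} (hF : Represents √a ξ Δx F s) :
    Represents √a ξ Δx (schemeStep hr hτ Δx F)
      (relaxationStep r α H ε Δt (transportStep a Δt Δx s)) := by
  have hc := hr.c_pos
  set c := √a with hcdef
  have haa : a = c * c := (Real.mul_self_sqrt ha.le).symm
  set P := (1 - c * Δt / Δx) • F + (c * Δt / Δx) • pairShift c (-c) (Δx / c) F with hP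
  have hcx : c * (Δx / c) = Δx := by field_simp
  have hP' : Represents c ξ Δx P (transportStep a Δt Δx s) := by
    have hs1 := shift_coe (c * (Δx / c)) F.fst
    have hs2 := shift_coe (-c * (Δx / c)) F.snd
    have hFm := ae_comp_sub Δx hF
    have hFp := ae_comp_sub (-Δx) hF
    rw [neg_mul] at hs2
    rw [hcx] at hs1 hs2
    filter_upwards [state_add_coe ((1 - c * Δt / Δx) • F)
      ((c * Δt / Δx) • pairShift c (-c) (Δx / c) F), state_smul_coe (1 - c * Δt / Δx) F,
      state_smul_coe (c * Δt / Δx) (pairShift c (-c) (Δx / c) F), hs1, hs2, hF, hFm, hFp]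
      with x h1 h2 h3 h4 h5 h6 h7 h8
    rw [pairShift_fst, pairShift_snd, neg_mul, hcx] at h3
    have e1 : P.fst x = (1 - c * Δt / Δx) * F.fst x + c * Δt / Δx * F.fst (x - Δx) := by
      rw [hP, h1.1, h2.1, h3.1, h4]
    have e2 : P.snd x = (1 - c * Δt / Δx) * F.snd x + c * Δt / Δx * F.snd (x - -Δx) := by
      rw [hP, h1.2, h2.2, h3.2, h5]
    have g0 : ∀ s : ℤ → ℝ, gridFn ξ Δx s (x - Δx) = s (⌊(x - ξ) / Δx + 1 / 2⌋ - 1) := fun s => by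
      have := gridFn_add hΔx ξ s x (-1)
      rw [← sub_eq_add_neg, Int.cast_neg, Int.cast_one, neg_one_mul, ← sub_eq_add_neg] at this
      exact this
    have g1 : ∀ s : ℤ → ℝ, gridFn ξ Δx s (x - -Δx) = s (⌊(x - ξ) / Δx + 1 / 2⌋ + 1) := fun s => by
      have := gridFn_add hΔx ξ s x 1
      rw [Int.cast_one, one_mul] at this
      rw [sub_neg_eq_add, this]
    rw [fst_eq hc.ne' F, fst_eq hc.ne' F, h6.1, h6.2, h7.1, h7.2, g0, g0] at e1
    rw [snd_eq hc.ne' F, snd_eq hc.ne' F, h6.1, h6.2, h8.1, h8.2, g1, g1] at e2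
    simp only [gridFn, transportStep, discreteDv, discreteADu, ← hcdef] at e1 e2 ⊢
    rw [uOf, vOf, e1, e2, haa]
    constructor <;> field_simp <;> ring
  filter_upwards [hP', uOf_add_source hc.ne' (hr.isNemytskii (expKappa_nonneg H (Δt / ε))
    (expSigma_nonneg (H := H) hτ)) P] with x h1 h2
  have e : RelaxationAP.schemeStep hr hτ Δx F = P + source c (hr.isNemytskii (expKappa_nonneg H (Δt / ε))
    (expSigma_nonneg (H := H) hτ)) P := rfl
  rw [e, h2.1, h2.2, h1.1, h1.2]
  refine ⟨rfl, ?_⟩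
  simp only [gridFn, relaxationStep, decrement, expKappa, expSigma, mul_div_assoc]
  ring

theorem Represents.iterate {r : ℝ → ℝ → ℝ} {α : ℝ → ℝ} {a b H : ℝ} (ha : 0 < a)
    (hr : IsGlobalTerm r α √a b H) {ε Δt ξ Δx : ℝ} (hτ : 0 ≤ Δt / ε) (hΔx : 0 < Δx)
    {F : State} {u₀ v₀ : ℝ → ℝ}
    (hF : Represents √a ξ Δx F (cellAverage ξ Δx u₀, cellAverage ξ Δx v₀)) (n : ℕ) :
    Represents √a ξ Δx ((RelaxationAP.schemeStep hr hτ Δx)^[n] F)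
      (scheme r α a H ε ξ Δt Δx u₀ v₀ n) := by
  induction n with
  | zero => exact hF
  | succ n ih =>
    rw [Function.iterate_succ_apply']
    exact ih.schemeStep ha hr hτ hΔx

/-! ### States with prescribed conserved and flux variables -/

/-- The state with conserved variable `u` and flux variable `v`. -/
def ofUV (c : ℝ) {u v : ℝ → ℝ} (hu : Integrable u) (hv : Integrable v) : State :=
  WithLp.toLp 1 (((hu.add (hv.div_const c)).div_const 2).toL1 _,
    ((hu.sub (hv.div_const c)).div_const 2).toL1 _)

theorem ofUV_coe {c : ℝ} (hc : c ≠ 0) {u v : ℝ → ℝ} (hu : Integrable u) (hv : Integrable v) :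
    ∀ᵐ x, uOf (ofUV c hu hv) x = u x ∧ vOf c (ofUV c hu hv) x = v x := by
  filter_upwards [((hu.add (hv.div_const c)).div_const 2).coeFn_toL1,
    ((hu.sub (hv.div_const c)).div_const 2).coeFn_toL1] with x h1 h2
  have h1' : (ofUV c hu hv).fst x = (u x + v x / c) / 2 := h1
  have h2' : (ofUV c hu hv).snd x = (u x - v x / c) / 2 := h2
  rw [uOf, vOf, h1', h2']
  constructor
  · ring
  · field_simp; ring

theorem uOf_sub (c : ℝ) (F G : State) : ∀ᵐ x, uOf (F - G) x = uOf F x - uOf G x ∧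
    vOf c (F - G) x = vOf c F x - vOf c G x := by
  filter_upwards [state_sub_coe F G] with x h
  rw [uOf, vOf, h.1, h.2, uOf, uOf, vOf, vOf]
  constructor <;> ring

theorem norm_le_integral_uv {c : ℝ} (hc : 0 < c) (F : State) :
    ‖F‖ ≤ (∫ x, |uOf F x|) + (∫ x, |vOf c F x|) / c := by
  rw [← integral_div, ← integral_add (integrable_uOf F).abs ((integrable_vOf c F).abs.div_const c)]
  refine state_norm_le ((integrable_uOf F).abs.add ((integrable_vOf c F).abs.div_const c))
    (Eventually.of_forall fun x => ?_)
  rw [abs_add_abs_eq_max]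
  refine max_le ?_ ?_
  · have := div_nonneg (abs_nonneg (vOf c F x)) hc.le
    rw [← uOf]; linarith
  · have : |F.fst x - F.snd x| = |vOf c F x| / c := by
      rw [vOf, abs_mul, abs_of_pos hc]; field_simp
    rw [this]
    have := abs_nonneg (uOf F x)
    linarith

theorem integral_uv_le_norm {c : ℝ} (hc : 0 < c) (F : State) :
    (∫ x, |uOf F x|) + ∫ x, |vOf c F x| ≤ (1 + c) * ‖F‖ := by
  rw [← integral_add (integrable_uOf F).abs (integrable_vOf c F).abs, state_norm_eq,
    ← integral_const_mul]
  refine integral_mono ((integrable_uOf F).abs.add (integrable_vOf c F).abs)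
    ((integrable_state F).const_mul _) fun x => ?_
  simp only [uOf, vOf, abs_mul, abs_of_pos hc]
  have h1 := abs_add_le (F.fst x) (F.snd x)
  have h2 := abs_sub (F.fst x) (F.snd x)
  nlinarith

end

end RelaxationAP

namespace RelaxationAP

noncomputable section

/-! ### Total variation and translations -/

/-- The points `x + k y` are increasing in `k`; a finite set of indices fits in `[-m, m)`, which is
renumbered from `0` to obtain a partition sum. -/
theorem sum_int_edist_le_eVariationOn (f : ℝ → ℝ) (x : ℝ) {y : ℝ} (hy : 0 ≤ y) :
    ∑' k : ℤ, ‖f (x + (k + 1 : ℤ) * y) - f (x + k * y)‖ₑ ≤ eVariationOn f univ := by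
  rw [ENNReal.tsum_eq_iSup_sum]
  refine iSup_le fun s => ?_
  obtain ⟨m, hm⟩ : ∃ m : ℕ, s ⊆ Finset.Ico (-(m : ℤ)) m := by
    refine ⟨s.sup (fun k => k.natAbs + 1), fun k hk => ?_⟩
    have : k.natAbs + 1 ≤ s.sup fun k => k.natAbs + 1 := Finset.le_sup (f := fun k => k.natAbs + 1) hk
    rw [Finset.mem_Ico]
    omega
  refine (Finset.sum_le_sum_of_subset hm).trans ?_
  have hu : Monotone fun i : ℕ => x + ((i : ℤ) - m : ℤ) * y := by
    refine monotone_nat_of_le_succ fun i => ?_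
    push_cast
    nlinarith
  refine le_trans (le_of_eq ?_) (eVariationOn.sum_le (f := f) (n := 2 * m) hu fun i => mem_univ _)
  symm
  refine Finset.sum_bij (fun i _ => (i : ℤ) - m) (fun i hi => ?_) (fun i _ j _ h => ?_)
    (fun k hk => ?_) (fun i _ => ?_)
  · rw [Finset.mem_range] at hi
    rw [Finset.mem_Ico]
    omega
  · simpa using h
  · rw [Finset.mem_Ico] at hk
    exact ⟨(k + m).toNat, by rw [Finset.mem_range]; omega, by omega⟩
  · rw [edist_eq_enorm_sub]
    congr 5
    push_cast
    ring

/-- The line is tiled by intervals of length `y`, all folded onto `(0, y]`. For each base point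
there the sum of increments is at most the variation, and integration contributes the length `y`. -/
theorem lintegral_translate_sub_le_eVariationOn {f : ℝ → ℝ} (hf : AEStronglyMeasurable f volume)
    {y : ℝ} (hy : 0 < y) :
    ∫⁻ x, ‖f (x + y) - f x‖ₑ ≤ ENNReal.ofReal y * eVariationOn f univ := by
  have hshift : ∀ a : ℝ, AEStronglyMeasurable (fun x => f (x + a)) volume := fun a =>
    hf.comp_quasiMeasurePreserving (measurePreserving_add_right volume a).quasiMeasurePreserving
  have h1 : ∫⁻ x, ‖f (x + y) - f x‖ₑ =
      ∑' k : ℤ, ∫⁻ x in Ioc 0 y, ‖f (x + (k + 1 : ℤ) * y) - f (x + k * y)‖ₑ := by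
    rw [← setLIntegral_univ, ← iUnion_Ioc_zsmul hy, lintegral_iUnion (fun _ => measurableSet_Ioc)
      (pairwise_disjoint_Ioc_zsmul y)]
    congr 1
    funext k
    have e : Ioc 0 y = (fun x : ℝ => x + k * y) ⁻¹' Ioc (k • y) ((k + 1) • y) := by
      ext x
      simp only [mem_Ioc, mem_preimage, zsmul_eq_mul, Int.cast_add, Int.cast_one]
      constructor <;> rintro ⟨h1, h2⟩ <;> constructor <;> linarith
    rw [e, ← (measurePreserving_add_right volume ((k : ℝ) * y)).setLIntegral_comp_preimage_emb
      (MeasurableEquiv.addRight ((k : ℝ) * y)).measurableEmbedding]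
    refine lintegral_congr fun x => ?_
    congr 3
    push_cast
    ring
  have hm : ∀ k : ℤ, AEMeasurable (fun x => ‖f (x + (k + 1 : ℤ) * y) - f (x + k * y)‖ₑ)
      (volume.restrict (Ioc 0 y)) := fun k => ((hshift _).sub (hshift _)).enorm.restrict
  rw [h1, ← lintegral_tsum hm]
  calc ∫⁻ x in Ioc 0 y, ∑' k : ℤ, ‖f (x + (k + 1 : ℤ) * y) - f (x + k * y)‖ₑ
      ≤ ∫⁻ x in Ioc 0 y, eVariationOn f univ :=
        lintegral_mono fun x => sum_int_edist_le_eVariationOn f x hy.le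
    _ = ENNReal.ofReal y * eVariationOn f univ := by
        rw [setLIntegral_const, Real.volume_Ioc, sub_zero, mul_comm]

theorem lintegral_translate_sub_le {f : ℝ → ℝ} (hf : AEStronglyMeasurable f volume) {B : ℝ≥0}
    (hB : totalVariation f ≤ B) (y : ℝ) :
    ∫⁻ x, ‖f (x + y) - f x‖ₑ ≤ ENNReal.ofReal |y| * B := by
  have pos : ∀ y : ℝ, 0 < y → ∫⁻ x, ‖f (x + y) - f x‖ₑ ≤ ENNReal.ofReal y * B := by
    intro y hy
    have h1 : ∀ f' : ℝ → ℝ, f' =ᵐ[volume] f →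
        ∫⁻ x, ‖f (x + y) - f x‖ₑ ≤ ENNReal.ofReal y * eVariationOn f' univ := by
      intro f' hf'
      refine le_trans (le_of_eq (lintegral_congr_ae ?_))
        (lintegral_translate_sub_le_eVariationOn (hf.congr hf'.symm) hy)
      filter_upwards [hf', (measurePreserving_add_right volume y).quasiMeasurePreserving.ae hf']
        with x h1 h2
      rw [h1, h2]
    have h2 : ∫⁻ x, ‖f (x + y) - f x‖ₑ ≤ ENNReal.ofReal y * totalVariation f := by
      have hy' : ENNReal.ofReal y ≠ 0 := by simpa using hy
      rw [totalVariation, ← ENNReal.div_le_iff' hy' ENNReal.ofReal_ne_top]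
      refine le_iInf₂ fun f' hf' => ?_
      rw [ENNReal.div_le_iff' hy' ENNReal.ofReal_ne_top]
      exact h1 f' hf'
    exact h2.trans (mul_le_mul_right hB _)
  rcases lt_trichotomy y 0 with hy | hy | hy
  · rw [abs_of_neg hy]
    refine le_trans (le_of_eq ?_) (pos (-y) (neg_pos.2 hy))
    rw [← lintegral_add_right_eq_self _ (-y)]
    refine lintegral_congr fun x => ?_
    rw [neg_add_cancel_right, ← enorm_neg, neg_sub]
  · simp [hy]
  · rw [abs_of_pos hy]; exact pos y hy

theorem IsDatum.integrable {N : ℝ} {B : ℝ≥0} {f : ℝ → ℝ} (hf : IsDatum N B f) : Integrable f := by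
  rw [← memLp_one_iff_integrable]
  exact ⟨hf.aestronglyMeasurable,
    (le_self_add.trans hf.bv).trans_lt (ENNReal.coe_lt_top (r := B))⟩

theorem IsDatum.lintegral_translate_sub_le {N : ℝ} {B : ℝ≥0} {f : ℝ → ℝ} (hf : IsDatum N B f)
    (y : ℝ) : ∫⁻ x, ‖f (x + y) - f x‖ₑ ≤ ENNReal.ofReal |y| * B :=
  RelaxationAP.lintegral_translate_sub_le hf.aestronglyMeasurable (le_add_self.trans hf.bv) y

theorem integral_abs_le_of_lintegral {w : ℝ → ℝ} (hw : Integrable w) {C : ℝ} (hC : 0 ≤ C)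
    (h : ∫⁻ x, ‖w x‖ₑ ≤ ENNReal.ofReal C) : ∫ x, |w x| ≤ C := by
  change ∫ x, ‖w x‖ ≤ C
  rw [integral_norm_eq_lintegral_enorm hw.aestronglyMeasurable]
  exact ENNReal.toReal_le_of_le_ofReal hC h

/-! ### Cell averages -/

theorem cellAverage_bound {ξ Δx N : ℝ} (hΔx : 0 < Δx) {f : ℝ → ℝ} (hf : ∀ᵐ x, |f x| ≤ N) (j : ℤ) :
    |cellAverage ξ Δx f j| ≤ N := by
  have h := norm_setIntegral_le_of_norm_le_const_ae' (s := cell ξ Δx j) (μ := volume) (f := f) (C := N)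
    (by rw [cell]; exact measure_Ioo_lt_top) (hf.mono fun x hx _ => hx)
  have hv : volume.real (cell ξ Δx j) = Δx := by
    rw [cell, Real.volume_real_Ioo_of_le (by nlinarith)]; ring
  rw [hv] at h
  rw [cellAverage, abs_mul, abs_of_pos (by positivity), one_div, inv_mul_le_iff₀ hΔx]
  rw [Real.norm_eq_abs] at h
  linarith

/-- The cell of `x` lies in `(x - Δx, x + Δx)`, so the averaging error at `x` is at most `1 / Δx`
times the integral of `|f (x + y) - f x|` over `|y| < Δx`. Exchanging the integrals and using the
modulus of translation leaves `1 / Δx` times `2 Δx` times `B Δx`. -/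
theorem lintegral_gridFn_sub_le {ξ Δx : ℝ} (hΔx : 0 < Δx) {f : ℝ → ℝ} (hf : Integrable f) {B : ℝ≥0}
    (hB : ∀ y, ∫⁻ x, ‖f (x + y) - f x‖ₑ ≤ ENNReal.ofReal |y| * B) :
    ∫⁻ x, ‖gridFn ξ Δx (cellAverage ξ Δx f) x - f x‖ₑ ≤ ENNReal.ofReal (2 * B * Δx) := by
  have hpt : ∀ᵐ x, ‖gridFn ξ Δx (cellAverage ξ Δx f) x - f x‖ₑ ≤
      ENNReal.ofReal (1 / Δx) * ∫⁻ y in Ioo (-Δx) Δx, ‖f (x + y) - f x‖ₑ := by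
    filter_upwards [mem_cell_floor hΔx ξ] with x hx
    set j := ⌊(x - ξ) / Δx + 1 / 2⌋ with hj
    have hxj : x ∈ cell ξ Δx j := (hx j).2 rfl
    have hv : volume.real (cell ξ Δx j) = Δx := by
      rw [cell, Real.volume_real_Ioo_of_le (by nlinarith)]; ring
    have hfin : volume (cell ξ Δx j) ≠ ⊤ := by rw [cell]; exact measure_Ioo_lt_top.ne
    have e : gridFn ξ Δx (cellAverage ξ Δx f) x - f x =
        1 / Δx * ∫ y in cell ξ Δx j, (f y - f x) := by
      rw [integral_sub hf.integrableOn (integrableOn_const hfin), setIntegral_const, hv, gridFn, ← hj,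
        cellAverage, smul_eq_mul]
      field_simp
    rw [e, enorm_mul, Real.enorm_of_nonneg (by positivity)]
    refine mul_le_mul_right ((enorm_integral_le_lintegral_enorm _).trans ?_) _
    have e2 : Ioo (-Δx) Δx = (fun y => y + x) ⁻¹' Ioo (x - Δx) (x + Δx) := by
      ext y
      simp only [mem_Ioo, mem_preimage]
      constructor <;> rintro ⟨h1, h2⟩ <;> constructor <;> linarith
    rw [e2]
    simp only [add_comm x]
    rw [(measurePreserving_add_right volume x).setLIntegral_comp_preimage_emb
      (MeasurableEquiv.addRight x).measurableEmbedding (fun y => ‖f y - f x‖ₑ)]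
    refine lintegral_mono_set fun y hy => ?_
    rw [cell] at hy hxj
    constructor <;> nlinarith [hy.1, hy.2, hxj.1, hxj.2]
  have hmeas : AEMeasurable (fun p : ℝ × ℝ => ‖f (p.1 + p.2) - f p.1‖ₑ)
      (volume.prod (volume.restrict (Ioo (-Δx) Δx))) := by
    have h1 : AEStronglyMeasurable (fun p : ℝ × ℝ => f p.1) (volume.prod volume) :=
      hf.aestronglyMeasurable.comp_fst
    have h2 : AEStronglyMeasurable (fun p : ℝ × ℝ => f (p.1 + p.2)) (volume.prod volume) :=
      (hf.aestronglyMeasurable.comp_snd (μ := volume)).comp_measurePreserving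
        (measurePreserving_prod_add volume volume)
    have h3 : AEMeasurable (fun p : ℝ × ℝ => ‖f (p.1 + p.2) - f p.1‖ₑ) (volume.prod volume) :=
      (h2.sub h1).enorm
    refine h3.mono_measure ?_
    exact Measure.prod_mono le_rfl Measure.restrict_le_self
  refine (lintegral_mono_ae hpt).trans ?_
  rw [lintegral_const_mul' _ _ ENNReal.ofReal_ne_top, lintegral_lintegral_swap hmeas]
  calc ENNReal.ofReal (1 / Δx) * ∫⁻ y in Ioo (-Δx) Δx, ∫⁻ x, ‖f (x + y) - f x‖ₑ
      ≤ ENNReal.ofReal (1 / Δx) * ∫⁻ y in Ioo (-Δx) Δx, ENNReal.ofReal Δx * B := by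
        refine mul_le_mul_right (setLIntegral_mono measurable_const fun y hy => (hB y).trans ?_) _
        exact mul_le_mul_left (ENNReal.ofReal_le_ofReal (abs_le.2 ⟨hy.1.le, hy.2.le⟩)) _
    _ = ENNReal.ofReal (2 * B * Δx) := by
        rw [setLIntegral_const, Real.volume_Ioo, ← ENNReal.ofReal_coe_nnreal,
          ← ENNReal.ofReal_mul hΔx.le, ← ENNReal.ofReal_mul (by positivity),
          ← ENNReal.ofReal_mul (by positivity)]
        congr 1
        field_simp
        ring

theorem integrable_gridFn_cellAverage {ξ Δx : ℝ} (hΔx : 0 < Δx) {f : ℝ → ℝ} (hf : Integrable f)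
    {B : ℝ≥0} (hB : ∀ y, ∫⁻ x, ‖f (x + y) - f x‖ₑ ≤ ENNReal.ofReal |y| * B) :
    Integrable (gridFn ξ Δx (cellAverage ξ Δx f)) := by
  have h : Integrable fun x => gridFn ξ Δx (cellAverage ξ Δx f) x - f x :=
    ⟨(measurable_gridFn _ _ _).aestronglyMeasurable.sub hf.aestronglyMeasurable,
      (lintegral_gridFn_sub_le hΔx hf hB).trans_lt ENNReal.ofReal_lt_top⟩
  exact (h.add hf).congr (Eventually.of_forall fun x => by simp)

end

end RelaxationAP

namespace RelaxationAP

noncomputable section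

/-! ### Supremum bounds for the scheme -/

/-- The grid values lie below (`e = 1`) or above (`e = -1`), in characteristic variables, the
constant state `(w, k)`. -/
def Barrier (c e w k : ℝ) (s : (ℤ → ℝ) × (ℤ → ℝ)) : Prop :=
  ∀ j, |k - s.2 j| ≤ e * (c * (w - s.1 j))

/-- A barrier is a pair of one-sided bounds on the characteristic variables. By the CFL condition
each new characteristic value is a convex combination, with weights `1 - l` and `l`, of an old one
and its upwind neighbour, and constant states are preserved. -/
theorem Barrier.transportStep {a e w k Δt Δx : ℝ} (ha : 0 < a) (he : e = 1 ∨ e = -1) (hcfl : CFL a Δt Δx)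
    {s : (ℤ → ℝ) × (ℤ → ℝ)} (hs : Barrier √a e w k s) :
    Barrier √a e w k (transportStep a Δt Δx s) := by
  have hc : 0 < √a := Real.sqrt_pos.2 ha
  obtain ⟨hΔt, hΔx, hl⟩ := hcfl
  intro j
  have haa : a = √a * √a := (Real.mul_self_sqrt ha.le).symm
  set c := √a
  set l := c * Δt / Δx with hldef
  have hl0 : 0 ≤ l := by positivity
  have e1 : (RelaxationAP.transportStep a Δt Δx s).1 j = s.1 j - l / (2 * c) *
      ((s.2 (j + 1) - s.2 (j - 1)) - c * (s.1 (j + 1) - 2 * s.1 j + s.1 (j - 1))) := by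
    have : Δt * (1 / (2 * Δx)) = l / (2 * c) := by rw [hldef]; field_simp
    simp only [RelaxationAP.transportStep, discreteDv, ← mul_assoc, this]
    rfl
  have e2 : (RelaxationAP.transportStep a Δt Δx s).2 j = s.2 j - l / 2 *
      (c * (s.1 (j + 1) - s.1 (j - 1)) - (s.2 (j + 1) - 2 * s.2 j + s.2 (j - 1))) := by
    simp only [RelaxationAP.transportStep, discreteADu]
    change s.2 j - Δt * (1 / (2 * Δx) * (a * (s.1 (j + 1) - s.1 (j - 1)) -
      c * (s.2 (j + 1) - 2 * s.2 j + s.2 (j - 1)))) = _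
    rw [haa, hldef]
    field_simp
  have e1' : c * (RelaxationAP.transportStep a Δt Δx s).1 j = c * s.1 j - l / 2 *
      ((s.2 (j + 1) - s.2 (j - 1)) - c * (s.1 (j + 1) - 2 * s.1 j + s.1 (j - 1))) := by
    rw [e1]; field_simp
  have h0 := abs_le.1 (hs j)
  have hm := abs_le.1 (hs (j - 1))
  have hp := abs_le.1 (hs (j + 1))
  have q1 := mul_nonneg (sub_nonneg.2 hl.le) (sub_nonneg.2 h0.1)
  have q2 := mul_nonneg (sub_nonneg.2 hl.le) (sub_nonneg.2 h0.2)
  have q3 := mul_nonneg hl0 (sub_nonneg.2 hm.1)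
  have q4 := mul_nonneg hl0 (sub_nonneg.2 hm.2)
  have q5 := mul_nonneg hl0 (sub_nonneg.2 hp.1)
  have q6 := mul_nonneg hl0 (sub_nonneg.2 hp.2)
  rw [mul_sub c, e1', e2]
  rcases he with rfl | rfl <;> rw [abs_le] <;> constructor <;> linarith

/-- The constant state is relaxed too, `w` being kept and `k` drawn towards `α w`. On a barrier `|k
- v| ≤ c |w - u|`, so the maximum in the contraction estimate is `c |w - u|`, which relaxation does
not change. -/
theorem Barrier.relaxationStep {r : ℝ → ℝ → ℝ} {α : ℝ → ℝ} {c b H e w k ε Δt : ℝ}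
    (hr : IsGlobalTerm r α c b H) (hε : 0 < ε) (hΔt : 0 < Δt) (he : e = 1 ∨ e = -1)
    {s : (ℤ → ℝ) × (ℤ → ℝ)} (hs : Barrier c e w k s) (hk : |k - α w| ≤ |α w|) :
    ∃ k', |k' - α w| ≤ |α w| ∧ Barrier c e w k' (relaxationStep r α H ε Δt s) := by
  have hc := hr.c_pos
  have hτ : 0 ≤ Δt / ε := by positivity
  have hκ := expKappa_nonneg H (Δt / ε)
  have hσ := expSigma_nonneg (H := H) hτ
  have hsum : expKappa H (Δt / ε) + expSigma H (Δt / ε) * H ≤ 1 := by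
    rw [expKappa_add_expSigma]; linarith [Real.exp_pos (-(H * (Δt / ε)))]
  refine ⟨k - decrement r α (expKappa H (Δt / ε)) (expSigma H (Δt / ε)) w k, ?_, fun j => ?_⟩
  · obtain ⟨q, hq1, hq2, hq3⟩ := hr.eq_slope w k
    have hq : 0 < q := hr.b_pos.trans_le hq1
    have e1 : k - decrement r α (expKappa H (Δt / ε)) (expSigma H (Δt / ε)) w k - α w =
        (1 - expKappa H (Δt / ε) - expSigma H (Δt / ε) * q) * (k - α w) := by
      rw [decrement, hq3]; ring
    have h2 := mul_le_mul_of_nonneg_left hq2 hσ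
    have h3 := mul_nonneg hσ hq.le
    rw [e1, abs_mul, abs_of_nonneg (by linarith)]
    exact (mul_le_of_le_one_left (abs_nonneg _) (by linarith)).trans hk
  · have h1 := hr.sub_decrement_abs_le hκ hσ hsum w k (s.1 j) (s.2 j)
    have h2 := hs j
    have h3 : e * (c * (w - s.1 j)) = c * |w - s.1 j| := by
      have h4 : 0 ≤ e * (w - s.1 j) := by
        have h5 : 0 ≤ c * (e * (w - s.1 j)) := by
          have := (abs_nonneg _).trans h2
          linarith
        exact nonneg_of_mul_nonneg_right h5 hc
      have h6 : |w - s.1 j| = e * (w - s.1 j) := by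
        rw [← abs_of_nonneg h4, abs_mul]
        rcases he with rfl | rfl <;> simp
      rw [h6]; ring
    rw [h3] at h2
    rw [max_eq_left h2] at h1
    have e2 : (RelaxationAP.relaxationStep r α H ε Δt s).2 j =
        s.2 j - decrement r α (expKappa H (Δt / ε)) (expSigma H (Δt / ε)) (s.1 j) (s.2 j) := by
      simp only [RelaxationAP.relaxationStep, decrement, expKappa, expSigma, mul_div_assoc]
      ring
    rw [e2]
    exact h1.trans (le_of_eq h3.symm)

/-- The starting barrier has flux `k = 0`, and `hN` places it beyond the data in both characteristic
variables. Thereafter `k` depends on the step but stays within `|α w|` of `α w`. -/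
theorem exists_barrier_scheme {r : ℝ → ℝ → ℝ} {α : ℝ → ℝ} {a b H e w N ε ξ Δt Δx : ℝ} (ha : 0 < a)
    (hr : IsGlobalTerm r α √a b H) (hε : 0 < ε) (he : e = 1 ∨ e = -1) (hcfl : CFL a Δt Δx)
    (hN : N ≤ √a * (e * w - N)) {u₀ v₀ : ℝ → ℝ} (hu : ∀ᵐ x, |u₀ x| ≤ N) (hv : ∀ᵐ x, |v₀ x| ≤ N)
    (n : ℕ) : ∃ k, |k - α w| ≤ |α w| ∧ Barrier √a e w k (scheme r α a H ε ξ Δt Δx u₀ v₀ n) := by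
  induction n with
  | zero =>
    refine ⟨0, by simp, fun j => ?_⟩
    have h1 := abs_le.1 (cellAverage_bound (ξ := ξ) hcfl.2.1 hu j)
    have h2 := cellAverage_bound (ξ := ξ) hcfl.2.1 hv j
    have hc : 0 < √a := hr.c_pos
    change |0 - cellAverage ξ Δx v₀ j| ≤ e * (√a * (w - cellAverage ξ Δx u₀ j))
    rw [zero_sub, abs_neg]
    have h3 : e * w - N ≤ e * (w - cellAverage ξ Δx u₀ j) := by
      rcases he with rfl | rfl <;> linarith
    have h4 := mul_le_mul_of_nonneg_left h3 hc.le
    linarith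
  | succ n ih =>
    obtain ⟨k, hk, hB⟩ := ih
    exact (hB.transportStep ha he hcfl).relaxationStep hr hε hcfl.1 he hk

theorem Barrier.le {c w k : ℝ} (hc : 0 < c) {s : (ℤ → ℝ) × (ℤ → ℝ)} (hs : Barrier c 1 w k s) (j : ℤ) :
    s.1 j ≤ w := by
  have := (abs_nonneg _).trans (hs j)
  rw [one_mul] at this
  linarith [nonneg_of_mul_nonneg_right this hc]

theorem Barrier.ge {c w k : ℝ} (hc : 0 < c) {s : (ℤ → ℝ) × (ℤ → ℝ)} (hs : Barrier c (-1) w k s)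
    (j : ℤ) : w ≤ s.1 j := by
  have := (abs_nonneg _).trans (hs j)
  rw [neg_one_mul, neg_nonneg] at this
  nlinarith

/-- Invariant region of the scheme. -/
theorem scheme_bound {r : ℝ → ℝ → ℝ} {α : ℝ → ℝ} {a b H U N ε ξ Δt Δx : ℝ} (ha : 0 < a)
    (hr : IsGlobalTerm r α √a b H) (hε : 0 < ε) (hcfl : CFL a Δt Δx)
    (hN : N ≤ √a * (U - N)) {u₀ v₀ : ℝ → ℝ} (hu : ∀ᵐ x, |u₀ x| ≤ N) (hv : ∀ᵐ x, |v₀ x| ≤ N)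
    (n : ℕ) (j : ℤ) :
    |(scheme r α a H ε ξ Δt Δx u₀ v₀ n).1 j| ≤ U ∧
    |(transportStep a Δt Δx (scheme r α a H ε ξ Δt Δx u₀ v₀ n)).1 j| ≤ U ∧
    |(scheme r α a H ε ξ Δt Δx u₀ v₀ n).2 j| ≤ 2 * √a * U + 2 * |α U| := by
  have hc := hr.c_pos
  obtain ⟨k, hk, hB⟩ := exists_barrier_scheme (ξ := ξ) ha hr hε (.inl rfl) hcfl (w := U)
    (by rwa [one_mul]) hu hv n
  obtain ⟨k', -, hB'⟩ := exists_barrier_scheme (ξ := ξ) ha hr hε (.inr rfl) hcfl (w := -U)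
    (by rwa [neg_mul_neg, one_mul]) hu hv n
  have hlow := hB'.ge hc j
  refine ⟨abs_le.2 ⟨hlow, hB.le hc j⟩, abs_le.2 ⟨(hB'.transportStep ha (.inr rfl) hcfl).ge hc j,
    (hB.transportStep ha (.inl rfl) hcfl).le hc j⟩, ?_⟩
  -- The bound on `v` follows from the upper barrier: `|k| ≤ 2 |α U|` and `c (U - u) ≤ 2 c U`.
  have h1 := abs_le.1 (hB j)
  have h2 := abs_le.1 hk
  have h3 := abs_le.1 (le_refl |α U|)
  have h4 := mul_le_mul_of_nonneg_left hlow hc.le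
  rw [one_mul] at h1
  rw [abs_le]
  constructor <;> linarith

/-! ### Truncation of the source term -/

/-- Projection of `ℝ` on `[-V, V]`. -/
def clip (V u : ℝ) : ℝ := max (-V) (min V u)

theorem clip_mem {V : ℝ} (hV : 0 ≤ V) (u : ℝ) : clip V u ∈ Icc (-V) V :=
  ⟨le_max_left _ _, max_le (by linarith) (min_le_left _ _)⟩

theorem clip_eq {V u : ℝ} (hu : |u| ≤ V) : clip V u = u := by
  rw [clip, min_eq_right (abs_le.1 hu).2, max_eq_right (abs_le.1 hu).1]

theorem abs_clip_sub_le (V u u' : ℝ) : |clip V u - clip V u'| ≤ |u - u'| :=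
  (abs_max_sub_max_le_max _ _ _ _).trans (by
    rw [sub_self, abs_zero]
    refine max_le (abs_nonneg _) ((abs_min_sub_min_le_max _ _ _ _).trans ?_)
    rw [sub_self, abs_zero]
    exact max_le (abs_nonneg _) le_rfl)

namespace IsRelaxationTerm

variable {R : ℝ → ℝ → ℝ} {A g h β₀ : ℝ → ℝ} (hR : IsRelaxationTerm R A g h β₀)
include hR

theorem differentiable_fst (v : ℝ) : Differentiable ℝ fun s => R s v := by
  have h1 := hR.contDiff.differentiable one_ne_zero
  exact h1.comp (differentiable_id.prodMk (differentiable_const v))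

theorem differentiable_snd (u : ℝ) : Differentiable ℝ fun s => R u s := by
  have h1 := hR.contDiff.differentiable one_ne_zero
  exact h1.comp ((differentiable_const u).prodMk differentiable_id)

theorem abs_sub_fst_le {V : ℝ} (hV : 0 ≤ V) {u u' : ℝ} (hu : u ∈ Icc (-V) V)
    (hu' : u' ∈ Icc (-V) V) (v : ℝ) : |R u v - R u' v| ≤ g V * |u - u'| :=
  Convex.norm_image_sub_le_of_norm_deriv_le (f := fun s => R s v) (C := g V)
    (fun _ _ => (hR.differentiable_fst v).differentiableAt)
    (fun x hx => hR.deriv_u V hV x hx v) (convex_Icc _ _) hu' hu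

theorem sub_snd_bounds {V : ℝ} (hV : 0 ≤ V) {u : ℝ} (hu : u ∈ Icc (-V) V) {v v' : ℝ} (hv : v ≤ v') :
    β₀ V * (v' - v) ≤ R u v' - R u v ∧ R u v' - R u v ≤ h V * (v' - v) :=
  ⟨mul_sub_le_image_sub_of_le_deriv (hR.differentiable_snd u)
      (fun x => (hR.deriv_v V hV u hu x).1) hv,
    image_sub_le_mul_sub_of_deriv_le (hR.differentiable_snd u)
      (fun x => (hR.deriv_v V hV u hu x).2) hv⟩

theorem abs_sub_snd_le {V : ℝ} (hV : 0 ≤ V) {u : ℝ} (hu : u ∈ Icc (-V) V) (v v' : ℝ) :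
    |R u v - R u v'| ≤ h V * |v - v'| := by
  rcases le_total v v' with hv | hv
  · have := hR.sub_snd_bounds hV hu hv
    have h0 := mul_nonneg (hR.pos V hV).le (sub_nonneg.2 hv)
    rw [abs_sub_comm, abs_of_nonneg (by linarith), abs_sub_comm, abs_of_nonneg (by linarith)]
    exact this.2
  · have := hR.sub_snd_bounds hV hu hv
    have h0 := mul_nonneg (hR.pos V hV).le (sub_nonneg.2 hv)
    rw [abs_of_nonneg (by linarith), abs_of_nonneg (by linarith)]
    exact this.2

/-- Only `u` needs clipping, since the derivative bounds hold on a whole strip in `v`. As `clip` is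
1-Lipschitz, the constants at level `V` become global, and `hsub` is the subcharacteristic
condition. -/
theorem isGlobalTerm {V c : ℝ} (hV : 0 ≤ V) (hc : 0 < c) (hsub : g V / β₀ V ≤ c) :
    IsGlobalTerm (fun u v => R (clip V u) v) (fun u => A (clip V u)) c (β₀ V) (h V) where
  c_pos := hc
  b_pos := hR.pos V hV
  b_le := by
    have := hR.deriv_v V hV 0 ⟨by linarith, hV⟩ 0
    exact this.1.trans this.2
  lip_u u u' v := by
    have h1 := hR.abs_sub_fst_le hV (clip_mem hV u) (clip_mem hV u') v
    have h2 : 0 ≤ g V := (abs_nonneg _).trans (hR.deriv_u V hV 0 ⟨by linarith, hV⟩ 0)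
    rw [div_le_iff₀ (hR.pos V hV)] at hsub
    exact h1.trans (mul_le_mul hsub (abs_clip_sub_le V u u') (abs_nonneg _) (h2.trans hsub))
  mono u v v' hv := hR.sub_snd_bounds hV (clip_mem hV u) hv
  zero u := (hR.equilibrium _ _).2 rfl
  map_zero := by
    rw [clip_eq (by simpa using hV), hR.map_zero]

end IsRelaxationTerm

theorem relaxationStep_clip {R : ℝ → ℝ → ℝ} {A : ℝ → ℝ} {V β ε Δt : ℝ} {s : (ℤ → ℝ) × (ℤ → ℝ)}
    (hs : ∀ j, |s.1 j| ≤ V) :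
    relaxationStep (fun u v => R (clip V u) v) (fun u => A (clip V u)) β ε Δt s =
      relaxationStep R A β ε Δt s := by
  simp only [relaxationStep, clip_eq (hs _)]

/-- The supremum bound is known for the clipped scheme. It covers the intermediate values of `u` fed
into the relaxation step, so clipping never acts and the two schemes agree inductively. -/
theorem scheme_clip {R : ℝ → ℝ → ℝ} {A : ℝ → ℝ} {a b H U V N ε ξ Δt Δx : ℝ} (ha : 0 < a)
    (hr : IsGlobalTerm (fun u v => R (clip V u) v) (fun u => A (clip V u)) √a b H) (hε : 0 < ε)
    (hcfl : CFL a Δt Δx) (hUV : U ≤ V) (hN : N ≤ √a * (U - N)) {u₀ v₀ : ℝ → ℝ}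
    (hu : ∀ᵐ x, |u₀ x| ≤ N) (hv : ∀ᵐ x, |v₀ x| ≤ N) (n : ℕ) :
    scheme R A a H ε ξ Δt Δx u₀ v₀ n =
      scheme (fun u v => R (clip V u) v) (fun u => A (clip V u)) a H ε ξ Δt Δx u₀ v₀ n := by
  induction n with
  | zero => rfl
  | succ n ih =>
    rw [scheme, scheme, ih]
    exact (relaxationStep_clip fun j =>
      ((scheme_bound ha hr hε hcfl hN hu hv n j).2.1).trans hUV).symm

end

end RelaxationAP

namespace RelaxationAP

noncomputable section

/-! ### States built from initial data -/

theorem norm_sub_le_integral_uv {c : ℝ} (hc : 0 < c) {F G : State} {u v u' v' : ℝ → ℝ}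
    (hF : ∀ᵐ x, uOf F x = u x ∧ vOf c F x = v x) (hG : ∀ᵐ x, uOf G x = u' x ∧ vOf c G x = v' x) :
    ‖F - G‖ ≤ (∫ x, |u x - u' x|) + (∫ x, |v x - v' x|) / c := by
  refine (norm_le_integral_uv hc (F - G)).trans (le_of_eq ?_)
  congr 1
  · refine integral_congr_ae ?_
    filter_upwards [uOf_sub c F G, hF, hG] with x h1 h2 h3
    simp only [h1.1, h2.1, h3.1]
  · congr 1
    refine integral_congr_ae ?_
    filter_upwards [uOf_sub c F G, hF, hG] with x h1 h2 h3
    simp only [h1.2, h2.2, h3.2]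

section Data

variable {c N : ℝ} {B : ℝ≥0} {u₀ v₀ : ℝ → ℝ} (hc : 0 < c) (hu : IsDatum N B u₀) (hv : IsDatum N B v₀)
include hc

theorem transLip_ofUV : TransLip (pairShift 1 1) ((1 + 1 / c) * B) (ofUV c hu.integrable hv.integrable) := by
  intro y
  have h0 := ofUV_coe hc.ne' hu.integrable hv.integrable
  have h1 : ∀ᵐ x, uOf (pairShift 1 1 y (ofUV c hu.integrable hv.integrable)) x = u₀ (x - y) ∧
      vOf c (pairShift 1 1 y (ofUV c hu.integrable hv.integrable)) x = v₀ (x - y) := by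
    filter_upwards [uOf_pairShift y (ofUV c hu.integrable hv.integrable), ae_comp_sub y h0]
      with x h1 h2
    exact ⟨h1.1.trans h2.1, (h1.2 c).trans h2.2⟩
  have key : ∀ w : ℝ → ℝ, IsDatum N B w → ∫ x, |w (x - y) - w x| ≤ |y| * B := by
    intro w hw
    refine integral_abs_le_of_lintegral ((hw.integrable.comp_sub_right y).sub hw.integrable)
      (by positivity) ?_
    have := hw.lintegral_translate_sub_le (-y)
    rw [abs_neg, ← ENNReal.ofReal_coe_nnreal, ← ENNReal.ofReal_mul (abs_nonneg _)] at this
    simp only [← sub_eq_add_neg] at this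
    exact this
  refine (norm_sub_le_integral_uv hc h1 h0).trans ?_
  have h2 := key u₀ hu
  have h3 := div_le_div_of_nonneg_right (key v₀ hv) hc.le
  refine (add_le_add h2 h3).trans (le_of_eq ?_)
  field_simp

theorem exists_represents {ξ Δx : ℝ} (hΔx : 0 < Δx) :
    ∃ F₀ : State, Represents c ξ Δx F₀ (cellAverage ξ Δx u₀, cellAverage ξ Δx v₀) ∧
      ‖F₀ - ofUV c hu.integrable hv.integrable‖ ≤ 2 * ((1 + 1 / c) * B) * Δx := by
  have hi : ∀ w : ℝ → ℝ, IsDatum N B w → Integrable (gridFn ξ Δx (cellAverage ξ Δx w)) := fun w hw =>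
    integrable_gridFn_cellAverage hΔx hw.integrable hw.lintegral_translate_sub_le
  have hrep := ofUV_coe hc.ne' (hi u₀ hu) (hi v₀ hv)
  refine ⟨ofUV c (hi u₀ hu) (hi v₀ hv), hrep, ?_⟩
  have key : ∀ w : ℝ → ℝ, IsDatum N B w →
      ∫ x, |gridFn ξ Δx (cellAverage ξ Δx w) x - w x| ≤ 2 * B * Δx := fun w hw =>
    integral_abs_le_of_lintegral ((hi w hw).sub hw.integrable) (by positivity)
      (lintegral_gridFn_sub_le hΔx hw.integrable hw.lintegral_translate_sub_le)
  refine (norm_sub_le_integral_uv hc hrep (ofUV_coe hc.ne' hu.integrable hv.integrable)).trans ?_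
  have h2 := key u₀ hu
  have h3 := div_le_div_of_nonneg_right (key v₀ hv) hc.le
  refine (add_le_add h2 h3).trans (le_of_eq ?_)
  field_simp

theorem defect_ofUV (α : ℝ → ℝ) :
    defect c α (ofUV c hu.integrable hv.integrable) = ∫ x, |v₀ x - α (u₀ x)| := by
  refine integral_congr_ae ?_
  filter_upwards [ofUV_coe hc.ne' hu.integrable hv.integrable] with x h
  simp only [h.1, h.2]

end Data

/-! ### Supremum bounds for the exact solution -/

/-- Convergence in `L¹` gives almost everywhere convergence along a subsequence, which preserves
pointwise bounds. -/
theorem ae_abs_le_of_tendsto {F : ℕ → LOne} {f : LOne} {U : ℝ} (h : Tendsto F atTop (𝓝 f))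
    (hF : ∀ n, ∀ᵐ x, |F n x| ≤ U) : ∀ᵐ x, |f x| ≤ U := by
  obtain ⟨ns, -, hns⟩ := (tendstoInMeasure_of_tendsto_Lp h).exists_seq_tendsto_ae
  filter_upwards [hns, ae_all_iff.2 hF] with x h1 h2
  exact le_of_tendsto h1.abs (Eventually.of_forall fun n => h2 _)

theorem ae_bounds_of_tendsto {c : ℝ} {F : ℕ → State} {f : State} {U K : ℝ}
    (h : Tendsto F atTop (𝓝 f))
    (hF : ∀ n, ∀ᵐ x, |uOf (F n) x| ≤ U ∧ |vOf c (F n) x| ≤ K) :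
    ∀ᵐ x, |uOf f x| ≤ U ∧ |vOf c f x| ≤ K := by
  have h1 : Tendsto (fun n => (F n).fst) atTop (𝓝 f.fst) :=
    ((WithLp.fstL 1 ℝ LOne LOne).continuous.tendsto f).comp h
  have h2 : Tendsto (fun n => (F n).snd) atTop (𝓝 f.snd) :=
    ((WithLp.sndL 1 ℝ LOne LOne).continuous.tendsto f).comp h
  have cu : ∀ F : State, (F.fst + F.snd : LOne) =ᵐ[volume] uOf F := fun F => Lp.coeFn_add _ _
  have cv : ∀ F : State, (c • (F.fst - F.snd) : LOne) =ᵐ[volume] vOf c F := fun F => by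
    filter_upwards [Lp.coeFn_smul c (F.fst - F.snd), Lp.coeFn_sub F.fst F.snd] with x e1 e2
    rw [e1, Pi.smul_apply, e2, Pi.sub_apply, smul_eq_mul, vOf]
  have b1 := ae_abs_le_of_tendsto (U := U) (h1.add h2) fun n => by
    filter_upwards [hF n, cu (F n)] with x e1 e2
    rw [e2]; exact e1.1
  have b2 := ae_abs_le_of_tendsto (U := K) ((h1.sub h2).const_smul c) fun n => by
    filter_upwards [hF n, cv (F n)] with x e1 e2
    rw [e2]; exact e1.2
  filter_upwards [b1, b2, cu f, cv f] with x e1 e2 e3 e4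
  rw [← e3, ← e4]
  exact ⟨e1, e2⟩

/-- The exact flow inherits the invariant region of the scheme, to which it is `L¹`-close by the
error estimate. -/
theorem flow_bounds {r : ℝ → ℝ → ℝ} {α : ℝ → ℝ} {a b H U N : ℝ} {B : ℝ≥0} (ha : 0 < a)
    (hr : IsGlobalTerm r α √a b H) (hN : N ≤ √a * (U - N)) {u₀ v₀ : ℝ → ℝ} (hu : IsDatum N B u₀)
    (hv : IsDatum N B v₀) {ε : ℝ} (hε : 0 < ε) {g : ℝ → State}
    (hg : IsMildCurve (pairShift √a (-√a)) (relaxSource hr hε) g)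
    (hg0 : g 0 = ofUV √a hu.integrable hv.integrable) {t : ℝ} (ht : 0 ≤ t) :
    ∀ᵐ x, |uOf (pairShift √a (-√a) t (g t)) x| ≤ U ∧
      |vOf √a (pairShift √a (-√a) t (g t)) x| ≤ 2 * √a * U + 2 * |α U| := by
  have hc := hr.c_pos
  -- The steps will be `Δt = 1 / (m + 1)` and `Δx = 2 √a Δt`, of Courant number `1/2`; since `Δt ≤
  -- 1`, the maximum bounds both `ε` and `Δx`.
  obtain ⟨C, hC0, hC⟩ := exists_schemeStep_error hr t (max ε (2 * √a)) ((1 + 1 / √a) * B)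
  set Δt : ℕ → ℝ := fun m => 1 / ((m : ℝ) + 1) with hΔt
  have hΔt0 : ∀ m, 0 < Δt m := fun m => Nat.one_div_pos_of_nat
  have hΔt1 : ∀ m, Δt m ≤ 1 := fun m => by
    rw [hΔt]; simp only; rw [div_le_one (by positivity)]; linarith [Nat.cast_nonneg (α := ℝ) m]
  set Δx : ℕ → ℝ := fun m => 2 * √a * Δt m with hΔx
  have hΔx0 : ∀ m, 0 < Δx m := fun m => by have := hΔt0 m; simp only [hΔx]; positivity
  have hcfl : ∀ m, √a * Δt m / Δx m < 1 := fun m => by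
    rw [div_lt_one (hΔx0 m)]; simp only [hΔx]; nlinarith [mul_pos hc (hΔt0 m)]
  choose F₀ hF₀ hF₀' using fun m => exists_represents hc hu hv (ξ := 0) (hΔx0 m)
  set n : ℕ → ℕ := fun m => ⌊t / Δt m⌋₊ with hn
  set F : ℕ → State := fun m =>
    (schemeStep hr (div_nonneg (hΔt0 m).le hε.le) (Δx m))^[n m] (F₀ m) with hF
  refine ae_bounds_of_tendsto (F := F) ?_ fun m => ?_
  · rw [tendsto_iff_norm_sub_tendsto_zero]
    refine squeeze_zero (g := fun m => C / ε * (Δt m * (defect √a α (g 0) / ε + 1) + √(Δx m)))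
      (fun _ => norm_nonneg _) (fun m => ?_) ?_
    · refine hC ε hε (le_max_left _ _) g hg (hg0 ▸ transLip_ofUV hc hu hv) (Δt m) (Δx m) (hΔt0 m)
        (hΔx0 m) (hcfl m) (le_max_of_le_right ?_) (F₀ m) (hg0 ▸ hF₀' m) (n m) t le_rfl ?_ ?_
      · simp only [hΔx]; nlinarith [hΔt1 m]
      · rw [← le_div_iff₀ (hΔt0 m)]; exact Nat.floor_le (div_nonneg ht (hΔt0 m).le)
      · rw [← div_le_iff₀ (hΔt0 m)]; exact (Nat.lt_floor_add_one _).le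
    · have h1 : Tendsto Δt atTop (𝓝 0) := tendsto_one_div_add_atTop_nhds_zero_nat
      have h2 : Tendsto (fun m => √(Δx m)) atTop (𝓝 0) := by
        have := (Real.continuous_sqrt.tendsto _).comp (h1.const_mul (2 * √a))
        rw [mul_zero, Real.sqrt_zero] at this
        exact this
      have := ((h1.mul_const (defect √a α (g 0) / ε + 1)).add h2).const_mul (C / ε)
      simpa using this
  · have h1 := (hF₀ m).iterate ha hr (div_nonneg (hΔt0 m).le hε.le) (hΔx0 m) (n m)
    filter_upwards [h1] with x hx
    rw [hx.1, hx.2]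
    have := scheme_bound (ξ := 0) ha hr hε ⟨hΔt0 m, hΔx0 m, hcfl m⟩ hN hu.bounded hv.bounded (n m)
      ⌊(x - 0) / Δx m + 1 / 2⌋
    exact ⟨this.1, this.2.2⟩

end

end RelaxationAP

namespace RelaxationAP

noncomputable section

/-! ### Jointly measurable representatives -/

/-- A Lipschitz curve in `L¹` has a jointly measurable representative, at every time. -/
theorem exists_measurable_representative {w : ℝ → LOne} {L : ℝ}
    (hL : ∀ s t, 0 ≤ s → 0 ≤ t → ‖w s - w t‖ ≤ L * |s - t|) :
    ∃ W : ℝ × ℝ → ℝ, Measurable W ∧ ∀ t, 0 ≤ t → ∀ᵐ x, W (t, x) = w t x := by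
  have hL0 : 0 ≤ L := by simpa using (norm_nonneg _).trans (hL 1 0 zero_le_one le_rfl)
  -- The curve is sampled at dyadic times. The errors `L / 2 ^ n` are summable, so at every fixed
  -- time the whole sequence converges almost everywhere in `x`; the `limsup` is measurable without
  -- knowing this.
  set Wn : ℕ → ℝ × ℝ → ℝ := fun n p => w ((⌊2 ^ n * p.1⌋₊ : ℝ) / 2 ^ n) p.2 with hWn
  have hmeas : ∀ n, Measurable (Wn n) := fun n => by
    have h1 : Measurable fun q : ℕ × ℝ => w ((q.1 : ℝ) / 2 ^ n) q.2 :=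
      measurable_from_prod_countable_right fun k =>
        (Lp.stronglyMeasurable (w ((k : ℝ) / 2 ^ n))).measurable
    have h2 : Measurable fun p : ℝ × ℝ => ((⌊2 ^ n * p.1⌋₊ : ℕ), p.2) :=
      (Nat.measurable_floor.comp (measurable_fst.const_mul _)).prodMk measurable_snd
    exact h1.comp h2
  refine ⟨fun p => limsup (fun n => Wn n p) atTop, Measurable.limsup hmeas, fun t ht => ?_⟩
  have hclose : ∀ n : ℕ, ∫⁻ x, ‖Wn n (t, x) - w t x‖ₑ ≤ ENNReal.ofReal (L * (1 / 2) ^ n) := by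
    intro n
    set s : ℝ := (⌊2 ^ n * t⌋₊ : ℝ) / 2 ^ n with hs
    have hs0 : 0 ≤ s := by positivity
    have hst : |s - t| ≤ (1 / 2) ^ n := by
      have h2 : (0 : ℝ) < 2 ^ n := by positivity
      have h3 := Nat.floor_le (mul_nonneg h2.le ht)
      have h4 := Nat.lt_floor_add_one (2 ^ n * t)
      have e : s - t = ((⌊2 ^ n * t⌋₊ : ℝ) - 2 ^ n * t) / 2 ^ n := by rw [hs]; field_simp
      rw [e, abs_div, abs_of_pos h2, one_div, inv_pow, inv_eq_one_div]
      refine div_le_div_of_nonneg_right ?_ h2.le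
      rw [abs_le]; constructor <;> linarith
    have e1 : ∫⁻ x, ‖Wn n (t, x) - w t x‖ₑ = ∫⁻ x, ‖(w s - w t : LOne) x‖ₑ := by
      refine lintegral_congr_ae ?_
      filter_upwards [Lp.coeFn_sub (w s) (w t)] with x hx
      rw [hx, Pi.sub_apply]
    rw [e1, ← eLpNorm_one_eq_lintegral_enorm, ← Lp.enorm_def, ← ofReal_norm]
    refine ENNReal.ofReal_le_ofReal ((hL s t hs0 ht).trans ?_)
    exact mul_le_mul_of_nonneg_left hst hL0
  have hsum : ∫⁻ x, ∑' n, ‖Wn n (t, x) - w t x‖ₑ ≠ ⊤ := by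
    rw [lintegral_tsum fun n => by
      exact (((hmeas n).comp measurable_prodMk_left).sub
        (Lp.stronglyMeasurable (w t)).measurable).enorm.aemeasurable]
    refine ne_top_of_le_ne_top ?_ (ENNReal.tsum_le_tsum hclose)
    rw [← ENNReal.ofReal_tsum_of_nonneg (fun n => by positivity)
      ((summable_geometric_two).mul_left L)]
    exact ENNReal.ofReal_ne_top
  have hae := ae_lt_top' (AEMeasurable.tsum fun n =>
    (((hmeas n).comp measurable_prodMk_left).sub
        (Lp.stronglyMeasurable (w t)).measurable).enorm.aemeasurable) hsum
  filter_upwards [hae] with x hx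
  have h1 := ENNReal.tendsto_atTop_zero_of_tsum_ne_top hx.ne
  have h2 : Tendsto (fun n => Wn n (t, x)) atTop (𝓝 (w t x)) := by
    rw [tendsto_iff_edist_tendsto_0]
    simp only [edist_eq_enorm_sub]
    exact h1
  exact h2.limsup_eq

/-! ### Pairing of `L¹` curves with test functions -/

/-- The duality pairing of `L¹` with bounded continuous functions. -/
theorem isBoundedBilinearMap_pairing :
    IsBoundedBilinearMap ℝ fun p : LOne × BoundedContinuousFunction ℝ ℝ => ∫ x, p.1 x * p.2 x := by
  have hi : ∀ (f : LOne) (b : BoundedContinuousFunction ℝ ℝ), Integrable fun x => f x * b x :=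
    fun f b => (L1.integrable_coeFn f).mul_bdd b.continuous.aestronglyMeasurable
      (Eventually.of_forall fun x => b.norm_coe_le_norm x)
  refine ⟨fun f f' b => ?_, fun r f b => ?_, fun f b b' => ?_, fun r f b => ?_, 1, one_pos,
    fun f b => ?_⟩
  · change ∫ x, (f + f' : LOne) x * b x = _
    rw [← integral_add (hi f b) (hi f' b)]
    refine integral_congr_ae ?_
    filter_upwards [Lp.coeFn_add f f'] with x hx
    rw [hx, Pi.add_apply]; ring
  · change ∫ x, (r • f : LOne) x * b x = _
    rw [smul_eq_mul, ← integral_const_mul]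
    refine integral_congr_ae ?_
    filter_upwards [Lp.coeFn_smul r f] with x hx
    rw [hx, Pi.smul_apply, smul_eq_mul]; ring
  · change ∫ x, f x * (b + b') x = _
    rw [← integral_add (hi f b) (hi f b')]
    refine integral_congr_ae (Eventually.of_forall fun x => ?_)
    simp only [BoundedContinuousFunction.coe_add, Pi.add_apply]; ring
  · change ∫ x, f x * (r • b) x = _
    rw [smul_eq_mul, ← integral_const_mul]
    refine integral_congr_ae (Eventually.of_forall fun x => ?_)
    simp only [BoundedContinuousFunction.coe_smul, smul_eq_mul]; ring
  · change ‖∫ x, f x * b x‖ ≤ _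
    refine (norm_integral_le_integral_norm _).trans ?_
    rw [one_mul, L1.norm_eq_integral_norm, ← integral_mul_const]
    refine integral_mono (hi f b).norm ((L1.integrable_coeFn f).norm.mul_const _) fun x => ?_
    simp only [norm_mul]
    exact mul_le_mul_of_nonneg_left (b.norm_coe_le_norm x) (norm_nonneg _)

/-- The function `y ↦ θ (t, y + κ t)`. -/
def charSlice (κ : ℝ) {θ : ℝ × ℝ → ℝ} (hθ : Continuous θ) (hs : HasCompactSupport θ) (t : ℝ) :
    BoundedContinuousFunction ℝ ℝ :=
  BoundedContinuousFunction.ofNormedAddCommGroup (fun y => θ (t, y + κ * t))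
    (hθ.comp (by fun_prop)) (hs.exists_bound_of_continuous hθ).choose
    fun _ => (hs.exists_bound_of_continuous hθ).choose_spec _

/-- Derivative of a test function along the characteristic direction `(1, κ)`. -/
def charDeriv (κ : ℝ) (φ : ℝ × ℝ → ℝ) (p : ℝ × ℝ) : ℝ :=
  fderiv ℝ φ p (1, 0) + κ * fderiv ℝ φ p (0, 1)

theorem charDeriv_eq (κ : ℝ) (φ : ℝ × ℝ → ℝ) : charDeriv κ φ = fun p => fderiv ℝ φ p (1, κ) := by
  funext p
  have : ((1 : ℝ), κ) = (1, 0) + κ • ((0 : ℝ), (1 : ℝ)) := by simp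
  rw [this, map_add, map_smul, charDeriv, smul_eq_mul]

theorem hasCompactSupport_charDeriv {κ : ℝ} {φ : ℝ × ℝ → ℝ} (hs : HasCompactSupport φ) :
    HasCompactSupport (charDeriv κ φ) := by
  rw [charDeriv_eq]
  exact hs.fderiv_apply (𝕜 := ℝ) _

section TestFunction

variable {κ : ℝ} {φ : ℝ × ℝ → ℝ} (hφ : ContDiff ℝ ∞ φ) (hs : HasCompactSupport φ)
include hφ

theorem contDiff_charDeriv : ContDiff ℝ ∞ (charDeriv κ φ) := by
  rw [charDeriv_eq]
  exact (hφ.fderiv_right (m := ∞) (by simp)).clm_apply contDiff_const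

theorem hasDerivAt_comp_char (y t : ℝ) :
    HasDerivAt (fun t => φ (t, y + κ * t)) (charDeriv κ φ (t, y + κ * t)) t := by
  rw [charDeriv_eq]
  have h1 : HasFDerivAt φ (fderiv ℝ φ (t, y + κ * t)) (t, y + κ * t) :=
    (hφ.differentiable (by simp) _).hasFDerivAt
  have h2 : HasDerivAt (fun t : ℝ => (t, y + κ * t)) (1, κ) t := by
    refine (hasDerivAt_id t).prodMk ?_
    simpa using ((hasDerivAt_id t).const_mul κ).const_add y
  exact h1.comp_hasDerivAt t h2

/-- In the moving frame the slices of a test function form a differentiable curve in the supremum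
norm: the characteristic derivative is Lipschitz, so the remainder is quadratic in time, uniformly
in `y`. -/
theorem hasDerivAt_charSlice (t : ℝ) :
    HasDerivAt (charSlice κ hφ.continuous hs)
      (charSlice κ (contDiff_charDeriv (κ := κ) hφ).continuous
        (hasCompactSupport_charDeriv (κ := κ) hs) t) t := by
  obtain ⟨C, hC⟩ := ((contDiff_charDeriv (κ := κ) hφ).of_le (by simp : (1 : WithTop ℕ∞) ≤ ((⊤ : ℕ∞) : WithTop ℕ∞))
    ).lipschitzWith_of_hasCompactSupport (hasCompactSupport_charDeriv hs) one_ne_zero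
  set C' : ℝ := C * (1 + |κ|) with hC'
  have hC'0 : 0 ≤ C' := by positivity
  have hbound : ∀ z, ‖charSlice κ hφ.continuous hs z - charSlice κ hφ.continuous hs t - (z - t) •
      charSlice κ (contDiff_charDeriv (κ := κ) hφ).continuous
        (hasCompactSupport_charDeriv (κ := κ) hs) t‖ ≤
      C' * |z - t| * |z - t| := by
    intro z
    rw [BoundedContinuousFunction.norm_le (by positivity)]
    intro y
    have key := (convex_uIcc t z).norm_image_sub_le_of_norm_hasDerivWithin_le
      (f := fun s => φ (s, y + κ * s) - s * charDeriv κ φ (t, y + κ * t))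
      (f' := fun s => charDeriv κ φ (s, y + κ * s) - charDeriv κ φ (t, y + κ * t))
      (C := C' * |z - t|) (x := t) (y := z)
      (fun s _ => by
        have := (hasDerivAt_comp_char (κ := κ) hφ y s).sub
          ((hasDerivAt_id s).mul_const (charDeriv κ φ (t, y + κ * t)))
        rw [one_mul] at this
        exact this.hasDerivWithinAt)
      (fun s hs => by
        have h1 := hC.dist_le_mul (s, y + κ * s) (t, y + κ * t)
        rw [Real.dist_eq] at h1
        refine h1.trans ?_
        rw [hC', mul_assoc]
        refine mul_le_mul_of_nonneg_left ?_ C.coe_nonneg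
        have h2 : |s - t| ≤ |z - t| := abs_sub_left_of_mem_uIcc hs
        rw [Prod.dist_eq, Real.dist_eq, Real.dist_eq]
        have h3 : y + κ * s - (y + κ * t) = κ * (s - t) := by ring
        rw [h3, abs_mul]
        have h4 := mul_le_mul_of_nonneg_left h2 (abs_nonneg κ)
        have h5 := abs_nonneg (z - t)
        have h6 := mul_nonneg (abs_nonneg κ) h5
        refine max_le ?_ ?_ <;> nlinarith)
      left_mem_uIcc right_mem_uIcc
    refine le_trans (le_of_eq ?_) key
    congr 1
    change φ (z, y + κ * z) - φ (t, y + κ * t) - (z - t) * charDeriv κ φ (t, y + κ * t) = _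
    ring
  rw [hasDerivAt_iff_isLittleO, Asymptotics.isLittleO_iff]
  intro η hη
  have hball : ∀ᶠ z in 𝓝 t, |z - t| < η / (C' + 1) := by
    have := Metric.ball_mem_nhds t (by positivity : 0 < η / (C' + 1))
    filter_upwards [this] with z hz
    rwa [Metric.mem_ball, Real.dist_eq] at hz
  filter_upwards [hball] with z hz
  refine (hbound z).trans ?_
  rw [Real.norm_eq_abs]
  refine mul_le_mul_of_nonneg_right ?_ (abs_nonneg _)
  rw [lt_div_iff₀ (by positivity)] at hz
  nlinarith [abs_nonneg (z - t)]

end TestFunction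

end

end RelaxationAP

namespace RelaxationAP

noncomputable section

/-! ### Mild solutions are weak solutions -/

theorem integral_pairing_charSlice {κ : ℝ} {θ : ℝ × ℝ → ℝ} (hθ : Continuous θ)
    (hs : HasCompactSupport θ) {t : ℝ} {p : LOne} {w : ℝ → ℝ}
    (hw : ∀ᵐ x, w x = shift (κ * t) p x) :
    ∫ y, p y * charSlice κ hθ hs t y = ∫ x, w x * θ (t, x) := by
  rw [← integral_sub_right_eq_self _ (κ * t)]
  refine integral_congr_ae ?_
  filter_upwards [hw, shift_coe (κ * t) p] with x h1 h2
  rw [h1, h2]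
  change _ * θ (t, x - κ * t + κ * t) = _
  rw [sub_add_cancel]

theorem integrable_mul_test {θ F : ℝ × ℝ → ℝ} (hθ : Continuous θ) (hs : HasCompactSupport θ)
    (hF : Measurable F) {K : ℝ} (hK : ∀ p, |F p| ≤ K) : Integrable fun p => F p * θ p :=
  (hθ.integrable_of_hasCompactSupport hs).bdd_mul hF.aestronglyMeasurable
    (Eventually.of_forall hK)

theorem exists_time_bound {θ : ℝ × ℝ → ℝ} (hs : HasCompactSupport θ) :
    ∃ b : ℝ, 0 < b ∧ ∀ t x, b ≤ t → θ (t, x) = 0 := by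
  obtain ⟨b, hb, hsub⟩ := hs.isBounded.subset_closedBall_lt 0 0
  refine ⟨b + 1, by linarith, fun t x ht => ?_⟩
  by_contra h
  have h1 := hsub (subset_tsupport θ h)
  rw [Metric.mem_closedBall, dist_zero_right] at h1
  have h2 : ‖t‖ ≤ b := (norm_fst_le (t, x)).trans h1
  rw [Real.norm_eq_abs] at h2
  linarith [le_abs_self t]

/-- A curve satisfying a transport equation in mild form satisfies it weakly. -/
theorem weak_transport_of_mild {κ K : ℝ} {p q : ℝ → LOne}
    (hp : ∀ t, 0 ≤ t → HasDerivAt p (shift (-(κ * t)) (q t)) t)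
    (hq : ContinuousOn (fun t => shift (-(κ * t)) (q t)) (Ici 0))
    {F Q : ℝ × ℝ → ℝ} (hF : Measurable F) (hQ : Measurable Q) (hFK : ∀ z, |F z| ≤ K)
    (hQK : ∀ z, |Q z| ≤ K) (hFp : ∀ t, 0 ≤ t → ∀ᵐ x, F (t, x) = shift (κ * t) (p t) x)
    (hQq : ∀ t, 0 ≤ t → ∀ᵐ x, Q (t, x) = q t x) {φ : ℝ × ℝ → ℝ} (hφ : ContDiff ℝ ∞ φ)
    (hs : HasCompactSupport φ) :
    (∫ z in Ioi (0 : ℝ) ×ˢ (univ : Set ℝ), (F z * charDeriv κ φ z + Q z * φ z))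
      + ∫ x, p 0 x * φ (0, x) = 0 := by
  have hψ : ContDiff ℝ ∞ (charDeriv κ φ) := contDiff_charDeriv hφ
  have hsψ : HasCompactSupport (charDeriv κ φ) := hasCompactSupport_charDeriv hs
  set S := charSlice κ hφ.continuous hs
  set S' := charSlice κ hψ.continuous hsψ
  have hS : Continuous S := continuous_iff_continuousAt.2 fun t =>
    (hasDerivAt_charSlice hφ hs t).continuousAt
  have hS' : Continuous S' := continuous_iff_continuousAt.2 fun t =>
    (hasDerivAt_charSlice hψ hsψ t).continuousAt
  have hpc : ContinuousOn p (Ici 0) := fun t ht => (hp t ht).continuousAt.continuousWithinAt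
  set p' := fun t => shift (-(κ * t)) (q t) with hp'
  set D : ℝ → ℝ := fun t => (∫ y, p t y * S' t y) + ∫ y, p' t y * S t y with hD
  have hcont : Continuous fun z : LOne × BoundedContinuousFunction ℝ ℝ => ∫ x, z.1 x * z.2 x :=
    isBoundedBilinearMap_pairing.continuous
  have hDc : ContinuousOn D (Ici 0) :=
    (hcont.comp_continuousOn (hpc.prodMk hS'.continuousOn)).add
      (hcont.comp_continuousOn (hq.prodMk hS.continuousOn))
  -- In the moving frame the weak formulation is the product rule for the pairing, integrated from
  -- `0` to a time `β` beyond the support.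
  have hderiv : ∀ t, 0 ≤ t → HasDerivAt (fun t => ∫ y, p t y * S t y) (D t) t := by
    intro t ht
    have := (isBoundedBilinearMap_pairing.hasFDerivAt (p t, S t)).comp_hasDerivAt t
      ((hp t ht).prodMk (hasDerivAt_charSlice hφ hs t))
    exact this
  obtain ⟨b, hb, hzero⟩ := exists_time_bound hs
  obtain ⟨b', hb', hzero'⟩ := exists_time_bound hsψ
  set β := max b b' with hβ
  have hβ0 : 0 < β := lt_max_of_lt_left hb
  have hFTC : ∫ t in (0 : ℝ)..β, D t = (∫ y, p β y * S β y) - ∫ y, p 0 y * S 0 y := by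
    refine intervalIntegral.integral_eq_sub_of_hasDerivAt
      (f := fun t => ∫ y, p t y * S t y) (fun t ht => ?_) ?_
    · rw [uIcc_of_le hβ0.le] at ht
      exact hderiv t ht.1
    · refine (hDc.mono ?_).intervalIntegrable
      rw [uIcc_of_le hβ0.le]
      exact Icc_subset_Ici_self
  have hDeq : ∀ t, 0 ≤ t → D t = ∫ x, (F (t, x) * charDeriv κ φ (t, x) + Q (t, x) * φ (t, x)) := by
    intro t ht
    have h1 : ∀ᵐ x, Q (t, x) = shift (κ * t) (p' t) x := by
      rw [hp']
      simp only [isIsometryGroup_shift.apply_neg]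
      exact hQq t ht
    have hi : ∀ {G θ : ℝ × ℝ → ℝ}, Measurable G → (∀ z, |G z| ≤ K) → Continuous θ →
        HasCompactSupport θ → Integrable fun x => G (t, x) * θ (t, x) := by
      intro G θ hG hGK hθ hsθ
      have hc : HasCompactSupport fun x : ℝ => θ (t, x) :=
        by
        refine HasCompactSupport.of_support_subset_isCompact (hsθ.isCompact.image continuous_snd)
          fun x hx => ⟨(t, x), subset_tsupport θ hx, rfl⟩
      exact ((by fun_prop : Continuous fun x : ℝ => θ (t, x)).integrable_of_hasCompactSupport hc
        ).bdd_mul (hG.comp measurable_prodMk_left).aestronglyMeasurable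
        (Eventually.of_forall fun x => hGK _)
    rw [hD, integral_add (hi hF hFK hψ.continuous hsψ) (hi hQ hQK hφ.continuous hs)]
    simp only
    rw [integral_pairing_charSlice hψ.continuous hsψ (hFp t ht),
      integral_pairing_charSlice hφ.continuous hs h1]
  have hint : Integrable fun z => F z * charDeriv κ φ z + Q z * φ z :=
    (integrable_mul_test hψ.continuous hsψ hF hFK).add (integrable_mul_test hφ.continuous hs hQ hQK)
  have hprod : ∫ z in Ioi (0 : ℝ) ×ˢ (univ : Set ℝ), (F z * charDeriv κ φ z + Q z * φ z) =
      ∫ t in (0 : ℝ)..β, D t := by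
    rw [Measure.volume_eq_prod, setIntegral_prod _ hint.integrableOn,
      intervalIntegral.integral_of_le hβ0.le]
    simp only [Measure.restrict_univ]
    rw [← setIntegral_congr_fun measurableSet_Ioi fun t ht => hDeq t (le_of_lt ht)]
    refine setIntegral_eq_of_subset_of_forall_sdiff_eq_zero measurableSet_Ioi Ioc_subset_Ioi_self
      fun t ht => ?_
    have ht' : β < t := not_le.1 fun h => ht.2 ⟨ht.1, h⟩
    rw [hDeq t (le_of_lt ht.1)]
    refine integral_eq_zero_of_ae (Eventually.of_forall fun x => ?_)
    simp only [Pi.zero_apply]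
    rw [hzero t x ((le_max_left _ _).trans ht'.le), hzero' t x ((le_max_right _ _).trans ht'.le)]
    simp
  rw [hprod, hFTC]
  have e1 : ∫ y, p β y * S β y = 0 := by
    refine integral_eq_zero_of_ae (Eventually.of_forall fun x => ?_)
    change p β x * φ (β, x + κ * β) = (0 : ℝ)
    rw [hzero β _ (le_max_left _ _), mul_zero]
  have e2 : ∫ y, p 0 y * S 0 y = ∫ x, p 0 x * φ (0, x) := by
    refine integral_congr_ae (Eventually.of_forall fun x => ?_)
    change p 0 x * φ (0, x + κ * 0) = _
    rw [mul_zero, add_zero]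
  rw [e1, e2]; ring

end

end RelaxationAP

namespace RelaxationAP

noncomputable section

theorem measurable_clip (V : ℝ) : Measurable (clip V) := by
  unfold clip; fun_prop

theorem abs_clip_le {V : ℝ} (hV : 0 ≤ V) (u : ℝ) : |clip V u| ≤ V := abs_le.2 (clip_mem hV u)

theorem isBoundedCurve_of_lipschitz {W : ℝ × ℝ → ℝ} (hW : Measurable W) {K : ℝ}
    (hK : ∀ p, |W p| ≤ K) {w : ℝ → LOne} {L : ℝ}
    (hL : ∀ s t, 0 ≤ s → 0 ≤ t → ‖w s - w t‖ ≤ L * |s - t|)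
    (hw : ∀ t, 0 ≤ t → ∀ᵐ x, W (t, x) = w t x) : IsBoundedCurve fun t x => W (t, x) where
  aestronglyMeasurable := hW.aestronglyMeasurable
  aestronglyMeasurable_slice t _ := (hW.comp measurable_prodMk_left).aestronglyMeasurable
  bounded _ := ⟨K, fun _ _ => Eventually.of_forall fun _ => hK _⟩
  continuous t ht R := by
    have hlim : Tendsto (fun s => ENNReal.ofReal (L * |s - t|)) (𝓝[Ici 0] t) (𝓝 0) := by
      have h1 : Continuous fun s => ENNReal.ofReal (L * |s - t|) :=
        ENNReal.continuous_ofReal.comp (by fun_prop)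
      have := h1.tendsto t
      simp only [sub_self, abs_zero, mul_zero, ENNReal.ofReal_zero] at this
      exact this.mono_left nhdsWithin_le_nhds
    refine tendsto_of_tendsto_of_tendsto_of_le_of_le' tendsto_const_nhds hlim
      (Eventually.of_forall fun _ => zero_le) ?_
    filter_upwards [self_mem_nhdsWithin] with s hs
    calc ∫⁻ x in Icc (-R) R, ‖W (s, x) - W (t, x)‖ₑ ≤ ∫⁻ x, ‖W (s, x) - W (t, x)‖ₑ :=
          lintegral_mono' Measure.restrict_le_self le_rfl
      _ = ∫⁻ x, ‖(w s - w t : LOne) x‖ₑ := by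
          refine lintegral_congr_ae ?_
          filter_upwards [hw s hs, hw t ht, Lp.coeFn_sub (w s) (w t)] with x h1 h2 h3
          rw [h1, h2, h3, Pi.sub_apply]
      _ ≤ _ := by
          rw [← eLpNorm_one_eq_lintegral_enorm, ← Lp.enorm_def, ← ofReal_norm]
          exact ENNReal.ofReal_le_ofReal (hL s t hs ht)

/-- A bounded mild solution is (a representative of) a weak solution. -/
theorem exists_isWeakSolution {R r : ℝ → ℝ → ℝ} {α : ℝ → ℝ} {a b H U K D ε : ℝ} (ha : 0 < a)
    (hr : IsGlobalTerm r α √a b H) (hε : 0 < ε) (hU : 0 ≤ U) (hK : 0 ≤ K)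
    (hrR : ∀ u v, |u| ≤ U → r u v = R u v) {g : ℝ → State} (hgc : Continuous g)
    (hg : IsMildCurve (pairShift √a (-√a)) (relaxSource hr hε) g)
    (hD : TransLip (pairShift 1 1) D (g 0))
    (hb : ∀ t, 0 ≤ t → ∀ᵐ x, |uOf (pairShift √a (-√a) t (g t)) x| ≤ U ∧
      |vOf √a (pairShift √a (-√a) t (g t)) x| ≤ K) {u₀ v₀ : ℝ → ℝ}
    (h0 : ∀ᵐ x, uOf (g 0) x = u₀ x ∧ vOf √a (g 0) x = v₀ x) :
    ∃ u v : ℝ → ℝ → ℝ, IsWeakSolution R a ε u₀ v₀ u v ∧ ∀ t, 0 ≤ t → ∀ᵐ x,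
      u t x = uOf (pairShift √a (-√a) t (g t)) x ∧ v t x = vOf √a (pairShift √a (-√a) t (g t)) x := by
  have hc := hr.c_pos
  have hcc : √a * √a = a := Real.mul_self_sqrt ha.le
  set c := √a
  set f : ℝ → State := fun t => pairShift c (-c) t (g t) with hf
  obtain ⟨L, hL⟩ : ∃ L, ∀ s t, 0 ≤ s → 0 ≤ t → ‖f s - f t‖ ≤ L * |s - t| :=
    ⟨_, fun s t hs ht => flow_lipschitz hr hε hg hD s t hs ht⟩
  set wu : ℝ → LOne := fun t => (f t).fst + (f t).snd with hwu
  set wv : ℝ → LOne := fun t => c • ((f t).fst - (f t).snd) with hwv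
  have hcu : ∀ t, ∀ᵐ x, wu t x = uOf (f t) x := fun t => Lp.coeFn_add _ _
  have hcv : ∀ t, ∀ᵐ x, wv t x = vOf c (f t) x := fun t => by
    filter_upwards [Lp.coeFn_smul c ((f t).fst - (f t).snd), Lp.coeFn_sub (f t).fst (f t).snd]
      with x h1 h2
    rw [h1, Pi.smul_apply, h2, Pi.sub_apply, smul_eq_mul, vOf]
  have hLu : ∀ s t, 0 ≤ s → 0 ≤ t → ‖wu s - wu t‖ ≤ L * |s - t| := fun s t hs ht => by
    refine le_trans ?_ (hL s t hs ht)
    rw [WithLp.prod_norm_eq_of_L1, hwu]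
    refine le_trans (le_of_eq ?_) (norm_add_le _ _)
    rw [WithLp.sub_fst, WithLp.sub_snd, add_sub_add_comm]
  have hLv : ∀ s t, 0 ≤ s → 0 ≤ t → ‖wv s - wv t‖ ≤ c * L * |s - t| := fun s t hs ht => by
    rw [mul_assoc]
    refine le_trans ?_ (mul_le_mul_of_nonneg_left (hL s t hs ht) hc.le)
    rw [WithLp.prod_norm_eq_of_L1, hwv]
    simp only
    rw [← smul_sub, norm_smul, Real.norm_of_nonneg hc.le]
    refine mul_le_mul_of_nonneg_left (le_trans (le_of_eq ?_) (norm_sub_le _ _)) hc.le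
    rw [WithLp.sub_fst, WithLp.sub_snd, sub_sub_sub_comm]
  obtain ⟨Wu, hWum, hWu⟩ := exists_measurable_representative hLu
  obtain ⟨Wv, hWvm, hWv⟩ := exists_measurable_representative hLv
  -- Clipping changes nothing almost everywhere at each time `t ≥ 0` and makes the bounds hold at
  -- every point.
  set u : ℝ × ℝ → ℝ := fun p => clip U (Wu p) with hu
  set v : ℝ × ℝ → ℝ := fun p => clip K (Wv p) with hv
  have hum : Measurable u := (measurable_clip U).comp hWum
  have hvm : Measurable v := (measurable_clip K).comp hWvm
  have huU : ∀ p, |u p| ≤ U := fun p => abs_clip_le hU _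
  have hvK : ∀ p, |v p| ≤ K := fun p => abs_clip_le hK _
  have hue : ∀ t, 0 ≤ t → ∀ᵐ x, u (t, x) = uOf (f t) x ∧ v (t, x) = vOf c (f t) x := fun t ht => by
    filter_upwards [hWu t ht, hWv t ht, hcu t, hcv t, hb t ht] with x h1 h2 h3 h4 h5
    rw [hu, hv]
    simp only
    rw [h1, h2, h3, h4]
    exact ⟨clip_eq h5.1, clip_eq h5.2⟩
  refine ⟨fun t x => u (t, x), fun t x => v (t, x), ?_, hue⟩
  have hcurve_u := isBoundedCurve_of_lipschitz hum huU hLu fun t ht => by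
    filter_upwards [hue t ht, hcu t] with x h1 h2
    rw [h1.1, h2]
  have hcurve_v := isBoundedCurve_of_lipschitz hvm hvK hLv fun t ht => by
    filter_upwards [hue t ht, hcv t] with x h1 h2
    rw [h1.2, h2]
  -- the source
  set Q : ℝ × ℝ → ℝ := fun p => r (u p) (v p) / ε / (2 * c) with hQdef
  have hrN := hr.isNemytskii le_rfl (one_div_nonneg.2 hε.le)
  have hdec : ∀ y z, decrement r α 0 (1 / ε) y z = r y z / ε := fun y z => by
    rw [decrement, zero_mul, zero_add, one_div_mul_eq_div]
  have hQm : Measurable Q := by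
    have := hrN.continuous.measurable.comp (hum.prodMk hvm)
    simp only [hdec] at this
    exact this.div_const _
  obtain ⟨C, hC⟩ := hrN.bound
  set K' : ℝ := max ((U + K / c) / 2) (|C| * (U + K) / (2 * c)) with hK'
  have hQK : ∀ p, |Q p| ≤ K' := fun p => by
    refine le_max_of_le_right ?_
    have h1 := hC (u p) (v p)
    rw [hdec] at h1
    rw [hQdef]
    simp only
    rw [abs_div, abs_of_pos (by positivity : 0 < 2 * c)]
    refine div_le_div_of_nonneg_right (h1.trans ?_) (by positivity)
    refine (mul_le_mul_of_nonneg_right (le_abs_self C) (by positivity)).trans ?_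
    exact mul_le_mul_of_nonneg_left (add_le_add (huU p) (hvK p)) (abs_nonneg _)
  have hvc : ∀ p, |v p / c| ≤ K / c := fun p => by
    rw [abs_div, abs_of_pos hc]
    exact div_le_div_of_nonneg_right (hvK p) hc.le
  have hQe : ∀ t, 0 ≤ t → ∀ᵐ x, -Q (t, x) = (relaxSource hr hε (f t)).fst x ∧
      Q (t, x) = (relaxSource hr hε (f t)).snd x := fun t ht => by
    filter_upwards [source_coe c hrN (f t), hue t ht] with x h1 h2
    rw [hQdef]
    simp only
    rw [h2.1, h2.2, ← hdec]
    exact ⟨h1.1.symm, h1.2.symm⟩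
  have hsrc : Continuous fun t => pairShift c (-c) (-t) (relaxSource hr hε (f t)) :=
    continuous_comp_of_lipschitz (Φ := fun t x => pairShift c (-c) (-t) x) (K := 1)
      (fun x => ((isIsometryGroup_pairShift c (-c)).continuous x).comp continuous_neg)
      (fun t => (pairShift c (-c) (-t)).lipschitz)
      ((lipschitz_relaxSource hr hε).continuous.comp
        ((isIsometryGroup_pairShift c (-c)).continuous_apply hgc))
  have hfst : Continuous fun F : State => F.fst := (WithLp.fstL 1 ℝ LOne LOne).continuous
  have hsnd : Continuous fun F : State => F.snd := (WithLp.sndL 1 ℝ LOne LOne).continuous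
  have key₁ : ∀ φ : ℝ × ℝ → ℝ, ContDiff ℝ ∞ φ → HasCompactSupport φ → (∫ z in Ioi (0 : ℝ) ×ˢ
      (univ : Set ℝ), ((u z + v z / c) / 2 * charDeriv c φ z + -Q z * φ z))
      + ∫ x, (g 0).fst x * φ (0, x) = 0 := by
    refine fun φ hφ hs => weak_transport_of_mild (K := K') (p := fun t => (g t).fst)
      (q := fun t => (relaxSource hr hε (f t)).fst) (F := fun z => (u z + v z / c) / 2)
      (Q := fun z => -Q z) (fun t ht => ?_) ?_ (by fun_prop) hQm.neg (fun z => ?_)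
      (fun z => by rw [abs_neg]; exact hQK z) (fun t ht => ?_)
      (fun t ht => (hQe t ht).mono fun x hx => hx.1) hφ hs
    · have := (WithLp.fstL 1 ℝ LOne LOne).hasFDerivAt.comp_hasDerivAt t (hg t ht)
      rw [← mul_neg]
      exact this
    · simp only [← mul_neg]
      exact (hfst.comp hsrc).continuousOn
    · refine le_max_of_le_left ?_
      rw [abs_div, abs_two]
      exact div_le_div_of_nonneg_right ((abs_add_le _ _).trans (add_le_add (huU z) (hvc z)))
        zero_le_two
    · filter_upwards [hue t ht] with x hx
      rw [hx.1, hx.2, ← fst_eq hc.ne']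
      rfl
  have key₂ : ∀ φ : ℝ × ℝ → ℝ, ContDiff ℝ ∞ φ → HasCompactSupport φ → (∫ z in Ioi (0 : ℝ) ×ˢ
      (univ : Set ℝ), ((u z - v z / c) / 2 * charDeriv (-c) φ z + Q z * φ z))
      + ∫ x, (g 0).snd x * φ (0, x) = 0 := by
    refine fun φ hφ hs => weak_transport_of_mild (K := K') (p := fun t => (g t).snd)
      (q := fun t => (relaxSource hr hε (f t)).snd) (F := fun z => (u z - v z / c) / 2)
      (Q := Q) (fun t ht => ?_) ?_ (by fun_prop) hQm (fun z => ?_)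
      hQK (fun t ht => ?_)
      (fun t ht => (hQe t ht).mono fun x hx => hx.2) hφ hs
    · have := (WithLp.sndL 1 ℝ LOne LOne).hasFDerivAt.comp_hasDerivAt t (hg t ht)
      rw [← mul_neg]
      exact this
    · simp only [← mul_neg]
      exact (hsnd.comp hsrc).continuousOn
    · refine le_max_of_le_left ?_
      rw [abs_div, abs_two]
      exact div_le_div_of_nonneg_right ((abs_sub _ _).trans (add_le_add (huU z) (hvc z)))
        zero_le_two
    · filter_upwards [hue t ht] with x hx
      rw [hx.1, hx.2, ← snd_eq hc.ne']
      rfl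
  have hint : ∀ {φ : ℝ × ℝ → ℝ}, ContDiff ℝ ∞ φ → HasCompactSupport φ →
      IntegrableOn (fun z => (u z + v z / c) / 2 * charDeriv c φ z + -Q z * φ z)
        (Ioi (0 : ℝ) ×ˢ (univ : Set ℝ)) ∧
      IntegrableOn (fun z => (u z - v z / c) / 2 * charDeriv (-c) φ z + Q z * φ z)
        (Ioi (0 : ℝ) ×ˢ (univ : Set ℝ)) := fun {φ} hφ hs => by
    have hb1 : ∀ z, |(u z + v z / c) / 2| ≤ (U + K / c) / 2 := fun z => by
      rw [abs_div, abs_two]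
      exact div_le_div_of_nonneg_right ((abs_add_le _ _).trans (add_le_add (huU z) (hvc z)))
        zero_le_two
    have hb2 : ∀ z, |(u z - v z / c) / 2| ≤ (U + K / c) / 2 := fun z => by
      rw [abs_div, abs_two]
      exact div_le_div_of_nonneg_right ((abs_sub _ _).trans (add_le_add (huU z) (hvc z)))
        zero_le_two
    have hq := integrable_mul_test hφ.continuous hs hQm hQK
    have hq' := integrable_mul_test hφ.continuous hs hQm.neg (fun z => by
      rw [Pi.neg_apply, abs_neg]; exact hQK z)
    exact ⟨((integrable_mul_test (contDiff_charDeriv hφ).continuous (hasCompactSupport_charDeriv hs)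
      (by fun_prop) hb1).add hq').integrableOn,
      ((integrable_mul_test (contDiff_charDeriv hφ).continuous (hasCompactSupport_charDeriv hs)
      (by fun_prop) hb2).add hq).integrableOn⟩
  have hint0 : ∀ {φ : ℝ × ℝ → ℝ}, ContDiff ℝ ∞ φ → HasCompactSupport φ → ∀ w : LOne,
      Integrable fun x => w x * φ (0, x) := fun {φ} hφ hs w => by
    obtain ⟨M, hM⟩ := hs.exists_bound_of_continuous hφ.continuous
    have hφc := hφ.continuous
    exact (L1.integrable_coeFn w).mul_bdd
      (by fun_prop : Continuous fun x : ℝ => φ (0, x)).aestronglyMeasurable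
      (Eventually.of_forall fun x => hM _)
  refine ⟨hcurve_u, hcurve_v, fun φ hφ hs => ?_, fun φ hφ hs => ?_⟩
  · have h1 := key₁ φ hφ hs
    have h2 := key₂ φ hφ hs
    have e1 : ∫ x, u₀ x * φ (0, x) = (∫ x, (g 0).fst x * φ (0, x)) + ∫ x, (g 0).snd x * φ (0, x) := by
      rw [← integral_add (hint0 hφ hs _) (hint0 hφ hs _)]
      refine integral_congr_ae ?_
      filter_upwards [h0] with x hx
      rw [← hx.1, uOf]; ring
    -- Adding the two transport equations cancels the sources and gives conservation of `u`; below,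
    -- their difference multiplied by `c` gives the equation for `v`, with source `-2 c Q = -r / ε`.
    have e2 : ∫ z in Ioi (0 : ℝ) ×ˢ (univ : Set ℝ),
        (u z * fderiv ℝ φ z (1, 0) + v z * fderiv ℝ φ z (0, 1)) =
        (∫ z in Ioi (0 : ℝ) ×ˢ (univ : Set ℝ),
          ((u z + v z / c) / 2 * charDeriv c φ z + -Q z * φ z)) +
        ∫ z in Ioi (0 : ℝ) ×ˢ (univ : Set ℝ),
          ((u z - v z / c) / 2 * charDeriv (-c) φ z + Q z * φ z) := by
      rw [← integral_add (hint hφ hs).1 (hint hφ hs).2]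
      refine integral_congr_ae (Eventually.of_forall fun z => ?_)
      simp only [charDeriv]
      field_simp
      ring
    rw [e1]
    refine Eq.trans (congrArg (· + _) e2) ?_
    linarith
  · have h1 := key₁ φ hφ hs
    have h2 := key₂ φ hφ hs
    have e1 : ∫ x, v₀ x * φ (0, x) =
        c * ((∫ x, (g 0).fst x * φ (0, x)) - ∫ x, (g 0).snd x * φ (0, x)) := by
      rw [← integral_sub (hint0 hφ hs _) (hint0 hφ hs _), ← integral_const_mul]
      refine integral_congr_ae ?_
      filter_upwards [h0] with x hx
      rw [← hx.2, vOf]; ring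
    have e2 : ∫ z in Ioi (0 : ℝ) ×ˢ (univ : Set ℝ),
        (v z * fderiv ℝ φ z (1, 0) + a * u z * fderiv ℝ φ z (0, 1) - 1 / ε * R (u z) (v z) * φ z) =
        c * ((∫ z in Ioi (0 : ℝ) ×ˢ (univ : Set ℝ),
          ((u z + v z / c) / 2 * charDeriv c φ z + -Q z * φ z)) -
        ∫ z in Ioi (0 : ℝ) ×ˢ (univ : Set ℝ),
          ((u z - v z / c) / 2 * charDeriv (-c) φ z + Q z * φ z)) := by
      rw [← integral_sub (hint hφ hs).1 (hint hφ hs).2, ← integral_const_mul]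
      refine integral_congr_ae (Eventually.of_forall fun z => ?_)
      simp only [charDeriv, hQdef]
      rw [← hrR _ _ (huU z), ← hcc]
      field_simp
      ring
    rw [e1]
    refine Eq.trans (congrArg (· + _) e2) ?_
    rw [← mul_add]
    refine mul_eq_zero_of_right _ ?_
    linarith

end

end RelaxationAP

namespace RelaxationAP

noncomputable section

/-! ### Bounded curves -/

/-- Boundedness on `[0, T] × ℝ` for every `T`. -/
def BoundedOnStrips (F : ℝ × ℝ → ℝ) : Prop := ∀ T, ∃ K, ∀ t ∈ Icc 0 T, ∀ x, |F (t, x)| ≤ K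

theorem BoundedOnStrips.integrableOn_mul {F θ : ℝ × ℝ → ℝ} (hb : BoundedOnStrips F)
    (hF : Measurable F) (hθ : Continuous θ) (hs : HasCompactSupport θ) :
    IntegrableOn (fun z => F z * θ z) (Ioi (0 : ℝ) ×ˢ (univ : Set ℝ)) := by
  obtain ⟨b, hb0, hzero⟩ := exists_time_bound hs
  obtain ⟨K, hK⟩ := hb b
  refine ((hθ.integrable_of_hasCompactSupport hs).abs.const_mul K).integrableOn.mono'
    (hF.mul hθ.measurable).aestronglyMeasurable ?_
  refine (ae_restrict_iff' (measurableSet_Ioi.prod MeasurableSet.univ)).2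
    (Eventually.of_forall fun z hz => ?_)
  rw [norm_mul, Real.norm_eq_abs, Real.norm_eq_abs]
  rcases le_total b z.1 with h | h
  · rw [hzero z.1 z.2 h]; simp
  · exact mul_le_mul_of_nonneg_right (hK z.1 ⟨le_of_lt hz.1, h⟩ z.2) (abs_nonneg _)

theorem restrict_strip : (volume : Measure (ℝ × ℝ)).restrict (Ici 0 ×ˢ univ) =
    (volume.restrict (Ici (0 : ℝ))).prod volume := by
  rw [Measure.volume_eq_prod, ← Measure.prod_restrict, Measure.restrict_univ]

theorem hasCompactSupport_comp_sub {θ : ℝ → ℝ} (hs : HasCompactSupport θ)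
    (y : ℝ) : HasCompactSupport fun x => θ (x - y) :=
  hs.comp_homeomorph (Homeomorph.subRight y)

namespace IsBoundedCurve

variable {f f' : ℝ → ℝ → ℝ}

/-- A jointly measurable version is clipped at a level depending on `⌈t⌉₊`, which makes the bounds
valid everywhere. By Fubini it agrees with `f` on almost every time slice, not necessarily on all.
-/
theorem exists_representative (hf : IsBoundedCurve f) : ∃ F : ℝ × ℝ → ℝ, Measurable F ∧
    BoundedOnStrips F ∧ (∀ᵐ z ∂volume.restrict (Ici (0 : ℝ) ×ˢ (univ : Set ℝ)), f z.1 z.2 = F z) ∧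
    ∀ᵐ t ∂volume.restrict (Ici (0 : ℝ)), ∀ᵐ x, f t x = F (t, x) := by
  choose K hK using hf.bounded
  -- Partial sums replace the bounds `K n` by nonnegative ones that are monotone in `n`.
  set k : ℕ → ℝ := fun n => ∑ i ∈ Finset.range (n + 1), |K i| with hk
  have hkmono : Monotone k := fun m n hmn => Finset.sum_le_sum_of_subset_of_nonneg
    (Finset.range_subset_range.2 (by omega)) fun _ _ _ => abs_nonneg _
  have hk0 : ∀ n, 0 ≤ k n := fun n => Finset.sum_nonneg fun _ _ => abs_nonneg _
  set G := hf.aestronglyMeasurable.mk _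
  have hG : Measurable G := hf.aestronglyMeasurable.stronglyMeasurable_mk.measurable
  have hfG : ∀ᵐ z ∂volume.restrict (Ici (0 : ℝ) ×ˢ (univ : Set ℝ)), f z.1 z.2 = G z :=
    hf.aestronglyMeasurable.ae_eq_mk
  set F : ℝ × ℝ → ℝ := fun z => clip (k ⌈z.1⌉₊) (G z) with hF
  have hFm : Measurable F := by
    have h1 : Measurable fun q : ℕ × ℝ => clip (k q.1) q.2 :=
      measurable_from_prod_countable_right fun n => measurable_clip (k n)
    exact h1.comp ((Nat.measurable_ceil.comp measurable_fst).prodMk hG)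
  have hslice : ∀ᵐ t ∂volume.restrict (Ici (0 : ℝ)), ∀ᵐ x, G (t, x) = F (t, x) := by
    have h1 := hfG
    rw [restrict_strip] at h1
    filter_upwards [Measure.ae_ae_of_ae_prod h1, ae_restrict_mem measurableSet_Ici] with t h2 ht
    filter_upwards [h2, hK ⌈t⌉₊ t ⟨ht, Nat.le_ceil t⟩] with x h3 h4
    rw [hF]
    simp only at h3 ⊢
    rw [clip_eq]
    rw [← h3]
    refine h4.trans ((le_abs_self _).trans ?_)
    exact Finset.single_le_sum (f := fun i : ℕ => |K i|) (fun _ _ => abs_nonneg _)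
      (Finset.mem_range.2 (Nat.lt_succ_self _))
  have hGF : ∀ᵐ z ∂volume.restrict (Ici (0 : ℝ) ×ˢ (univ : Set ℝ)), G z = F z := by
    rw [restrict_strip, Measure.ae_prod_iff_ae_ae (measurableSet_eq_fun hG hFm)]
    exact hslice
  refine ⟨F, hFm, fun T => ⟨k ⌈T⌉₊, fun t ht x => ?_⟩, ?_, ?_⟩
  · exact (abs_clip_le (hk0 _) _).trans (hkmono (Nat.ceil_mono ht.2))
  · filter_upwards [hfG, hGF] with z h1 h2
    rw [h1, h2]
  · have h1 := hfG
    rw [restrict_strip] at h1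
    filter_upwards [Measure.ae_ae_of_ae_prod h1, hslice] with t h2 h3
    filter_upwards [h2, h3] with x h4 h5
    rw [← h5, ← h4]

theorem const_mul (hf : IsBoundedCurve f) (r : ℝ) : IsBoundedCurve fun t x => r * f t x where
  aestronglyMeasurable := hf.aestronglyMeasurable.const_mul r
  aestronglyMeasurable_slice t ht := (hf.aestronglyMeasurable_slice t ht).const_mul r
  bounded T := by
    obtain ⟨K, hK⟩ := hf.bounded T
    refine ⟨|r| * K, fun t ht => (hK t ht).mono fun x hx => ?_⟩
    rw [abs_mul]
    exact mul_le_mul_of_nonneg_left hx (abs_nonneg r)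
  continuous t ht L := by
    have h1 := ENNReal.Tendsto.const_mul (a := ‖r‖ₑ) (hf.continuous t ht L) (Or.inr enorm_ne_top)
    rw [mul_zero] at h1
    refine h1.congr fun s => ?_
    rw [← lintegral_const_mul' _ _ enorm_ne_top]
    refine lintegral_congr fun x => ?_
    rw [← mul_sub, enorm_mul]

theorem add (hf : IsBoundedCurve f) (hf' : IsBoundedCurve f') :
    IsBoundedCurve fun t x => f t x + f' t x where
  aestronglyMeasurable := hf.aestronglyMeasurable.add hf'.aestronglyMeasurable
  aestronglyMeasurable_slice t ht :=
    (hf.aestronglyMeasurable_slice t ht).add (hf'.aestronglyMeasurable_slice t ht)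
  bounded T := by
    obtain ⟨K, hK⟩ := hf.bounded T
    obtain ⟨K', hK'⟩ := hf'.bounded T
    refine ⟨K + K', fun t ht => ?_⟩
    filter_upwards [hK t ht, hK' t ht] with x h1 h2
    exact (abs_add_le _ _).trans (add_le_add h1 h2)
  continuous t ht L := by
    have h1 := (hf.continuous t ht L).add (hf'.continuous t ht L)
    rw [add_zero] at h1
    refine tendsto_of_tendsto_of_tendsto_of_le_of_le' tendsto_const_nhds h1
      (Eventually.of_forall fun _ => zero_le) ?_
    filter_upwards [self_mem_nhdsWithin] with s hs
    have hmeas : AEMeasurable (fun x => ‖f s x - f t x‖ₑ) (volume.restrict (Icc (-L) L)) :=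
      ((hf.aestronglyMeasurable_slice s hs).sub (hf.aestronglyMeasurable_slice t ht)).enorm.restrict
    rw [← lintegral_add_left' hmeas]
    refine lintegral_mono fun x => ?_
    rw [add_sub_add_comm]
    exact enorm_add_le _ _

theorem integrable_mul (hf : IsBoundedCurve f) {t : ℝ} (ht : 0 ≤ t) {θ : ℝ → ℝ} (hθ : Continuous θ)
    (hs : HasCompactSupport θ) : Integrable fun x => f t x * θ x := by
  obtain ⟨K, hK⟩ := hf.bounded t
  exact (hθ.integrable_of_hasCompactSupport hs).bdd_mul (hf.aestronglyMeasurable_slice t ht)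
    (hK t ⟨ht, le_rfl⟩)

/-- Testing an `L¹_loc`-continuous curve with a travelling test function. -/
theorem continuousOn_integral (hf : IsBoundedCurve f) {κ : ℝ} {θ : ℝ → ℝ} (hθ : ContDiff ℝ ∞ θ)
    (hs : HasCompactSupport θ) :
    ContinuousOn (fun t => ∫ x, f t x * θ (x - κ * t)) (Ici 0) := by
  intro t ht
  have ht : 0 ≤ t := ht
  obtain ⟨C, hC⟩ := hs.exists_bound_of_continuous hθ.continuous
  obtain ⟨l, hl⟩ := (hθ.of_le (by simp : (1 : WithTop ℕ∞) ≤ ((⊤ : ℕ∞) : WithTop ℕ∞))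
    ).lipschitzWith_of_hasCompactSupport hs one_ne_zero
  obtain ⟨K, hK⟩ := hf.bounded t
  have hK := hK t ⟨ht, le_rfl⟩
  obtain ⟨L₀, hL₀, hsub⟩ := hs.isBounded.subset_closedBall_lt 0 0
  -- The window contains the support of the travelling function for all times up to `t + 1`.
  set L := L₀ + |κ| * (t + 1) with hL
  have hzero : ∀ s x, 0 ≤ s → s ≤ t + 1 → x ∉ Icc (-L) L → θ (x - κ * s) = 0 := by
    intro s x hs0 hs1 hx
    by_contra h
    have h1 := hsub (subset_tsupport θ h)
    rw [Metric.mem_closedBall, dist_zero_right, Real.norm_eq_abs] at h1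
    refine hx (abs_le.1 ?_)
    have h2 : |κ * s| ≤ |κ| * (t + 1) := by
      rw [abs_mul, abs_of_nonneg hs0]
      exact mul_le_mul_of_nonneg_left hs1 (abs_nonneg _)
    calc |x| = |(x - κ * s) + κ * s| := by ring_nf
      _ ≤ _ := (abs_add_le _ _).trans (add_le_add h1 h2)
  have hlim : Tendsto (fun s => ENNReal.ofReal C * (∫⁻ x in Icc (-L) L, ‖f s x - f t x‖ₑ) +
      ENNReal.ofReal (|K| * (l * (|κ| * |s - t|))) * volume (Icc (-L) L)) (𝓝[Ici 0] t) (𝓝 0) := by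
    have h1 := ENNReal.Tendsto.const_mul (a := ENNReal.ofReal C) (hf.continuous t ht L)
      (Or.inr ENNReal.ofReal_ne_top)
    have hc : Continuous fun s => ENNReal.ofReal (|K| * (l * (|κ| * |s - t|))) :=
      ENNReal.continuous_ofReal.comp (by fun_prop)
    have h2 := hc.tendsto t
    simp only [sub_self, abs_zero, mul_zero, ENNReal.ofReal_zero] at h2
    have h3 := ENNReal.Tendsto.mul_const (b := volume (Icc (-L) L))
      (h2.mono_left (nhdsWithin_le_nhds (s := Ici (0 : ℝ)))) (Or.inr measure_Icc_lt_top.ne)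
    have := h1.add h3
    rwa [mul_zero, zero_mul, add_zero] at this
  rw [ContinuousWithinAt, tendsto_iff_edist_tendsto_0]
  refine tendsto_of_tendsto_of_tendsto_of_le_of_le' tendsto_const_nhds hlim
    (Eventually.of_forall fun _ => zero_le) ?_
  have hnear : ∀ᶠ s in 𝓝[Ici 0] t, s ≤ t + 1 :=
    nhdsWithin_le_nhds (Iic_mem_nhds (lt_add_one t))
  filter_upwards [self_mem_nhdsWithin, hnear] with s hs0 hs1
  have hs0 : 0 ≤ s := hs0
  have hi : ∀ r, 0 ≤ r → ∀ y, Integrable fun x => f r x * θ (x - y) := fun r hr y =>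
    hf.integrable_mul hr (hθ.continuous.comp (by fun_prop)) (hasCompactSupport_comp_sub hs y)
  rw [edist_eq_enorm_sub, ← integral_sub (hi s hs0 _) (hi t ht _),
    ← setIntegral_eq_integral_of_forall_compl_eq_zero (s := Icc (-L) L) fun x hx => by
      rw [hzero s x hs0 hs1 hx, hzero t x ht (by linarith) hx]; simp]
  refine (enorm_integral_le_lintegral_enorm _).trans ?_
  rw [← lintegral_const_mul' _ _ ENNReal.ofReal_ne_top, ← setLIntegral_const,
    ← lintegral_add_right _ measurable_const]
  refine lintegral_mono_ae ?_
  filter_upwards [ae_restrict_of_ae hK] with x hx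
  have e : f s x * θ (x - κ * s) - f t x * θ (x - κ * t) =
    θ (x - κ * s) * (f s x - f t x) + f t x * (θ (x - κ * s) - θ (x - κ * t)) := by ring
  rw [e]
  refine (enorm_add_le _ _).trans (add_le_add ?_ ?_)
  · rw [enorm_mul]
    gcongr
    rw [← ofReal_norm]
    exact ENNReal.ofReal_le_ofReal (hC _)
  · rw [← ofReal_norm, norm_mul]
    refine ENNReal.ofReal_le_ofReal (mul_le_mul (hx.trans (le_abs_self K)) ?_ (norm_nonneg _)
      (abs_nonneg _))
    have h1 := hl.dist_le_mul (x - κ * s) (x - κ * t)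
    rw [dist_eq_norm, Real.dist_eq] at h1
    have h2 : x - κ * s - (x - κ * t) = -(κ * (s - t)) := by ring
    rwa [h2, abs_neg, abs_mul] at h1

end IsBoundedCurve

/-! ### Weak formulations in time -/

/-- A continuous `m` with `m' = n` weakly on `[0, ∞)` and `m 0 = 0` is the primitive of `n`. -/
theorem eq_integral_of_weak {m n : ℝ → ℝ} (hm : ContinuousOn m (Ici 0))
    (hn : ∀ T, 0 ≤ T → IntervalIntegrable n volume 0 T) (hb : ∀ T, ∃ C, ∀ s ∈ Icc 0 T, |n s| ≤ C)
    (hw : ∀ χ : ℝ → ℝ, ContDiff ℝ ∞ χ → HasCompactSupport χ →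
      ∫ s in Ioi 0, (deriv χ s * m s + χ s * n s) = 0) {t : ℝ} (ht : 0 ≤ t) :
    m t = ∫ s in (0 : ℝ)..t, n s := by
  obtain ⟨C, hC⟩ := hb (t + 1)
  have hC0 : 0 ≤ C := (abs_nonneg _).trans (hC 0 ⟨le_rfl, by linarith⟩)
  have key : ∀ η, 0 < η → ∃ δ₀, 0 < δ₀ ∧ ∀ δ, 0 < δ → δ < δ₀ →
      |m t - ∫ s in (0 : ℝ)..t, n s| ≤ η + C * δ := by
    intro η hη
    obtain ⟨δ₁, hδ₁, hmδ⟩ := Metric.continuousWithinAt_iff.1 (hm t ht) η hη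
    refine ⟨min δ₁ 1, lt_min hδ₁ one_pos, fun δ hδ hδ' => ?_⟩
    have hδ1 : δ < δ₁ := hδ'.trans_le (min_le_left _ _)
    have hδ2 : δ < 1 := hδ'.trans_le (min_le_right _ _)
    set ψ : ℝ → ℝ := fun s => Real.smoothTransition ((t + δ - s) / δ) with hψ
    have hψc : ContDiff ℝ ∞ ψ := Real.smoothTransition.contDiff.comp (by fun_prop)
    have hψa : Antitone ψ := fun s s' hss => Real.smoothTransition.monotone
      (div_le_div_of_nonneg_right (by linarith) hδ.le)
    have hψ1 : ∀ s, s ≤ t → ψ s = 1 := fun s hs => Real.smoothTransition.one_of_one_le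
      (by rw [one_le_div hδ]; linarith)
    have hψ0 : ∀ s, t + δ ≤ s → ψ s = 0 := fun s hs => Real.smoothTransition.zero_of_nonpos
      (div_nonpos_of_nonpos_of_nonneg (by linarith) hδ.le)
    have hψle : ∀ s, |ψ s| ≤ 1 := fun s => by
      rw [abs_of_nonneg (Real.smoothTransition.nonneg _)]
      exact Real.smoothTransition.le_one _
    have hψ'c : Continuous (deriv ψ) := hψc.continuous_deriv (by simp)
    -- `ψ` descends from `1` to `0` on `[t, t + δ]`. The first factor vanishes for `s ≤ -2`, giving
    -- compact support, and equals `1` for `s ≥ -1`, so positive times do not see it.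
    set χ : ℝ → ℝ := fun s => Real.smoothTransition (s + 2) * ψ s with hχ
    have hχc : ContDiff ℝ ∞ χ := (Real.smoothTransition.contDiff.comp (by fun_prop)).mul hψc
    have hχs : HasCompactSupport χ := by
      refine HasCompactSupport.of_support_subset_isCompact (isCompact_Icc (a := -2) (b := t + δ))
        fun s hs => ⟨?_, ?_⟩
      · by_contra h
        exact hs (by rw [hχ]; simp only; rw [Real.smoothTransition.zero_of_nonpos (by linarith), zero_mul])
      · by_contra h
        exact hs (by rw [hχ]; simp only; rw [hψ0 s (by linarith), mul_zero])
    have hχψ : ∀ s, 0 < s → χ s = ψ s ∧ deriv χ s = deriv ψ s := fun s hs => by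
      have : χ =ᶠ[𝓝 s] ψ := by
        filter_upwards [Ioi_mem_nhds hs] with s' hs'
        have hs' : 0 < s' := hs'
        rw [hχ]; simp only
        rw [Real.smoothTransition.one_of_one_le (by linarith), one_mul]
      exact ⟨this.eq_of_nhds, this.deriv_eq⟩
    have hψ'1 : ∀ s, s < t → deriv ψ s = 0 := fun s hs => by
      have : ψ =ᶠ[𝓝 s] fun _ => 1 := by
        filter_upwards [Iio_mem_nhds hs] with s' hs'
        exact hψ1 s' (le_of_lt hs')
      rw [this.deriv_eq, deriv_const]
    have hψ'0 : ∀ s, t + δ < s → deriv ψ s = 0 := fun s hs => by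
      have : ψ =ᶠ[𝓝 s] fun _ => 0 := by
        filter_upwards [Ioi_mem_nhds hs] with s' hs'
        exact hψ0 s' (le_of_lt hs')
      rw [this.deriv_eq, deriv_const]
    have hnI : ∀ a b, 0 ≤ a → 0 ≤ b → IntervalIntegrable (fun s => ψ s * n s) volume a b :=
      fun a b ha hb => ((hn a ha).symm.trans (hn b hb)).continuousOn_mul hψc.continuous.continuousOn
    have hmI : ∀ a b, 0 ≤ a → 0 ≤ b → IntervalIntegrable (fun s => deriv ψ s * m s) volume a b :=
      fun a b ha hb => ((hψ'c.continuousOn (s := Ici 0)).mul hm |>.mono fun s hs =>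
        le_trans (le_min ha hb) hs.1).intervalIntegrable
    have h1 : ∫ s in (0 : ℝ)..t + δ, (deriv ψ s * m s + ψ s * n s) = 0 := by
      refine Eq.trans ?_ (hw χ hχc hχs)
      rw [intervalIntegral.integral_of_le (by linarith)]
      rw [setIntegral_congr_fun (g := fun s => deriv χ s * m s + χ s * n s) measurableSet_Ioc
        fun s hs => by simp only [hχψ s hs.1]]
      symm
      refine setIntegral_eq_of_subset_of_forall_sdiff_eq_zero measurableSet_Ioi
        Ioc_subset_Ioi_self fun s hs => ?_
      have hs' : t + δ < s := not_le.1 fun h => hs.2 ⟨hs.1, h⟩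
      rw [(hχψ s hs.1).1, (hχψ s hs.1).2, hψ0 s hs'.le, hψ'0 s hs']; ring
    rw [← intervalIntegral.integral_add_adjacent_intervals
      (b := t) ((hmI _ _ le_rfl ht).add (hnI _ _ le_rfl ht))
      ((hmI _ _ ht (by linarith)).add (hnI _ _ ht (by linarith))),
      intervalIntegral.integral_add (hmI _ _ ht (by linarith)) (hnI _ _ ht (by linarith))] at h1
    have h2 : ∫ s in (0 : ℝ)..t, (deriv ψ s * m s + ψ s * n s) = ∫ s in (0 : ℝ)..t, n s := by
      refine intervalIntegral.integral_congr_ae ?_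
      have hne : ∀ᵐ s : ℝ, s ≠ t := by simp [ae_iff]
      filter_upwards [hne] with s hst hs
      rw [uIoc_of_le ht] at hs
      rw [hψ'1 s (lt_of_le_of_ne hs.2 hst), hψ1 s hs.2]; ring
    have h3 : |∫ s in t..t + δ, ψ s * n s| ≤ C * δ := by
      have := intervalIntegral.norm_integral_le_of_norm_le_const (a := t) (b := t + δ)
        (f := fun s => ψ s * n s) (C := C) fun s hs => by
          rw [uIoc_of_le (by linarith)] at hs
          rw [norm_mul]
          refine (mul_le_mul (hψle s) (hC s ⟨by linarith [hs.1], by linarith [hs.2]⟩)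
            (abs_nonneg _) zero_le_one).trans (le_of_eq (one_mul C))
      rwa [add_sub_cancel_left, abs_of_pos hδ] at this
    have hFTC : ∫ s in t..t + δ, deriv ψ s = -1 := by
      rw [intervalIntegral.integral_deriv_eq_sub
        (fun s _ => (hψc.differentiable (by simp)) s) (hψ'c.intervalIntegrable _ _),
        hψ0 _ le_rfl, hψ1 _ le_rfl]
      norm_num
    -- On `[t, t + δ]` the function `-ψ'` is a probability density, so the integral is minus an
    -- average of `m` near `t`.
    have h4 : |(∫ s in t..t + δ, deriv ψ s * m s) + m t| ≤ η := by
      have e : (∫ s in t..t + δ, deriv ψ s * m s) + m t =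
          ∫ s in t..t + δ, deriv ψ s * (m s - m t) := by
        simp only [mul_sub]
        rw [intervalIntegral.integral_sub (hmI _ _ ht (by linarith))
          ((hψ'c.intervalIntegrable _ _).mul_const _), intervalIntegral.integral_mul_const, hFTC]
        ring
      rw [e, ← Real.norm_eq_abs]
      refine (intervalIntegral.norm_integral_le_of_norm_le (a := t) (b := t + δ) (g := fun s => -deriv ψ s * η)
        (by linarith) (Eventually.of_forall fun s hs => ?_)
        ((hψ'c.neg.intervalIntegrable _ _).mul_const _)).trans (le_of_eq ?_)
      · rw [norm_mul, Real.norm_eq_abs, abs_of_nonpos hψa.deriv_nonpos]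
        refine mul_le_mul_of_nonneg_left (le_of_lt ?_) (neg_nonneg.2 hψa.deriv_nonpos)
        refine hmδ (ht.trans hs.1.le) ?_
        rw [Real.dist_eq, abs_of_pos (sub_pos.2 hs.1)]
        linarith [hs.2]
      · rw [intervalIntegral.integral_mul_const, intervalIntegral.integral_neg, hFTC]; ring
    rw [h2] at h1
    rw [abs_le] at h3 h4 ⊢
    constructor <;> linarith
  by_contra hne
  have hpos : 0 < |m t - ∫ s in (0 : ℝ)..t, n s| := abs_pos.2 (sub_ne_zero.2 hne)
  set z := |m t - ∫ s in (0 : ℝ)..t, n s|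
  obtain ⟨δ₀, hδ₀, h⟩ := key (z / 4) (by linarith)
  set δ := min (δ₀ / 2) (z / (4 * (C + 1))) with hδ
  have h1 := h δ (lt_min (by linarith) (by positivity)) ((min_le_left _ _).trans_lt (by linarith))
  have h2 : (C + 1) * δ ≤ z / 4 := by
    refine (mul_le_mul_of_nonneg_left (min_le_right _ _) (by linarith)).trans (le_of_eq ?_)
    field_simp
  have h3 : 0 < δ := lt_min (by linarith) (by positivity)
  nlinarith

end

end RelaxationAP

namespace RelaxationAP

noncomputable section

/-! ### Weak solutions of transport equations along characteristics -/

/-- The factor `θ (x - κ t)` is constant along characteristics; such products reduce the weak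
equation to one in time alone. -/
theorem charDeriv_travelling {κ : ℝ} {χ θ : ℝ → ℝ} (hχ : ContDiff ℝ ∞ χ) (hθ : ContDiff ℝ ∞ θ)
    (z : ℝ × ℝ) :
    charDeriv κ (fun z => χ z.1 * θ (z.2 - κ * z.1)) z = deriv χ z.1 * θ (z.2 - κ * z.1) := by
  have hφ : ContDiff ℝ ∞ fun z : ℝ × ℝ => χ z.1 * θ (z.2 - κ * z.1) :=
    (hχ.comp contDiff_fst).mul (hθ.comp (by fun_prop))
  have h1 := hasDerivAt_comp_char (κ := κ) hφ (z.2 - κ * z.1) z.1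
  simp only [sub_add_cancel, add_sub_cancel_right] at h1
  exact h1.unique (((hχ.differentiable (by simp)) z.1).hasDerivAt.mul_const _)

theorem hasCompactSupport_travelling {κ : ℝ} {χ θ : ℝ → ℝ} (hχ : HasCompactSupport χ)
    (hθ : HasCompactSupport θ) :
    HasCompactSupport fun z : ℝ × ℝ => χ z.1 * θ (z.2 - κ * z.1) := by
  refine HasCompactSupport.of_support_subset_isCompact
    ((hχ.isCompact.prod hθ.isCompact).image
      (by fun_prop : Continuous fun p : ℝ × ℝ => (p.1, p.2 + κ * p.1))) fun z hz => ?_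
  have hz := mul_ne_zero_iff.1 hz
  exact ⟨(z.1, z.2 - κ * z.1), ⟨subset_tsupport _ hz.1, subset_tsupport _ hz.2⟩, by simp⟩

section WeakTransport

variable {κ : ℝ} {d : ℝ → ℝ → ℝ} (hd : IsBoundedCurve d) {D q : ℝ × ℝ → ℝ} (hD : Measurable D)
  (hDb : BoundedOnStrips D) (hdD : ∀ᵐ t ∂volume.restrict (Ici (0 : ℝ)), ∀ᵐ x, d t x = D (t, x))
  (hq : Measurable q) (hqb : BoundedOnStrips q)
  (hw : ∀ φ : ℝ × ℝ → ℝ, ContDiff ℝ ∞ φ → HasCompactSupport φ →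
    ∫ z in Ioi (0 : ℝ) ×ˢ (univ : Set ℝ), (D z * charDeriv κ φ z + q z * φ z) = 0)
include hq hqb

theorem integrable_slice_mul {s : ℝ} (hs : 0 ≤ s) {θ : ℝ → ℝ} (hθ : Continuous θ)
    (hsθ : HasCompactSupport θ) : Integrable fun x => q (s, x) * θ x := by
  obtain ⟨K, hK⟩ := hqb s
  exact (hθ.integrable_of_hasCompactSupport hsθ).bdd_mul
    (hq.comp measurable_prodMk_left).aestronglyMeasurable
    (Eventually.of_forall fun x => hK s ⟨hs, le_rfl⟩ x)

include hd hD hDb hdD hw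

/-- The weak formulation tested with functions transported along the characteristics. -/
theorem integral_travelling_eq {θ : ℝ → ℝ} (hθ : ContDiff ℝ ∞ θ) (hsθ : HasCompactSupport θ) {t : ℝ}
    (ht : 0 ≤ t) : ∫ x, d t x * θ (x - κ * t) = ∫ s in (0 : ℝ)..t, ∫ x, q (s, x) * θ (x - κ * s) := by
  have hθ' : ∀ s : ℝ, Continuous fun x => θ (x - κ * s) := fun s => hθ.continuous.comp (by fun_prop)
  have hθs : ∀ s : ℝ, HasCompactSupport fun x => θ (x - κ * s) := fun s =>
    hasCompactSupport_comp_sub hsθ _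
  have hbound : ∀ T, ∃ C, ∀ s ∈ Icc 0 T, |∫ x, q (s, x) * θ (x - κ * s)| ≤ C := fun T => by
    obtain ⟨K, hK⟩ := hqb T
    refine ⟨K * ∫ x, |θ x|, fun s hs => ?_⟩
    rw [← integral_const_mul,
      ← integral_sub_right_eq_self (fun x => K * |θ x|) (κ * s), ← Real.norm_eq_abs]
    refine (norm_integral_le_integral_norm _).trans (integral_mono_of_nonneg ?_ ?_
      (Eventually.of_forall fun x => ?_))
    · exact Eventually.of_forall fun _ => norm_nonneg _
    · exact (((hθ' s).integrable_of_hasCompactSupport (hθs s)).abs.const_mul K)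
    · simp only [norm_mul, Real.norm_eq_abs]
      exact mul_le_mul_of_nonneg_right (hK s hs x) (abs_nonneg _)
  refine eq_integral_of_weak (hd.continuousOn_integral hθ hsθ) (fun T hT => ?_) hbound
    (fun χ hχ hχs => ?_) ht
  · obtain ⟨C, hC⟩ := hbound T
    rw [intervalIntegrable_iff_integrableOn_Ioc_of_le hT]
    have hm : StronglyMeasurable fun z : ℝ × ℝ => q z * θ (z.2 - κ * z.1) :=
      (hq.mul (hθ.continuous.measurable.comp (by fun_prop))).stronglyMeasurable
    refine Measure.integrableOn_of_bounded (M := C) measure_Ioc_lt_top.ne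
      (hm.integral_prod_right' (ν := volume)).aestronglyMeasurable ?_
    refine (ae_restrict_iff' measurableSet_Ioc).2 (Eventually.of_forall fun s hs => ?_)
    exact hC s (Ioc_subset_Icc_self hs)
  · set φ : ℝ × ℝ → ℝ := fun z => χ z.1 * θ (z.2 - κ * z.1) with hφdef
    have hφ : ContDiff ℝ ∞ φ := (hχ.comp contDiff_fst).mul (hθ.comp (by fun_prop))
    have hφs : HasCompactSupport φ := hasCompactSupport_travelling hχs hsθ
    have h1 := hw φ hφ hφs
    have hint : IntegrableOn (fun z => D z * charDeriv κ φ z + q z * φ z)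
        (Ioi (0 : ℝ) ×ˢ (univ : Set ℝ)) :=
      (hDb.integrableOn_mul hD (contDiff_charDeriv hφ).continuous
        (hasCompactSupport_charDeriv hφs)).add (hqb.integrableOn_mul hq hφ.continuous hφs)
    rw [Measure.volume_eq_prod, setIntegral_prod _ hint] at h1
    refine Eq.trans ?_ h1
    refine setIntegral_congr_ae measurableSet_Ioi ?_
    rw [ae_restrict_iff' measurableSet_Ici] at hdD
    filter_upwards [hdD] with s hs hs0
    have hs0 : 0 < s := hs0
    rw [Measure.restrict_univ, ← integral_const_mul, ← integral_const_mul,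
      ← integral_add ((hd.integrable_mul hs0.le (hθ' s) (hθs s)).const_mul _)
        ((integrable_slice_mul hq hqb hs0.le (hθ' s) (hθs s)).const_mul _)]
    refine integral_congr_ae ?_
    filter_upwards [hs hs0.le] with x hx
    rw [hφdef, charDeriv_travelling hχ hθ, ← hx]
    ring

/-- Integration along the characteristics. -/
theorem ae_eq_integral_char {t : ℝ} (ht : 0 ≤ t) :
    ∀ᵐ y, d t (y + κ * t) = ∫ s in (0 : ℝ)..t, q (s, y + κ * s) := by
  obtain ⟨K, hK⟩ := hd.bounded t
  have hK := hK t ⟨ht, le_rfl⟩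
  obtain ⟨K', hK'⟩ := hqb t
  have htr : MeasurePreserving (fun y : ℝ => y + κ * t) := measurePreserving_add_right volume _
  have hqs : Measurable fun p : ℝ × ℝ => q (p.2, p.1 + κ * p.2) := hq.comp (by fun_prop)
  set J : ℝ → ℝ := fun y => ∫ s in (0 : ℝ)..t, q (s, y + κ * s) with hJ
  have hJm : AEStronglyMeasurable J volume := by
    have := hqs.stronglyMeasurable.integral_prod_right' (ν := volume.restrict (Ioc 0 t))
    simp only [hJ, intervalIntegral.integral_of_le ht]
    exact this.aestronglyMeasurable
  have hJb : ∀ y, ‖J y‖ ≤ K' * t := fun y => by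
    have := intervalIntegral.norm_integral_le_of_norm_le_const (a := 0) (b := t)
      (f := fun s => q (s, y + κ * s)) (C := K') fun s hs => by
        rw [uIoc_of_le ht] at hs
        exact hK' s (Ioc_subset_Icc_self hs) _
    rwa [sub_zero, abs_of_nonneg ht] at this
  have hdm : AEStronglyMeasurable (fun y => d t (y + κ * t)) volume :=
    (hd.aestronglyMeasurable_slice t ht).comp_measurePreserving htr
  have hdb : ∀ᵐ y, ‖d t (y + κ * t)‖ ≤ K := htr.quasiMeasurePreserving.ae hK
  have hloc : LocallyIntegrable (fun y => d t (y + κ * t) - J y) volume := by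
    have h1 : MemLp (fun y => d t (y + κ * t)) ∞ volume := memLp_top_of_bound hdm K hdb
    have h2 : MemLp J ∞ volume := memLp_top_of_bound hJm _ (Eventually.of_forall hJb)
    exact (h1.sub h2).locallyIntegrable le_top
  -- The identity is tested against a smooth `θ`, moved back to the fixed frame, and reduced by
  -- Fubini to the travelling weak formulation.
  have := ae_eq_zero_of_integral_contDiff_smul_eq_zero hloc fun θ hθ hsθ => ?_
  · exact this.mono fun y hy => sub_eq_zero.1 hy
  have hθi : Integrable θ := hθ.continuous.integrable_of_hasCompactSupport hsθ
  simp only [smul_eq_mul, mul_sub]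
  rw [integral_sub (hθi.mul_bdd hdm hdb) (hθi.mul_bdd hJm (Eventually.of_forall hJb)), sub_eq_zero]
  have e1 : ∫ y, θ y * d t (y + κ * t) = ∫ x, d t x * θ (x - κ * t) := by
    rw [← integral_sub_right_eq_self _ (κ * t)]
    refine integral_congr_ae (Eventually.of_forall fun x => ?_)
    simp only [sub_add_cancel, mul_comm]
  rw [e1, integral_travelling_eq hd hD hDb hdD hq hqb hw hθ hsθ ht]
  have e2 : ∀ y, θ y * J y = ∫ s in Ioc 0 t, θ y * q (s, y + κ * s) := fun y => by
    rw [hJ]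
    simp only
    rw [intervalIntegral.integral_of_le ht, integral_const_mul]
  simp only [e2]
  rw [integral_integral_swap, intervalIntegral.integral_of_le ht]
  · refine setIntegral_congr_fun measurableSet_Ioc fun s _ => ?_
    rw [← integral_sub_right_eq_self (fun y => θ y * q (s, y + κ * s)) (κ * s)]
    refine integral_congr_ae (Eventually.of_forall fun x => ?_)
    simp only [sub_add_cancel, mul_comm]
  · refine (hθi.comp_fst (volume.restrict (Ioc 0 t))).mul_bdd (c := K') hqs.aestronglyMeasurable ?_
    rw [Measure.ae_prod_iff_ae_ae (measurableSet_le hqs.norm measurable_const)]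
    refine Eventually.of_forall fun y => (ae_restrict_iff' measurableSet_Ioc).2
      (Eventually.of_forall fun s hs => ?_)
    exact hK' s (Ioc_subset_Icc_self hs) _

/-- Weighted `L¹` bound for the solution of a transport equation with source. -/
theorem lintegral_weighted_le {t T : ℝ} (ht : 0 ≤ t) (htT : t ≤ T) :
    ∫⁻ x, ‖d t x‖ₑ * ENNReal.ofReal (Real.exp (-|x|)) ≤ ENNReal.ofReal (Real.exp (|κ| * T)) *
      ∫⁻ s in Ioc 0 t, ∫⁻ x, ‖q (s, x)‖ₑ * ENNReal.ofReal (Real.exp (-|x|)) := by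
  set w : ℝ → ℝ≥0∞ := fun x => ENNReal.ofReal (Real.exp (-|x|)) with hw'
  have hwm : Measurable w := by rw [hw']; fun_prop
  -- Weak solutions are merely bounded, hence the integrable weight `exp (-|x|)`; finite propagation
  -- speed changes it by at most the factor `exp (|κ| T)`.
  have hwle : ∀ y, ∀ s ∈ Ioc 0 t, w (y + κ * t) ≤ ENNReal.ofReal (Real.exp (|κ| * T)) *
      w (y + κ * s) := fun y s hs => by
    rw [hw']
    simp only
    rw [← ENNReal.ofReal_mul (Real.exp_pos _).le, ← Real.exp_add]
    refine ENNReal.ofReal_le_ofReal (Real.exp_le_exp.2 ?_)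
    have h1 : |κ * (t - s)| ≤ |κ| * T := by
      rw [abs_mul, abs_of_nonneg (sub_nonneg.2 hs.2)]
      exact mul_le_mul_of_nonneg_left (by linarith [hs.1]) (abs_nonneg _)
    have h2 : |y + κ * s| ≤ |y + κ * t| + |κ * (t - s)| := by
      have := abs_sub (y + κ * t) (κ * (t - s))
      rwa [show y + κ * t - κ * (t - s) = y + κ * s by ring] at this
    linarith
  have hqs : Measurable fun p : ℝ × ℝ => ‖q (p.2, p.1 + κ * p.2)‖ₑ * w (p.1 + κ * p.2) :=
    (hq.comp (by fun_prop)).enorm.mul (hwm.comp (by fun_prop))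
  calc ∫⁻ x, ‖d t x‖ₑ * w x = ∫⁻ y, ‖d t (y + κ * t)‖ₑ * w (y + κ * t) :=
        (lintegral_add_right_eq_self (fun x => ‖d t x‖ₑ * w x) (κ * t)).symm
    _ ≤ ∫⁻ y, ∫⁻ s in Ioc 0 t, ENNReal.ofReal (Real.exp (|κ| * T)) *
          (‖q (s, y + κ * s)‖ₑ * w (y + κ * s)) := by
        refine lintegral_mono_ae ?_
        filter_upwards [ae_eq_integral_char hd hD hDb hdD hq hqb hw ht] with y hy
        rw [hy, intervalIntegral.integral_of_le ht]
        refine (mul_le_mul_left (enorm_integral_le_lintegral_enorm _) _).trans ?_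
        rw [← lintegral_mul_const' _ _ ENNReal.ofReal_ne_top]
        refine setLIntegral_mono' measurableSet_Ioc fun s hs => ?_
        rw [mul_left_comm]
        exact mul_le_mul_right (hwle y s hs) _
    _ = ENNReal.ofReal (Real.exp (|κ| * T)) *
          ∫⁻ y, ∫⁻ s in Ioc 0 t, ‖q (s, y + κ * s)‖ₑ * w (y + κ * s) := by
        rw [← lintegral_const_mul' _ _ ENNReal.ofReal_ne_top]
        refine lintegral_congr fun y => ?_
        rw [lintegral_const_mul' _ _ ENNReal.ofReal_ne_top]
    _ = _ := by
        rw [lintegral_lintegral_swap hqs.aemeasurable]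
        congr 1
        refine lintegral_congr fun s => ?_
        exact lintegral_add_right_eq_self (fun x => ‖q (s, x)‖ₑ * w x) (κ * s)

end WeakTransport

/-! ### Uniqueness -/

/-- Grönwall's inequality for a bounded function, in homogeneous form. -/
theorem eq_zero_of_le_lintegral {E : ℝ → ℝ≥0∞} {C M : ℝ≥0} {T : ℝ} (hM : ∀ t ∈ Icc 0 T, E t ≤ M)
    (h : ∀ t ∈ Icc 0 T, E t ≤ C * ∫⁻ s in Ioc 0 t, E s) {t : ℝ} (ht : t ∈ Icc 0 T) : E t = 0 := by
  set l : ℝ := 2 * C + 1 with hl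
  have hl0 : 0 < l := by positivity
  -- Each use of the integral inequality halves the bound in the norm weighted by `exp (l t)`, since
  -- `C / l ≤ 1/2`. Measurability of `E` is not needed.
  have key : ∀ n : ℕ, ∀ t ∈ Icc 0 T, E t ≤ ENNReal.ofReal (M * (1 / 2) ^ n * Real.exp (l * t)) := by
    intro n
    induction n with
    | zero =>
      intro t ht
      refine (hM t ht).trans ?_
      rw [pow_zero, mul_one, ← ENNReal.ofReal_coe_nnreal]
      refine ENNReal.ofReal_le_ofReal ?_
      have : 1 ≤ Real.exp (l * t) := Real.one_le_exp (mul_nonneg hl0.le ht.1)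
      nlinarith [M.coe_nonneg]
    | succ n ih =>
      intro t ht
      refine (h t ht).trans ?_
      have h1 : ∫⁻ s in Ioc 0 t, E s ≤
          ∫⁻ s in Ioc 0 t, ENNReal.ofReal (M * (1 / 2) ^ n * Real.exp (l * s)) :=
        setLIntegral_mono' measurableSet_Ioc fun s hs => ih s ⟨hs.1.le, hs.2.trans ht.2⟩
      have hc : Continuous fun s => (M : ℝ) * (1 / 2) ^ n * Real.exp (l * s) := by fun_prop
      have h2 : ∫ s in (0 : ℝ)..t, (M : ℝ) * (1 / 2) ^ n * Real.exp (l * s) =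
          M * (1 / 2) ^ n * ((Real.exp (l * t) - 1) / l) := by
        rw [intervalIntegral.integral_const_mul, intervalIntegral.integral_comp_mul_left _ hl0.ne']
        simp only [mul_zero, Real.exp_zero, smul_eq_mul, integral_exp]
        ring
      rw [← ofReal_integral_eq_lintegral_ofReal
        (hc.integrableOn_Icc.mono_set Ioc_subset_Icc_self)
        (Eventually.of_forall fun s => by positivity),
        ← intervalIntegral.integral_of_le ht.1, h2] at h1
      refine (mul_le_mul_right h1 _).trans ?_
      rw [← ENNReal.ofReal_coe_nnreal, ← ENNReal.ofReal_mul C.coe_nonneg]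
      refine ENNReal.ofReal_le_ofReal ?_
      have h3 : (C : ℝ) * ((Real.exp (l * t) - 1) / l) ≤ 1 / 2 * Real.exp (l * t) := by
        rw [← mul_div_assoc, div_le_iff₀ hl0, hl]
        nlinarith [C.coe_nonneg, Real.exp_pos ((2 * (C : ℝ) + 1) * t)]
      calc (C : ℝ) * (M * (1 / 2) ^ n * ((Real.exp (l * t) - 1) / l))
          = M * (1 / 2) ^ n * (C * ((Real.exp (l * t) - 1) / l)) := by ring
        _ ≤ M * (1 / 2) ^ n * (1 / 2 * Real.exp (l * t)) := by gcongr
        _ = _ := by rw [pow_succ]; ring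
  have hlim : Tendsto (fun n : ℕ => ENNReal.ofReal (M * (1 / 2) ^ n * Real.exp (l * t))) atTop (𝓝 0) := by
    have h1 : Tendsto (fun n : ℕ => (M : ℝ) * (1 / 2) ^ n * Real.exp (l * t)) atTop (𝓝 0) := by
      have := ((tendsto_pow_atTop_nhds_zero_of_lt_one (by norm_num : (0 : ℝ) ≤ 1 / 2)
        (by norm_num)).const_mul (M : ℝ)).mul_const (Real.exp (l * t))
      simpa using this
    have := ENNReal.tendsto_ofReal h1
    rwa [ENNReal.ofReal_zero] at this
  exact le_antisymm (ge_of_tendsto' hlim fun n => key n t ht) zero_le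

end

end RelaxationAP

namespace RelaxationAP

noncomputable section

theorem lintegral_exp_neg_abs_lt_top : ∫⁻ x : ℝ, ENNReal.ofReal (Real.exp (-|x|)) < ⊤ := by
  have h : Integrable fun x : ℝ => Real.exp (-|x|) := by
    rw [← integrableOn_univ, ← Iic_union_Ioi (a := (0 : ℝ))]
    refine IntegrableOn.union ?_ ?_
    · refine (integrableOn_exp_Iic 0).congr_fun (fun x hx => ?_) measurableSet_Iic
      simp only [abs_of_nonpos (mem_Iic.1 hx), neg_neg]
    · refine (exp_neg_integrableOn_Ioi 0 one_pos).congr_fun (fun x hx => ?_) measurableSet_Ioi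
      simp only [abs_of_pos (mem_Ioi.1 hx), neg_one_mul]
  rw [← ofReal_integral_eq_lintegral_ofReal h (Eventually.of_forall fun _ => (Real.exp_pos _).le)]
  exact ENNReal.ofReal_lt_top

theorem IsRelaxationTerm.abs_sub_le {R : ℝ → ℝ → ℝ} {A g h β₀ : ℝ → ℝ}
    (hR : IsRelaxationTerm R A g h β₀) {K : ℝ} (hK : 0 ≤ K) {u u' : ℝ} (hu : |u| ≤ K) (hu' : |u'| ≤ K)
    (v v' : ℝ) : |R u v - R u' v'| ≤ g K * |u - u'| + h K * |v - v'| := by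
  have h1 := hR.abs_sub_fst_le hK (abs_le.1 hu) (abs_le.1 hu') v
  have h2 := hR.abs_sub_snd_le hK (abs_le.1 hu') v v'
  calc |R u v - R u' v'| = |(R u v - R u' v) + (R u' v - R u' v')| := by ring_nf
    _ ≤ _ := (abs_add_le _ _).trans (add_le_add h1 h2)

theorem IsRelaxationTerm.boundedOnStrips {R : ℝ → ℝ → ℝ} {A g h β₀ : ℝ → ℝ}
    (hR : IsRelaxationTerm R A g h β₀) {U V : ℝ × ℝ → ℝ} (hU : BoundedOnStrips U)
    (hV : BoundedOnStrips V) : BoundedOnStrips fun z => R (U z) (V z) := fun T => by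
  obtain ⟨K, hK⟩ := hU T
  obtain ⟨K', hK'⟩ := hV T
  refine ⟨g |K| * |K| + h |K| * |K'|, fun t ht x => ?_⟩
  have h0 : R 0 0 = 0 := (hR.equilibrium 0 0).2 hR.map_zero.symm
  have hg : 0 ≤ g |K| := (abs_nonneg _).trans
    (hR.deriv_u |K| (abs_nonneg _) 0 ⟨by simp, abs_nonneg _⟩ 0)
  have hh : 0 ≤ h |K| := by
    have := hR.deriv_v |K| (abs_nonneg _) 0 ⟨by simp, abs_nonneg _⟩ 0
    exact (hR.pos |K| (abs_nonneg _)).le.trans (this.1.trans this.2)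
  have h1 := hR.abs_sub_le (abs_nonneg K) ((hK t ht x).trans (le_abs_self K))
    (by simp : |(0 : ℝ)| ≤ |K|) (V (t, x)) 0
  rw [h0, sub_zero, sub_zero, sub_zero] at h1
  exact h1.trans (add_le_add
    (mul_le_mul_of_nonneg_left ((hK t ht x).trans (le_abs_self K)) hg)
    (mul_le_mul_of_nonneg_left ((hK' t ht x).trans (le_abs_self K')) hh))

theorem BoundedOnStrips.add {F G : ℝ × ℝ → ℝ} (hF : BoundedOnStrips F) (hG : BoundedOnStrips G) :
    BoundedOnStrips fun z => F z + G z := fun T => by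
  obtain ⟨K, hK⟩ := hF T
  obtain ⟨K', hK'⟩ := hG T
  exact ⟨K + K', fun t ht x => (abs_add_le _ _).trans (add_le_add (hK t ht x) (hK' t ht x))⟩

theorem BoundedOnStrips.const_mul {F : ℝ × ℝ → ℝ} (hF : BoundedOnStrips F) (r : ℝ) :
    BoundedOnStrips fun z => r * F z := fun T => by
  obtain ⟨K, hK⟩ := hF T
  refine ⟨|r| * K, fun t ht x => ?_⟩
  rw [abs_mul]
  exact mul_le_mul_of_nonneg_left (hK t ht x) (abs_nonneg r)

/-- The weak formulation in characteristic variables, for bounded measurable representatives. -/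
theorem IsWeakSolution.characteristic {R : ℝ → ℝ → ℝ} {A g h β₀ : ℝ → ℝ}
    (hR : IsRelaxationTerm R A g h β₀) {a ε : ℝ} (ha : 0 < a) {u₀ v₀ : ℝ → ℝ} {u v : ℝ → ℝ → ℝ}
    (hs : IsWeakSolution R a ε u₀ v₀ u v) {U V : ℝ × ℝ → ℝ} (hU : Measurable U) (hV : Measurable V)
    (hUb : BoundedOnStrips U) (hVb : BoundedOnStrips V)
    (hUu : ∀ᵐ z ∂volume.restrict (Ici (0 : ℝ) ×ˢ (univ : Set ℝ)), u z.1 z.2 = U z)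
    (hVv : ∀ᵐ z ∂volume.restrict (Ici (0 : ℝ) ×ˢ (univ : Set ℝ)), v z.1 z.2 = V z) {κ : ℝ}
    (hκ : κ * κ = a) {φ : ℝ × ℝ → ℝ} (hφ : ContDiff ℝ ∞ φ) (hφs : HasCompactSupport φ) :
    IntegrableOn (fun z => (U z + 1 / κ * V z) * charDeriv κ φ z
      - 1 / (κ * ε) * R (U z) (V z) * φ z) (Ioi (0 : ℝ) ×ˢ (univ : Set ℝ)) ∧
    (∫ z in Ioi (0 : ℝ) ×ˢ (univ : Set ℝ), ((U z + 1 / κ * V z) * charDeriv κ φ z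
      - 1 / (κ * ε) * R (U z) (V z) * φ z)) =
      -(∫ x, u₀ x * φ (0, x)) - 1 / κ * ∫ x, v₀ x * φ (0, x) := by
  have hκ0 : κ ≠ 0 := by rintro rfl; simp at hκ; exact ha.ne hκ
  have hRc : Measurable fun z => R (U z) (V z) := hR.contDiff.continuous.measurable.comp (hU.prodMk hV)
  have hRb := hR.boundedOnStrips hUb hVb
  have hle : volume.restrict (Ioi (0 : ℝ) ×ˢ (univ : Set ℝ)) ≤
      volume.restrict (Ici (0 : ℝ) ×ˢ (univ : Set ℝ)) :=
    Measure.restrict_mono (Set.prod_mono Ioi_subset_Ici_self le_rfl) le_rfl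
  have hUu := ae_mono hle hUu
  have hVv := ae_mono hle hVv
  have hd : ∀ w : ℝ × ℝ, Continuous (fun z => fderiv ℝ φ z w) ∧
      HasCompactSupport fun z => fderiv ℝ φ z w := fun w =>
    ⟨((hφ.fderiv_right (m := 0) (by simp)).clm_apply contDiff_const).continuous,
      hφs.fderiv_apply (𝕜 := ℝ) _⟩
  have i1 : ∀ w, IntegrableOn (fun z => U z * fderiv ℝ φ z w) (Ioi (0 : ℝ) ×ˢ (univ : Set ℝ)) :=
    fun w => hUb.integrableOn_mul hU (hd w).1 (hd w).2
  have i2 : ∀ w, IntegrableOn (fun z => V z * fderiv ℝ φ z w) (Ioi (0 : ℝ) ×ˢ (univ : Set ℝ)) :=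
    fun w => hVb.integrableOn_mul hV (hd w).1 (hd w).2
  have i3 := hRb.integrableOn_mul hRc hφ.continuous hφs
  have eu := hs.eq_u φ hφ hφs
  have ev := hs.eq_v φ hφ hφs
  have cu : ∫ z in Ioi (0 : ℝ) ×ˢ (univ : Set ℝ),
        (u z.1 z.2 * fderiv ℝ φ z (1, 0) + v z.1 z.2 * fderiv ℝ φ z (0, 1)) =
      ∫ z in Ioi (0 : ℝ) ×ˢ (univ : Set ℝ),
        (U z * fderiv ℝ φ z (1, 0) + V z * fderiv ℝ φ z (0, 1)) := by
    refine integral_congr_ae ?_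
    filter_upwards [hUu, hVv] with z h1 h2
    rw [h1, h2]
  have cv : ∫ z in Ioi (0 : ℝ) ×ˢ (univ : Set ℝ),
        (v z.1 z.2 * fderiv ℝ φ z (1, 0) + a * u z.1 z.2 * fderiv ℝ φ z (0, 1)
          - 1 / ε * R (u z.1 z.2) (v z.1 z.2) * φ z) =
      ∫ z in Ioi (0 : ℝ) ×ˢ (univ : Set ℝ),
        (V z * fderiv ℝ φ z (1, 0) + a * (U z * fderiv ℝ φ z (0, 1))
          - 1 / ε * (R (U z) (V z) * φ z)) := by
    refine integral_congr_ae ?_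
    filter_upwards [hUu, hVv] with z h1 h2
    rw [h1, h2]; ring
  rw [cu] at eu
  rw [cv] at ev
  have j1 := (i1 (1, 0)).add (i2 (0, 1))
  have j2 := ((i2 (1, 0)).add ((i1 (0, 1)).const_mul a)).sub (i3.const_mul (1 / ε))
  -- The first equation plus `1 / κ` times the second; `κ * κ = a` assembles the derivatives along
  -- `(1, κ)`.
  have e : (fun z => (U z + 1 / κ * V z) * charDeriv κ φ z - 1 / (κ * ε) * R (U z) (V z) * φ z) =
      fun z => (U z * fderiv ℝ φ z (1, 0) + V z * fderiv ℝ φ z (0, 1)) + 1 / κ *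
        (V z * fderiv ℝ φ z (1, 0) + a * (U z * fderiv ℝ φ z (0, 1))
          - 1 / ε * (R (U z) (V z) * φ z)) := by
    funext z
    have e1 : 1 / (κ * ε) = 1 / κ * (1 / ε) := by rw [one_div_mul_one_div]
    have e2 : 1 / κ * a = κ := by rw [← hκ]; field_simp
    have e3 : 1 / κ * κ = 1 := by field_simp
    rw [charDeriv, e1]
    linear_combination (V z * fderiv ℝ φ z (0, 1)) * e3 - (U z * fderiv ℝ φ z (0, 1)) * e2
  rw [e]
  refine ⟨j1.add (j2.const_mul (1 / κ)), ?_⟩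
  refine (integral_add j1 (j2.const_mul (1 / κ))).trans ?_
  rw [integral_const_mul]
  refine Eq.trans (congrArg₂ (fun x y => x + 1 / κ * y) (eq_neg_of_add_eq_zero_left eu)
    (eq_neg_of_add_eq_zero_left ev)) ?_
  ring

/-- Weak solutions are unique. -/
theorem IsWeakSolution.unique {R : ℝ → ℝ → ℝ} {A g h β₀ : ℝ → ℝ}
    (hR : IsRelaxationTerm R A g h β₀) {a ε : ℝ} (ha : 0 < a) {u₀ v₀ : ℝ → ℝ}
    {u v u' v' : ℝ → ℝ → ℝ} (hs : IsWeakSolution R a ε u₀ v₀ u v)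
    (hs' : IsWeakSolution R a ε u₀ v₀ u' v') {t : ℝ} (ht : 0 ≤ t) :
    ∀ᵐ x, u t x = u' t x ∧ v t x = v' t x := by
  obtain ⟨U, hU, hUb, hUu, hUt⟩ := hs.curve_u.exists_representative
  obtain ⟨V, hV, hVb, hVv, hVt⟩ := hs.curve_v.exists_representative
  obtain ⟨U', hU', hUb', hUu', hUt'⟩ := hs'.curve_u.exists_representative
  obtain ⟨V', hV', hVb', hVv', hVt'⟩ := hs'.curve_v.exists_representative
  -- the difference in the characteristic variable of speed `κ`
  set d : ℝ → ℝ → ℝ → ℝ := fun κ t x => u t x + -1 * u' t x + 1 / κ * (v t x + -1 * v' t x) with hd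
  set D : ℝ → ℝ × ℝ → ℝ := fun κ z => U z + -1 * U' z + 1 / κ * (V z + -1 * V' z) with hD
  set q : ℝ → ℝ × ℝ → ℝ := fun κ z => -1 / (κ * ε) * (R (U z) (V z) + -1 * R (U' z) (V' z)) with hq
  have hRm : ∀ {F G : ℝ × ℝ → ℝ}, Measurable F → Measurable G → Measurable fun z => R (F z) (G z) :=
    fun hF hG => hR.contDiff.continuous.measurable.comp (hF.prodMk hG)
  have hdc : ∀ κ, IsBoundedCurve (d κ) := fun κ => (hs.curve_u.add (hs'.curve_u.const_mul (-1))).add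
    ((hs.curve_v.add (hs'.curve_v.const_mul (-1))).const_mul (1 / κ))
  have hDm : ∀ κ, Measurable (D κ) := fun κ => by simp only [hD]; fun_prop
  have hDb : ∀ κ, BoundedOnStrips (D κ) := fun κ =>
    (hUb.add (hUb'.const_mul (-1))).add ((hVb.add (hVb'.const_mul (-1))).const_mul (1 / κ))
  have hdD : ∀ᵐ t ∂volume.restrict (Ici (0 : ℝ)), ∀ᵐ x, ∀ κ, d κ t x = D κ (t, x) := by
    filter_upwards [hUt, hVt, hUt', hVt'] with t h1 h2 h3 h4
    filter_upwards [h1, h2, h3, h4] with x k1 k2 k3 k4 κ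
    simp only [hd, hD]
    rw [k1, k2, k3, k4]
  have hqm : ∀ κ, Measurable (q κ) := fun κ =>
    ((hRm hU hV).add ((hRm hU' hV').const_mul (-1))).const_mul _
  have hqb : ∀ κ, BoundedOnStrips (q κ) := fun κ => ((hR.boundedOnStrips hUb hVb).add
    ((hR.boundedOnStrips hUb' hVb').const_mul (-1))).const_mul _
  have hw : ∀ κ, κ * κ = a → ∀ φ : ℝ × ℝ → ℝ, ContDiff ℝ ∞ φ → HasCompactSupport φ →
      ∫ z in Ioi (0 : ℝ) ×ˢ (univ : Set ℝ), (D κ z * charDeriv κ φ z + q κ z * φ z) = 0 := by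
    intro κ hκ φ hφ hφs
    obtain ⟨i1, e1⟩ := hs.characteristic hR ha hU hV hUb hVb hUu hVv hκ hφ hφs
    obtain ⟨i2, e2⟩ := hs'.characteristic hR ha hU' hV' hUb' hVb' hUu' hVv' hκ hφ hφs
    have key := integral_sub i1 i2
    rw [e1, e2, sub_self] at key
    refine Eq.trans ?_ key
    refine integral_congr_ae (μ := volume.restrict (Ioi (0 : ℝ) ×ˢ (univ : Set ℝ)))
      (Eventually.of_forall fun z => ?_)
    simp only [hD, hq]
    ring
  set c := √a with hc
  have hc0 : 0 < c := Real.sqrt_pos.2 ha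
  have hcc : c * c = a := Real.mul_self_sqrt ha.le
  have hcc' : -c * -c = a := by rw [neg_mul_neg, hcc]
  set w : ℝ → ℝ≥0∞ := fun x => ENNReal.ofReal (Real.exp (-|x|)) with hwdef
  have hwm : Measurable w := by rw [hwdef]; fun_prop
  set E : ℝ → ℝ≥0∞ := fun t => ∫⁻ x, (‖d c t x‖ₑ + ‖d (-c) t x‖ₑ) * w x with hE
  have hEadd : ∀ t, 0 ≤ t → E t = (∫⁻ x, ‖d c t x‖ₑ * w x) + ∫⁻ x, ‖d (-c) t x‖ₑ * w x :=
    fun t ht => by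
      simp only [hE, add_mul]
      exact lintegral_add_left' ((((hdc c).aestronglyMeasurable_slice t ht).enorm).mul
        hwm.aemeasurable) _
  -- the source is controlled by the differences
  obtain ⟨C, hC⟩ : ∃ C : ℝ≥0, ∀ s ∈ Icc 0 t, ∀ x, ∀ κ, κ = c ∨ κ = -c →
      ‖q κ (s, x)‖ₑ ≤ C * (‖D c (s, x)‖ₑ + ‖D (-c) (s, x)‖ₑ) := by
    obtain ⟨K, hK⟩ := hUb t
    obtain ⟨K', hK'⟩ := hUb' t
    -- Only the bounds on `U` and `U'` matter: the Lipschitz constants of `R` on a strip in `u` do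
    -- not depend on `v`.
    set L := max |K| |K'| with hL
    have hL0 : 0 ≤ L := le_max_of_le_left (abs_nonneg _)
    refine ⟨(|1 / (c * ε)| * (|g L| + |h L| * c)).toNNReal, fun s hs x κ hκ => ?_⟩
    have h1 := hR.abs_sub_le hL0 ((hK s hs x).trans ((le_abs_self K).trans (le_max_left _ _)))
      ((hK' s hs x).trans ((le_abs_self K').trans (le_max_right _ _))) (V (s, x)) (V' (s, x))
    have hDu : |U (s, x) - U' (s, x)| ≤ |D c (s, x)| + |D (-c) (s, x)| := by
      have e : U (s, x) - U' (s, x) = (D c (s, x) + D (-c) (s, x)) / 2 := by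
        simp only [hD, one_div, inv_neg]; ring
      rw [e, abs_div, abs_two]
      linarith [abs_add_le (D c (s, x)) (D (-c) (s, x)), abs_nonneg (D c (s, x) + D (-c) (s, x))]
    have hDv : |V (s, x) - V' (s, x)| ≤ c * (|D c (s, x)| + |D (-c) (s, x)|) := by
      have e : V (s, x) - V' (s, x) = c * ((D c (s, x) - D (-c) (s, x)) / 2) := by
        simp only [hD, one_div, inv_neg]; field_simp; ring
      rw [e, abs_mul, abs_of_pos hc0, abs_div, abs_two]
      refine mul_le_mul_of_nonneg_left ?_ hc0.le
      linarith [abs_sub (D c (s, x)) (D (-c) (s, x)), abs_nonneg (D c (s, x) - D (-c) (s, x))]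
    have hqκ : |q κ (s, x)| = |1 / (c * ε)| * |R (U (s, x)) (V (s, x)) - R (U' (s, x)) (V' (s, x))| := by
      simp only [hq]
      rw [abs_mul, neg_one_mul, ← sub_eq_add_neg, neg_div, abs_neg]
      rcases hκ with rfl | rfl
      · rfl
      · rw [neg_mul, div_neg, abs_neg]
    have h2 : |q κ (s, x)| ≤ |1 / (c * ε)| * (|g L| + |h L| * c) *
        (|D c (s, x)| + |D (-c) (s, x)|) := by
      rw [hqκ, mul_assoc]
      refine mul_le_mul_of_nonneg_left (h1.trans ?_) (abs_nonneg _)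
      have h3 := mul_le_mul (le_abs_self (g L)) hDu (abs_nonneg _) (abs_nonneg _)
      have h4 := mul_le_mul (le_abs_self (h L)) hDv (abs_nonneg _) (abs_nonneg _)
      linarith
    rw [← ofReal_norm, ← ofReal_norm, ← ofReal_norm, ← ENNReal.ofReal_coe_nnreal,
      Real.coe_toNNReal _ (by positivity), ← ENNReal.ofReal_add (norm_nonneg _) (norm_nonneg _),
      ← ENNReal.ofReal_mul (by positivity)]
    exact ENNReal.ofReal_le_ofReal h2
  -- Grönwall
  have hgron : ∀ s ∈ Icc 0 t, E s ≤
      ((2 * Real.exp (c * t)).toNNReal * C : ℝ≥0) * ∫⁻ r in Ioc 0 s, E r := by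
    intro s hs
    have hsrc : ∀ κ, κ = c ∨ κ = -c → ∫⁻ r in Ioc 0 s, ∫⁻ x, ‖q κ (r, x)‖ₑ * w x ≤
        C * ∫⁻ r in Ioc 0 s, E r := fun κ hκ => by
      rw [← lintegral_const_mul' _ _ ENNReal.coe_ne_top]
      refine lintegral_mono_ae ?_
      have h1 : ∀ᵐ r ∂volume.restrict (Ioc 0 s), ∀ᵐ x, ∀ κ, d κ r x = D κ (r, x) :=
        ae_mono (Measure.restrict_mono (Ioc_subset_Icc_self.trans Icc_subset_Ici_self) le_rfl) hdD
      filter_upwards [h1, ae_restrict_mem measurableSet_Ioc] with r h2 hr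
      simp only [hE]
      rw [← lintegral_const_mul' _ _ ENNReal.coe_ne_top]
      refine lintegral_mono_ae ?_
      filter_upwards [h2] with x hx
      rw [hx, hx, ← mul_assoc]
      exact mul_le_mul_left (hC r ⟨hr.1.le, hr.2.trans hs.2⟩ x κ hκ) _
    have hk : ∀ κ, κ = c ∨ κ = -c → κ * κ = a → ∫⁻ x, ‖d κ s x‖ₑ * w x ≤
        ENNReal.ofReal (Real.exp (c * t)) * (C * ∫⁻ r in Ioc 0 s, E r) := fun κ hκ hκa => by
      have h1 := lintegral_weighted_le (hdc κ) (hDm κ) (hDb κ)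
        (hdD.mono fun t h => h.mono fun x h => h κ) (hqm κ) (hqb κ) (hw κ hκa) hs.1 hs.2
      have h2 : |κ| = c := by
        rcases hκ with rfl | rfl
        · exact abs_of_pos hc0
        · rw [abs_neg, abs_of_pos hc0]
      rw [h2] at h1
      exact h1.trans (mul_le_mul_right (hsrc κ hκ) _)
    rw [hEadd s hs.1]
    refine (add_le_add (hk c (Or.inl rfl) hcc) (hk (-c) (Or.inr rfl) hcc')).trans (le_of_eq ?_)
    rw [ENNReal.coe_mul, ← two_mul, ← mul_assoc, ← mul_assoc]
    congr 2
    rw [Real.toNNReal_mul zero_le_two, ENNReal.coe_mul]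
    congr 1
    simp
  -- Finiteness of the weighted norm is what the homogeneous Grönwall argument starts from.
  obtain ⟨M, hM⟩ : ∃ M : ℝ≥0, ∀ s ∈ Icc 0 t, E s ≤ M := by
    obtain ⟨K, hK⟩ := (hdc c).bounded t
    obtain ⟨K', hK'⟩ := (hdc (-c)).bounded t
    have hfin : (ENNReal.ofReal K + ENNReal.ofReal K') * ∫⁻ x, w x ≠ ⊤ :=
      ENNReal.mul_ne_top (by simp) lintegral_exp_neg_abs_lt_top.ne
    refine ⟨((ENNReal.ofReal K + ENNReal.ofReal K') * ∫⁻ x, w x).toNNReal, fun s hs => ?_⟩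
    rw [ENNReal.coe_toNNReal hfin, ← lintegral_const_mul _ hwm]
    refine lintegral_mono_ae ?_
    filter_upwards [hK s hs, hK' s hs] with x h1 h2
    refine mul_le_mul_left (add_le_add ?_ ?_) _
    · rw [← ofReal_norm]; exact ENNReal.ofReal_le_ofReal h1
    · rw [← ofReal_norm]; exact ENNReal.ofReal_le_ofReal h2
  have hE0 : E t = 0 := eq_zero_of_le_lintegral hM hgron ⟨ht, le_rfl⟩
  rw [hE] at hE0
  have hmeas : AEMeasurable (fun x => (‖d c t x‖ₑ + ‖d (-c) t x‖ₑ) * w x) :=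
    (((hdc c).aestronglyMeasurable_slice t ht).enorm.add
      ((hdc (-c)).aestronglyMeasurable_slice t ht).enorm).mul hwm.aemeasurable
  filter_upwards [(lintegral_eq_zero_iff' hmeas).1 hE0] with x hx
  have hwx : w x ≠ 0 := (ENNReal.ofReal_pos.2 (Real.exp_pos _)).ne'
  have h1 := add_eq_zero.1 ((mul_eq_zero.1 hx).resolve_right hwx)
  have h2 := enorm_eq_zero.1 h1.1
  have h3 := enorm_eq_zero.1 h1.2
  simp only [hd, one_div, inv_neg] at h2 h3
  have h4 : u t x - u' t x = 0 := by linarith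
  have h5 : c⁻¹ * (v t x - v' t x) = 0 := by linarith
  exact ⟨sub_eq_zero.1 h4, sub_eq_zero.1 ((mul_eq_zero.1 h5).resolve_left (inv_ne_zero hc0.ne'))⟩

end

end RelaxationAP

namespace RelaxationAP

noncomputable section

/-! ### The relaxation system -/

theorem IsDatum.nonneg {N : ℝ} {B : ℝ≥0} {f : ℝ → ℝ} (hf : IsDatum N B f) : 0 ≤ N := by
  obtain ⟨x, hx⟩ := hf.bounded.exists
  exact (abs_nonneg _).trans hx

theorem boundU_le_boundV (A : ℝ → ℝ) (N a₀ : ℝ) : boundU N a₀ ≤ boundV A N a₀ := by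
  have hF : 0 ≤ boundF A N a₀ := Real.sSup_nonneg (by rintro _ ⟨ξ, -, rfl⟩; exact abs_nonneg _)
  unfold boundV
  have : 0 ≤ 1 / √a₀ * boundF A N a₀ := by positivity
  linarith

section Bounds

variable {N a₀ : ℝ} (hN : 0 ≤ N)
include hN

theorem boundU_nonneg : 0 ≤ boundU N a₀ := by unfold boundU; positivity

theorem le_boundU : N ≤ boundU N a₀ := by
  unfold boundU
  have : 0 ≤ 1 / √a₀ * N := by positivity
  linarith

/-- Since `U - N = N / √a₀`, the right-hand side is `(√a / √a₀) N`. This is the condition under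
which the constant states `(±U, 0)` enclose the data. -/
theorem le_mul_boundU_sub {a : ℝ} (ha₀ : 0 < a₀) (ha : √a₀ < √a) : N ≤ √a * (boundU N a₀ - N) := by
  have h0 : 0 < √a₀ := Real.sqrt_pos.2 ha₀
  have e : √a * (boundU N a₀ - N) = √a / √a₀ * N := by unfold boundU; field_simp; ring
  rw [e]
  have := (one_le_div h0).2 ha.le
  nlinarith

end Bounds

theorem aestronglyMeasurable_piecewiseConst {Δt Δx : ℝ} (hΔt : 0 < Δt) (hΔx : 0 < Δx) (ξ : ℝ)
    (k : ℕ → ℤ → ℝ) {t : ℝ} (ht : 0 ≤ t) : AEStronglyMeasurable (piecewiseConst ξ Δt Δx k t) := by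
  refine (measurable_gridFn ξ Δx (k ⌊t / Δt⌋₊)).aestronglyMeasurable.congr
    (piecewiseConst_ae_eq hΔt hΔx ξ k _ ?_ ?_).symm
  · rw [← le_div_iff₀ hΔt]; exact Nat.floor_le (div_nonneg ht hΔt.le)
  · rw [← div_lt_iff₀ hΔt]; exact Nat.lt_floor_add_one _

/-! ### Existence, error estimate and convergence for the original system. -/

section Main

variable {R : ℝ → ℝ → ℝ} {A g h β₀ : ℝ → ℝ} (hR : IsRelaxationTerm R A g h β₀) {N U V a : ℝ} {B : ℝ≥0}
  (ha : 0 < a) (hU : 0 ≤ U) (hNU : N ≤ U) (hUV : U ≤ V) (hN : N ≤ √a * (U - N))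
  (hr : IsGlobalTerm (fun u v => R (clip V u) v) (fun u => A (clip V u)) √a (β₀ V) (h V))
include ha hU hUV hN

/-- The flow of the clipped system respects `|u| ≤ U ≤ V`, where the clipped and original sources
coincide, so it solves the original problem. -/
theorem exists_flow {ε : ℝ} (hε : 0 < ε) {u₀ v₀ : ℝ → ℝ} (hu : IsDatum N B u₀) (hv : IsDatum N B v₀) :
    ∃ f : ℝ → State, f 0 = ofUV √a hu.integrable hv.integrable ∧
      IsMildCurve (pairShift √a (-√a)) (relaxSource hr hε) f ∧
      ∃ u v : ℝ → ℝ → ℝ, IsWeakSolution R a ε u₀ v₀ u v ∧ ∀ t, 0 ≤ t → ∀ᵐ x,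
        u t x = uOf (pairShift √a (-√a) t (f t)) x ∧
        v t x = vOf √a (pairShift √a (-√a) t (f t)) x := by
  have hc := hr.c_pos
  obtain ⟨f, hf0, hfc, hf⟩ := exists_isMildCurve (isIsometryGroup_pairShift √a (-√a))
    (lipschitz_relaxSource hr hε) (relaxSource_zero hr hε) (ofUV √a hu.integrable hv.integrable)
  refine ⟨f, hf0, hf, exists_isWeakSolution (U := U) (K := 2 * √a * U + 2 * |A (clip V U)|) ha hr hε hU
    (by positivity) (fun u v hu => ?_) hfc hf (by rw [hf0]; exact transLip_ofUV hc hu hv)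
    (fun t ht => flow_bounds ha hr hN hu hv hε hf hf0 ht) ?_⟩
  · simp only [clip_eq (hu.trans hUV)]
  · rw [hf0]; exact ofUV_coe hc.ne' hu.integrable hv.integrable

include hR hNU hr

/-- The error estimate. -/
theorem exists_error_bound (T M : ℝ) : ∃ C : ℝ, ∀ ε : ℝ, 0 < ε → ε ≤ M → ∀ u₀ v₀ : ℝ → ℝ,
    IsDatum N B u₀ → IsDatum N B v₀ → ∀ u v : ℝ → ℝ → ℝ, IsWeakSolution R a ε u₀ v₀ u v →
    ∀ ξ Δt Δx : ℝ, CFL a Δt Δx → Δx ≤ M → ∀ t ∈ Icc 0 T,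
      eLpNorm (fun x => numU R A a (h V) ε ξ Δt Δx u₀ v₀ t x - u t x) 1 volume
        + eLpNorm (fun x => numV R A a (h V) ε ξ Δt Δx u₀ v₀ t x - v t x) 1 volume
      ≤ ENNReal.ofReal (C / ε * (Δt * ((∫ x, |v₀ x - A (u₀ x)|) / ε + 1) + √Δx)) := by
  have hc := hr.c_pos
  obtain ⟨C, hC0, hC⟩ := exists_schemeStep_error hr T M ((1 + 1 / √a) * B)
  refine ⟨(1 + √a) * C, fun ε hε hεM u₀ v₀ hu hv u v hs ξ Δt Δx hcfl hΔxM t ht => ?_⟩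
  obtain ⟨hΔt, hΔx, hcfl'⟩ := id hcfl
  obtain ⟨f, hf0, hf, u', v', hs', hflow⟩ := exists_flow ha hU hUV hN hr hε hu hv
  obtain ⟨F₀, hF₀, hF₀'⟩ := exists_represents hc hu hv (ξ := ξ) hΔx
  set n := ⌊t / Δt⌋₊
  have hn1 : n * Δt ≤ t := by rw [← le_div_iff₀ hΔt]; exact Nat.floor_le (div_nonneg ht.1 hΔt.le)
  have hn2 : t < (n + 1) * Δt := by rw [← div_lt_iff₀ hΔt]; exact Nat.lt_floor_add_one _
  set Fn := (schemeStep hr (div_nonneg hΔt.le hε.le) Δx)^[n] F₀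
  set ft := pairShift √a (-√a) t (f t)
  have herr : ‖Fn - ft‖ ≤ C / ε * (Δt * ((∫ x, |v₀ x - A (u₀ x)|) / ε + 1) + √Δx) := by
    have h1 := hC ε hε hεM f hf (by rw [hf0]; exact transLip_ofUV hc hu hv) Δt Δx hΔt hΔx hcfl'
      hΔxM F₀ (by rw [hf0]; exact hF₀') n t ht.2 hn1 hn2.le
    rw [hf0, defect_ofUV hc hu hv] at h1
    have e : ∫ x, |v₀ x - A (clip V (u₀ x))| = ∫ x, |v₀ x - A (u₀ x)| := by
      refine integral_congr_ae ?_
      filter_upwards [hu.bounded] with x hx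
      rw [clip_eq (hx.trans (hNU.trans hUV))]
    rwa [e] at h1
  -- Uniqueness identifies the given weak solution with the flow, and `scheme_clip` identifies the
  -- scheme with its clipped version, so the estimate on states applies.
  have hnum : ∀ᵐ x, numU R A a (h V) ε ξ Δt Δx u₀ v₀ t x - u t x = uOf (Fn - ft) x ∧
      numV R A a (h V) ε ξ Δt Δx u₀ v₀ t x - v t x = vOf √a (Fn - ft) x := by
    filter_upwards [piecewiseConst_ae_eq hΔt hΔx ξ
        (fun n => (scheme R A a (h V) ε ξ Δt Δx u₀ v₀ n).1) n hn1 hn2,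
      piecewiseConst_ae_eq hΔt hΔx ξ
        (fun n => (scheme R A a (h V) ε ξ Δt Δx u₀ v₀ n).2) n hn1 hn2,
      hF₀.iterate ha hr (div_nonneg hΔt.le hε.le) hΔx n, hs.unique hR ha hs' ht.1,
      hflow t ht.1, uOf_sub √a Fn ft] with x h1 h2 h3 h4 h5 h6
    rw [numU, numV, h1, h2, scheme_clip ha hr hε hcfl hUV hN hu.bounded hv.bounded n, ← h3.1, ← h3.2,
      h4.1, h4.2, h5.1, h5.2, h6.1, h6.2]
    exact ⟨rfl, rfl⟩
  have hnorm : ∀ {w : ℝ → ℝ}, Integrable w → eLpNorm w 1 volume = ENNReal.ofReal (∫ x, |w x|) :=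
    fun {w} hw => by
      rw [eLpNorm_one_eq_lintegral_enorm, ← ofReal_integral_norm_eq_lintegral_enorm hw]
      rfl
  rw [eLpNorm_congr_ae (hnum.mono fun x hx => hx.1), eLpNorm_congr_ae (hnum.mono fun x hx => hx.2),
    hnorm (integrable_uOf _), hnorm (integrable_vOf _ _),
    ← ENNReal.ofReal_add (integral_nonneg fun _ => abs_nonneg _)
      (integral_nonneg fun _ => abs_nonneg _)]
  refine ENNReal.ofReal_le_ofReal ((integral_uv_le_norm hc _).trans ?_)
  rw [mul_div_assoc, mul_assoc]
  exact mul_le_mul_of_nonneg_left herr (by positivity)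

/-- Convergence of the scheme in `L¹_loc`. -/
theorem tendsto_scheme {ε : ℝ} (hε : 0 < ε) {u₀ v₀ : ℝ → ℝ} (hu : IsDatum N B u₀)
    (hv : IsDatum N B v₀) {u v : ℝ → ℝ → ℝ} (hs : IsWeakSolution R a ε u₀ v₀ u v) (ξ : ℝ × ℝ → ℝ)
    {K : Set (ℝ × ℝ)} (hK : IsCompact K) (hK0 : K ⊆ Ici 0 ×ˢ univ) :
    Tendsto (fun s : ℝ × ℝ => ∫⁻ p in K,
        (‖numU R A a (h V) ε (ξ s) s.1 s.2 u₀ v₀ p.1 p.2 - u p.1 p.2‖ₑ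
          + ‖numV R A a (h V) ε (ξ s) s.1 s.2 u₀ v₀ p.1 p.2 - v p.1 p.2‖ₑ))
      (𝓝[{s : ℝ × ℝ | CFL a s.1 s.2}] (0, 0)) (𝓝 0) := by
  obtain ⟨T, hT⟩ := hK.isBounded.subset_closedBall 0
  have hKT : K ⊆ Icc 0 T ×ˢ univ := fun p hp => by
    refine ⟨⟨(hK0 hp).1, ?_⟩, mem_univ _⟩
    have := hT hp
    rw [Metric.mem_closedBall, dist_zero_right] at this
    exact (le_abs_self _).trans ((norm_fst_le p).trans this)
  obtain ⟨C, hC⟩ := exists_error_bound (B := B) hR ha hU hNU hUV hN hr T (max ε 1)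
  have hlim : Tendsto (fun s : ℝ × ℝ => ENNReal.ofReal
      (C / ε * (s.1 * ((∫ x, |v₀ x - A (u₀ x)|) / ε + 1) + √s.2)) * volume (Icc 0 T))
      (𝓝[{s : ℝ × ℝ | CFL a s.1 s.2}] (0, 0)) (𝓝 0) := by
    have h1 : Continuous fun s : ℝ × ℝ => ENNReal.ofReal
        (C / ε * (s.1 * ((∫ x, |v₀ x - A (u₀ x)|) / ε + 1) + √s.2)) :=
      ENNReal.continuous_ofReal.comp (by fun_prop)
    have h2 := h1.tendsto (0, 0)
    simp only [zero_mul, Real.sqrt_zero, add_zero, mul_zero, ENNReal.ofReal_zero] at h2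
    have h3 := ENNReal.Tendsto.mul_const (b := volume (Icc 0 T)) h2 (Or.inr measure_Icc_lt_top.ne)
    rw [zero_mul] at h3
    exact h3.mono_left nhdsWithin_le_nhds
  refine tendsto_of_tendsto_of_tendsto_of_le_of_le' tendsto_const_nhds hlim
    (Eventually.of_forall fun _ => zero_le) ?_
  have hsmall : ∀ᶠ s : ℝ × ℝ in 𝓝[{s : ℝ × ℝ | CFL a s.1 s.2}] (0, 0), s.2 < 1 :=
    nhdsWithin_le_nhds ((isOpen_Iio.preimage continuous_snd).mem_nhds (by simp))
  filter_upwards [self_mem_nhdsWithin, hsmall] with s hcfl hs1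
  have hcfl : CFL a s.1 s.2 := hcfl
  refine (lintegral_mono_set hKT).trans ?_
  rw [Measure.volume_eq_prod, ← Measure.prod_restrict, Measure.restrict_univ]
  -- The slice estimate, uniform on `[0, T]`, is integrated in time; this inequality of iterated
  -- integrals requires no joint measurability.
  refine (lintegral_prod_le _).trans ?_
  rw [← setLIntegral_const]
  refine setLIntegral_mono' measurableSet_Icc fun t ht => ?_
  have := hC ε hε (le_max_left _ _) u₀ v₀ hu hv u v hs (ξ s) s.1 s.2 hcfl
    (hs1.le.trans (le_max_right _ _)) t ht
  rw [eLpNorm_one_eq_lintegral_enorm, eLpNorm_one_eq_lintegral_enorm, ← lintegral_add_left'] at this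
  · exact this
  · exact ((aestronglyMeasurable_piecewiseConst hcfl.1 hcfl.2.1 _ _ ht.1).sub
      (hs.curve_u.aestronglyMeasurable_slice t ht.1)).enorm

end Main

end

end RelaxationAP

theorem theorem2p2
    (R : ℝ → ℝ → ℝ) (A g h β₀ : ℝ → ℝ)
    (hR : RelaxationAP.IsRelaxationTerm R A g h β₀)
    (N₀ a₀ a β : ℝ) (B : ℝ≥0)
    (ha₀ : 0 < a₀)
    (ha : max √a₀ (g (RelaxationAP.boundV A N₀ a₀) / β₀ (RelaxationAP.boundV A N₀ a₀)) < √a)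
    (hβ : β = h (RelaxationAP.boundV A N₀ a₀)) :
    -- the relaxation Cauchy problem has a weak solution
    (∀ ε : ℝ, 0 < ε → ∀ u₀ v₀ : ℝ → ℝ,
      RelaxationAP.IsDatum N₀ B u₀ → RelaxationAP.IsDatum N₀ B v₀ →
        ∃ u v : ℝ → ℝ → ℝ, RelaxationAP.IsWeakSolution R a ε u₀ v₀ u v) ∧
    -- the numerical solution converges to the weak solution in `L¹_loc([0, ∞) × ℝ)` as `h → 0`
    -- under the CFL condition (the origin `ξ` of the grid may vary with the steps)
    (∀ ε : ℝ, 0 < ε → ∀ u₀ v₀ : ℝ → ℝ,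
      RelaxationAP.IsDatum N₀ B u₀ → RelaxationAP.IsDatum N₀ B v₀ →
      ∀ u v : ℝ → ℝ → ℝ, RelaxationAP.IsWeakSolution R a ε u₀ v₀ u v →
      ∀ ξ : ℝ × ℝ → ℝ, ∀ K : Set (ℝ × ℝ), IsCompact K → K ⊆ Ici 0 ×ˢ univ →
        Tendsto
          (fun s : ℝ × ℝ => ∫⁻ p in K,
            (‖RelaxationAP.numU R A a β ε (ξ s) s.1 s.2 u₀ v₀ p.1 p.2 - u p.1 p.2‖ₑ
              + ‖RelaxationAP.numV R A a β ε (ξ s) s.1 s.2 u₀ v₀ p.1 p.2 - v p.1 p.2‖ₑ))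
          (𝓝[{s : ℝ × ℝ | RelaxationAP.CFL a s.1 s.2}] (0, 0)) (𝓝 0)) ∧
    -- the error estimate, with a constant uniform in `ε`, the data, the grid and the steps
    (∀ T M : ℝ, ∃ C : ℝ, ∀ ε : ℝ, 0 < ε → ε ≤ M → ∀ u₀ v₀ : ℝ → ℝ,
      RelaxationAP.IsDatum N₀ B u₀ → RelaxationAP.IsDatum N₀ B v₀ →
      ∀ u v : ℝ → ℝ → ℝ, RelaxationAP.IsWeakSolution R a ε u₀ v₀ u v →
      ∀ ξ Δt Δx : ℝ, RelaxationAP.CFL a Δt Δx → Δx ≤ M → ∀ t ∈ Icc 0 T,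
        eLpNorm (fun x => RelaxationAP.numU R A a β ε ξ Δt Δx u₀ v₀ t x - u t x) 1 volume
          + eLpNorm (fun x => RelaxationAP.numV R A a β ε ξ Δt Δx u₀ v₀ t x - v t x) 1 volume
        ≤ ENNReal.ofReal
            (C / ε * (Δt * ((∫ x, |v₀ x - A (u₀ x)|) / ε + 1) + √Δx))) := by
  subst hβ
  -- For `N₀ < 0` there are no admissible data and every claim is vacuous.
  rcases lt_or_ge N₀ 0 with hN0 | hN0
  · exact ⟨fun ε _ u₀ v₀ hu _ => absurd hu.nonneg hN0.not_ge,
      fun ε _ u₀ v₀ hu _ => absurd hu.nonneg hN0.not_ge,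
      fun T M => ⟨0, fun ε _ _ u₀ v₀ hu _ => absurd hu.nonneg hN0.not_ge⟩⟩
  have ha1 : √a₀ < √a := (le_max_left _ _).trans_lt ha
  have hsub : g (RelaxationAP.boundV A N₀ a₀) / β₀ (RelaxationAP.boundV A N₀ a₀) ≤ √a :=
    ((le_max_right _ _).trans_lt ha).le
  have hc : 0 < √a := (Real.sqrt_nonneg _).trans_lt ha1
  have hapos : 0 < a := Real.sqrt_pos.1 hc
  have hU := RelaxationAP.boundU_nonneg (a₀ := a₀) hN0
  have hNU := RelaxationAP.le_boundU (a₀ := a₀) hN0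
  have hUV := RelaxationAP.boundU_le_boundV A N₀ a₀
  have hN := RelaxationAP.le_mul_boundU_sub hN0 ha₀ ha1
  have hr := hR.isGlobalTerm (hU.trans hUV) hc hsub
  refine ⟨fun ε hε u₀ v₀ hu hv => ?_, fun ε hε u₀ v₀ hu hv u v hs ξ K hK hK0 => ?_, fun T M => ?_⟩
  · obtain ⟨f, -, -, u, v, hs, -⟩ := RelaxationAP.exists_flow hapos hU hUV hN hr hε hu hv
    exact ⟨u, v, hs⟩
  · exact RelaxationAP.tendsto_scheme hR hapos hU hNU hUV hN hr hε hu hv hs ξ hK hK0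
  · exact RelaxationAP.exists_error_bound hR hapos hU hNU hUV hN hr T M
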